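/- Let $\Lambda$ be the von Mangoldt function and, for positive integers $n$, let $r_2(n)=\sum_{m+m'=n}\Lambda(m)\Lambda(m')$, the sum being over positive integers $m,m'$. Assume the Riemann Hypothesis. Then, for integers $N\ge 2$, $$\sum_{n\le N} r_2(n)=\frac12 N^2-2\sum_{\rho}\frac{N^{\rho+1}}{\rho(\rho+1)}+O\big(N(\log N)^3\big),$$ where $\rho$ runs over the nontrivial zeros of the Riemann zeta function $\zeta(s)$ (those with $0<\operatorname{Re}\rho<1$), counted with multiplicity, the sum over $\rho$ is absolutely convergent, and the implied constant is absolute. -/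

import Mathlib

/-- The nontrivial zeros of the Riemann zeta function: its zeros in the critical strip
`0 < Re ρ < 1`, as a set (multiplicities are recorded by `zetaZeroMult`). -/
def nontrivialZetaZeros : Set ℂ :=
  {ρ : ℂ | riemannZeta ρ = 0 ∧ 0 < ρ.re ∧ ρ.re < 1}

/-- The multiplicity of `ρ` as a zero of the Riemann zeta function. -/
noncomputable def zetaZeroMult (ρ : ℂ) : ℕ :=
  analyticOrderNatAt riemannZeta ρ

/-- The weighted number of Goldbach representations
`r₂(n) = ∑_{m + m' = n} Λ(m) Λ(m')`.
The terms with `m = 0` or `m' = 0` vanish because `Λ 0 = 0`. -/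
noncomputable def goldbachR2 (n : ℕ) : ℝ :=
  ∑ p ∈ Finset.HasAntidiagonal.antidiagonal n,
    ArithmeticFunction.vonMangoldt p.1 * ArithmeticFunction.vonMangoldt p.2

/-- The contribution `N ^ (ρ + 1) / (ρ (ρ + 1))` of a zero `ρ`, repeated according to its
multiplicity. -/
noncomputable def zetaZeroTerm (N : ℕ) (ρ : ℂ) : ℂ :=
  (zetaZeroMult ρ : ℂ) * ((N : ℂ) ^ (ρ + 1) / (ρ * (ρ + 1)))

/-! Write `Λ = 1 + (Λ - 1)` in both factors of `r₂` and sum over `n ≤ N`. The terms with at most one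
`Λ - 1` are elementary or equal to the Cesàro sum `psiOne`, whose explicit formula gives the main
term and the sum over zeros (`psiOne_add_tsum_eq`, with remainder `O(N log N)`). What remains is the
correlation of `Λ - 1` with `ψ(k) - k`, which is `shiftCorr psiErr N 1`.

This correlation is bounded without exponential sums. Let `S(h)` be the correlation of the
`h`-increments of `C = psiErr` with the reflected sequence `C(N - y)`. Moving half of `S(2h)` by `h`
shows that `2 S(h) - S(2h)` is a correlation of `h`-increments with `h`-increments, hence at most
their second moment. If that moment is at most `h B` for all `h ≥ 1`, doubling `h` until it exceeds
`N` gives `S(1) ≪ B log N` (`abs_shiftCorr_one_le_log`).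

Under RH one can take `B ≪ N (log N)^2`. This is a mean square estimate for `ψ(x + h) - ψ(x) - h`
over dyadic intervals, of size `h X (log N)^2` (`exists_lintegral_psiRem_le`). A smoothed explicit
formula writes `ψ(x) - x` as a sum over zeros plus a regular part. A Gaussian large sieve
(`lintegral_normSq_gaussian_le`) bounds the mean square of each; the zeros are split at height `X /
h`, the low ones being estimated through the derivative in `x` and the high ones trivially.

The explicit formula comes from Mellin inversion. The Mellin transform of `smoothErr` is `-ζ'/ζ`
with its pole at `1` and its poles at the nontrivial zeros removed, divided by `s (s + 1)`. Landau's
lemma on discs centred at `2 + i t` shows that this regular part is holomorphic for `0 < Re s < 4`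
and `O((1 + |t|)^(3/8))` there, so the line of integration moves to `Re s = δ` without residues. The
choice `δ = 1 / (2 log N)` keeps `x ^ δ` bounded at the price of powers of `1 / δ ≍ log N`. Neither
the functional equation nor the Hadamard product is used. -/

namespace GoldbachAverage

/-! ### Correlations of a sequence with its reflection, and the doubling argument. -/

open Finset

/-- The smoothed additive correlation of a sequence with its reflection. -/
noncomputable def shiftCorr (C : ℕ → ℝ) (N h : ℕ) : ℝ :=
  ∑ y ∈ range (N + 1), (C y - C (y - h)) * C (N - y)

/-- The second moment of the increments of a sequence. -/
noncomputable def incrMoment (C : ℕ → ℝ) (N h : ℕ) : ℝ :=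
  ∑ y ∈ range (N + 1), (C y - C (y - h)) ^ 2

lemma incrMoment_nonneg (C : ℕ → ℝ) (N h : ℕ) : 0 ≤ incrMoment C N h :=
  sum_nonneg fun _ _ => sq_nonneg _

/-- This is the substitution `y ↦ y - h`. Truncated subtraction together with `C 0 = 0` extends `C`
by zero to negative arguments, so the unmatched terms at both ends vanish. -/
lemma sum_shift_eq {C : ℕ → ℝ} (hC : C 0 = 0) (N h : ℕ) :
    ∑ y ∈ range (N + 1), (C (y - h) - C (y - 2 * h)) * C (N - y) =
      ∑ y ∈ range (N + 1), (C y - C (y - h)) * C (N - y - h) := by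
  refine Finset.sum_bij_ne_zero (fun y _ _ => y - h) ?_ ?_ ?_ ?_
  · intro y hy _
    simp only [mem_range] at hy ⊢
    omega
  · intro a ha ha' b hb hb' hab
    have key : ∀ y, (C (y - h) - C (y - 2 * h)) * C (N - y) ≠ 0 → h ≤ y := by
      intro y hy
      by_contra hlt
      apply hy
      rw [show y - h = 0 by omega, show y - 2 * h = 0 by omega]
      simp
    have := key a ha'
    have := key b hb'
    omega
  · intro y hy hy'
    have h1 : h + y ≤ N := by
      by_contra hlt
      apply hy'
      rw [show N - y - h = 0 by omega, hC]
      simp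
    refine ⟨y + h, by simp only [mem_range]; omega, ?_, by omega⟩
    rw [show y + h - h = y by omega, show y + h - 2 * h = y - h by omega,
      show N - (y + h) = N - y - h by omega]
    exact hy'
  · intro y hy hy'
    have h1 : h ≤ y := by
      by_contra hlt
      apply hy'
      rw [show y - h = 0 by omega, show y - 2 * h = 0 by omega]
      simp
    rw [show y - h - h = y - 2 * h by omega, show N - (y - h) - h = N - y by omega]

/-- A `2h`-increment is the sum of two consecutive `h`-increments. Shifting the second one onto the
first moves the shift to the reflected factor, so the difference pairs `h`-increments with reflected
`h`-increments; AM-GM and the symmetry `y ↦ N - y` finish. -/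
lemma abs_two_mul_shiftCorr_sub_le {C : ℕ → ℝ} (hC : C 0 = 0) (N h : ℕ) :
    |2 * shiftCorr C N h - shiftCorr C N (2 * h)| ≤ incrMoment C N h := by
  have e : 2 * shiftCorr C N h - shiftCorr C N (2 * h) =
      ∑ y ∈ range (N + 1), (C y - C (y - h)) * (C (N - y) - C (N - y - h)) := by
    simp only [mul_sub (C _ - C _)]
    rw [sum_sub_distrib, ← sum_shift_eq hC, shiftCorr, shiftCorr, mul_sum, ← sum_sub_distrib,
      ← sum_sub_distrib]
    exact sum_congr rfl fun y _ => by ring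
  rw [e]
  have r : ∑ y ∈ range (N + 1), (C (N - y) - C (N - y - h)) ^ 2 = incrMoment C N h := by
    rw [incrMoment, ← sum_range_reflect]
    refine sum_congr rfl fun y hy => ?_
    rw [mem_range] at hy
    rw [show N + 1 - 1 - y = N - y by omega, show N - (N - y) = y by omega]
  calc _ ≤ ∑ y ∈ range (N + 1), |(C y - C (y - h)) * (C (N - y) - C (N - y - h))| :=
        abs_sum_le_sum_abs _ _
    _ ≤ ∑ y ∈ range (N + 1),
        ((C y - C (y - h)) ^ 2 / 2 + (C (N - y) - C (N - y - h)) ^ 2 / 2) := by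
        refine sum_le_sum fun y _ => ?_
        rw [abs_le]
        constructor <;>
          nlinarith [sq_nonneg ((C y - C (y - h)) + (C (N - y) - C (N - y - h))),
            sq_nonneg ((C y - C (y - h)) - (C (N - y) - C (N - y - h)))]
    _ = incrMoment C N h := by
        rw [sum_add_distrib, ← sum_div, ← sum_div, r, incrMoment]
        ring

/-- This ends the doubling: once `h > N` every increment is the full value `C y`. -/
lemma abs_shiftCorr_le_of_lt {C : ℕ → ℝ} (hC : C 0 = 0) {N h : ℕ} (hN : N < h) :
    |shiftCorr C N h| ≤ incrMoment C N h := by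
  have e1 : shiftCorr C N h = ∑ y ∈ range (N + 1), C y * C (N - y) := by
    refine sum_congr rfl fun y hy => ?_
    rw [mem_range] at hy
    rw [show y - h = 0 by omega, hC, sub_zero]
  have e2 : incrMoment C N h = ∑ y ∈ range (N + 1), C y ^ 2 := by
    refine sum_congr rfl fun y hy => ?_
    rw [mem_range] at hy
    rw [show y - h = 0 by omega, hC, sub_zero]
  have r : ∑ y ∈ range (N + 1), C (N - y) ^ 2 = ∑ y ∈ range (N + 1), C y ^ 2 := by
    rw [← sum_range_reflect]
    exact sum_congr rfl fun y hy => by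
      rw [mem_range] at hy
      rw [show N - (N + 1 - 1 - y) = y by omega]
  rw [e1, e2]
  calc _ ≤ ∑ y ∈ range (N + 1), |C y * C (N - y)| := abs_sum_le_sum_abs _ _
    _ ≤ ∑ y ∈ range (N + 1), (C y ^ 2 / 2 + C (N - y) ^ 2 / 2) := by
        refine sum_le_sum fun y _ => ?_
        rw [abs_le]
        constructor <;>
          nlinarith [sq_nonneg (C y + C (N - y)), sq_nonneg (C y - C (N - y))]
    _ = _ := by
        rw [sum_add_distrib, ← sum_div, ← sum_div, r]
        ring

/-- The normalised quantity `shiftCorr C N (2 ^ K) / 2 ^ K` changes by at most `B / 2` at each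
doubling. -/
lemma abs_shiftCorr_one_le {C : ℕ → ℝ} (hC : C 0 = 0) {N : ℕ} {B : ℝ}
    (hB : ∀ h, 1 ≤ h → incrMoment C N h ≤ h * B) (K : ℕ) :
    |shiftCorr C N 1| ≤ |shiftCorr C N (2 ^ K)| / 2 ^ K + K * (B / 2) := by
  induction K with
  | zero => simp
  | succ K ih =>
    have h1 := abs_two_mul_shiftCorr_sub_le hC N (2 ^ K)
    have h2 := hB (2 ^ K) Nat.one_le_two_pow
    rw [show 2 * 2 ^ K = 2 ^ (K + 1) by ring] at h1
    push_cast at h2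
    have h3 : |2 * shiftCorr C N (2 ^ K)| ≤ |shiftCorr C N (2 ^ (K + 1))| + 2 ^ K * B := by
      have := abs_sub_abs_le_abs_sub (2 * shiftCorr C N (2 ^ K)) (shiftCorr C N (2 ^ (K + 1)))
      linarith
    rw [abs_mul, abs_two] at h3
    have h4 : |shiftCorr C N (2 ^ K)| / 2 ^ K ≤ |shiftCorr C N (2 ^ (K + 1))| / 2 ^ (K + 1) + B / 2 := by
      have h2K : (0 : ℝ) < 2 ^ K := by positivity
      rw [div_le_iff₀ h2K, add_mul]
      have : |shiftCorr C N (2 ^ (K + 1))| / 2 ^ (K + 1) * 2 ^ K =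
          |shiftCorr C N (2 ^ (K + 1))| / 2 := by
        rw [pow_succ (2 : ℝ)]
        field_simp
      linarith
    push_cast
    linarith

lemma abs_shiftCorr_one_le_log {C : ℕ → ℝ} (hC : C 0 = 0) {N : ℕ} (hN : 2 ≤ N) {B : ℝ}
    (hB : ∀ h, 1 ≤ h → incrMoment C N h ≤ h * B) :
    |shiftCorr C N 1| ≤ 4 * B * Real.log N := by
  have hB0 : 0 ≤ B := by
    have := hB 1 le_rfl
    have := incrMoment_nonneg C N 1
    push_cast at *
    linarith
  -- With this `K` the shift `2 ^ K` exceeds `N`, so the terminal correlation is at most `2 ^ K *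
  -- B`.
  have h1 := abs_shiftCorr_one_le hC hB (Nat.log 2 N + 1)
  have h2 : |shiftCorr C N (2 ^ (Nat.log 2 N + 1))| / 2 ^ (Nat.log 2 N + 1) ≤ B := by
    rw [div_le_iff₀ (by positivity)]
    refine (abs_shiftCorr_le_of_lt hC (Nat.lt_pow_succ_log_self one_lt_two N)).trans ?_
    have := hB (2 ^ (Nat.log 2 N + 1)) Nat.one_le_two_pow
    push_cast at this
    linarith
  have h3 : (Nat.log 2 N : ℝ) * Real.log 2 ≤ Real.log N := by
    rw [← Real.log_pow]
    refine Real.log_le_log (by positivity) ?_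
    exact_mod_cast Nat.pow_log_le_self 2 (by omega)
  have h4 : Real.log 2 ≤ Real.log N := Real.log_le_log (by norm_num) (by exact_mod_cast hN)
  have h5 := Real.log_two_gt_d9
  have h6 : (0 : ℝ) ≤ Nat.log 2 N := Nat.cast_nonneg _
  have h7 : (Nat.log 2 N : ℝ) ≤ 2 * Real.log N := by nlinarith
  push_cast at h1
  nlinarith

lemma sum_range_le_of_blocks {f : ℕ → ℝ} (hf : ∀ y, 0 ≤ f y) (hf0 : f 0 = 0) {N : ℕ} {B : ℝ}
    (hb : ∀ Y, 1 ≤ Y → Y ≤ N → ∑ y ∈ Ico Y (2 * Y), f y ≤ B * (Y : ℝ) ^ 2) (hB : 0 ≤ B)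
    (n : ℕ) (hn : n ≤ N + 1) : ∑ y ∈ range n, f y ≤ 2 * B * (n : ℝ) ^ 2 := by
  induction n using Nat.strong_induction_on with
  | _ n ih =>
    rcases Nat.lt_or_ge n 2 with h | h
    · interval_cases n
      · simp
      · simp [hf0, hB]
    · set Y := (n + 1) / 2 with hY
      have h1 : ∑ y ∈ range n, f y ≤ ∑ y ∈ range (2 * Y), f y :=
        sum_le_sum_of_subset_of_nonneg (range_subset_range.2 (by omega)) fun _ _ _ => hf _
      rw [← sum_range_add_sum_Ico _ (show Y ≤ 2 * Y by omega)] at h1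
      have h2 := ih Y (by omega) (by omega)
      -- The block `[Y, 2Y)` with `Y = ⌈n / 2⌉` covers the top half. Since `Y ≤ 3 n / 4` for `n ≥
      -- 2`, the induction closes because `3 * 9 / 16 < 2`.
      have h3 := hb Y (by omega) (by omega)
      have h4 : (Y : ℝ) ≤ 3 / 4 * n := by
        have : 4 * Y ≤ 3 * n := by omega
        have : (4 * Y : ℝ) ≤ 3 * n := by exact_mod_cast this
        linarith
      have h5 : (Y : ℝ) ^ 2 ≤ 9 / 16 * (n : ℝ) ^ 2 := by
        have : (0 : ℝ) ≤ Y := Nat.cast_nonneg _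
        nlinarith
      nlinarith [sq_nonneg (n : ℝ)]

lemma sum_Ico_le_of_blocks {f : ℕ → ℝ} (hf : ∀ y, 0 ≤ f y) {N h : ℕ} {B : ℝ} (hh : 1 ≤ h)
    (hb : ∀ Y, h ≤ Y → Y ≤ N → ∑ y ∈ Ico Y (2 * Y), f y ≤ B * (Y : ℝ)) (hB : 0 ≤ B)
    (n : ℕ) (hn : n ≤ N + 1) : ∑ y ∈ Ico h n, f y ≤ 3 * B * (n : ℝ) := by
  induction n using Nat.strong_induction_on with
  | _ n ih =>
    rcases Nat.lt_or_ge h n with h' | h'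
    -- Blocks are available only from `h` on, hence the maximum; if it equals `h`, a single block
    -- covers everything. Otherwise `Y ≤ 3 n / 4`, and the constant `3` satisfies `(3 + 1) * 3 / 4 =
    -- 3`.
    · set Y := max h ((n + 1) / 2) with hY
      have h1 : ∑ y ∈ Ico h n, f y ≤ ∑ y ∈ Ico h (2 * Y), f y :=
        sum_le_sum_of_subset_of_nonneg (Ico_subset_Ico le_rfl (by omega)) fun _ _ _ => hf _
      rw [← sum_Ico_consecutive _ (show h ≤ Y by omega) (show Y ≤ 2 * Y by omega)] at h1
      have h3 := hb Y (by omega) (by omega)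
      rcases eq_or_ne Y h with hYh | hYh
      · rw [hYh, Ico_self, sum_empty] at h1
        rw [hYh] at h3
        have : (h : ℝ) ≤ n := by exact_mod_cast h'.le
        nlinarith
      · have h2 := ih Y (by omega) (by omega)
        have h4 : (Y : ℝ) ≤ 3 / 4 * n := by
          have : 4 * Y ≤ 3 * n := by omega
          have : (4 * Y : ℝ) ≤ 3 * n := by exact_mod_cast this
          linarith
        nlinarith
    · rw [Ico_eq_empty_of_le h']
      simp
      positivity

/-- The increment bounds hold only for blocks starting at `Y ≥ h`. For `y ≥ 2h` the lower endpoint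
`y - h` is at least `h`, so they apply; for `y < 2h` the increments are bounded by the values
themselves. -/
lemma incrMoment_le_of_blocks {C : ℕ → ℝ} (hC : C 0 = 0) {N : ℕ} (hN : 1 ≤ N) {B : ℝ} (hB : 0 ≤ B)
    (h1 : ∀ Y, 1 ≤ Y → Y ≤ N → ∑ y ∈ Ico Y (2 * Y), C y ^ 2 ≤ B * (Y : ℝ) ^ 2)
    (h2 : ∀ h Y, 1 ≤ h → h ≤ Y → Y ≤ N →
      ∑ y ∈ Ico Y (2 * Y), (C (y + h) - C y) ^ 2 ≤ B * h * (Y : ℝ)) (h : ℕ) (hh : 1 ≤ h) :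
    incrMoment C N h ≤ h * (60 * B * N) := by
  have hN' : (1 : ℝ) ≤ N := by exact_mod_cast hN
  have hh' : (1 : ℝ) ≤ h := by exact_mod_cast hh
  have key : ∀ n, n ≤ N + 1 → ∑ y ∈ range n, C y ^ 2 ≤ 2 * B * (n : ℝ) ^ 2 := fun n hn =>
    sum_range_le_of_blocks (fun y => sq_nonneg _) (by simp [hC]) h1 hB n hn
  have hsplit : incrMoment C N h ≤ ∑ y ∈ range (min (2 * h) (N + 1)), (4 * C y ^ 2)
      + ∑ y ∈ Ico h (N + 1), (C (y + h) - C y) ^ 2 := by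
    rw [incrMoment]
    have : range (N + 1) = (range (N + 1)).filter (· < 2 * h) ∪
        (range (N + 1)).filter (fun y => ¬ y < 2 * h) := by rw [filter_union_filter_not_eq]
    rw [← sum_filter_add_sum_filter_not (range (N + 1)) (· < 2 * h)]
    refine add_le_add ?_ ?_
    · have e : (range (N + 1)).filter (· < 2 * h) = range (min (2 * h) (N + 1)) := by
        ext y; simp only [mem_filter, mem_range]; omega
      rw [e]
      set M := min (2 * h) (N + 1)
      calc ∑ y ∈ range M, (C y - C (y - h)) ^ 2
          ≤ ∑ y ∈ range M, (2 * C y ^ 2 + 2 * C (y - h) ^ 2) := by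
            refine sum_le_sum fun y _ => ?_
            nlinarith [sq_nonneg (C y + C (y - h))]
        _ = 2 * ∑ y ∈ range M, C y ^ 2 + 2 * ∑ y ∈ range M, C (y - h) ^ 2 := by
            rw [sum_add_distrib, mul_sum, mul_sum]
        _ ≤ 2 * ∑ y ∈ range M, C y ^ 2 + 2 * ∑ y ∈ range M, C y ^ 2 := by
            have : ∑ y ∈ range M, C (y - h) ^ 2 ≤ ∑ y ∈ range M, C y ^ 2 := by
              have e2 : ∑ y ∈ range M, C (y - h) ^ 2 =
                  ∑ y ∈ (range M).filter (h ≤ ·), C (y - h) ^ 2 := by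
                rw [sum_filter]
                refine sum_congr rfl fun y _ => ?_
                split_ifs with hy
                · rfl
                · rw [show y - h = 0 by omega, hC]; simp
              have e3 : ∑ y ∈ (range M).filter (h ≤ ·), C (y - h) ^ 2 =
                  ∑ z ∈ ((range M).filter (h ≤ ·)).image (· - h), C z ^ 2 := by
                rw [sum_image]
                intro a ha b hb hab
                simp only [coe_filter, mem_range, Set.mem_ofPred_eq] at ha hb hab
                omega
              rw [e2, e3]
              refine sum_le_sum_of_subset_of_nonneg ?_ fun _ _ _ => sq_nonneg _
              intro z hz
              simp only [mem_image, mem_filter, mem_range] at hz ⊢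
              omega
            linarith
        _ = _ := by rw [← mul_sum]; ring
    · have e3 : ∑ y ∈ (range (N + 1)).filter (fun y => ¬ y < 2 * h), (C y - C (y - h)) ^ 2 =
          ∑ z ∈ ((range (N + 1)).filter (fun y => ¬ y < 2 * h)).image (· - h),
            (C (z + h) - C z) ^ 2 := by
        rw [sum_image]
        · refine sum_congr rfl fun y hy => ?_
          simp only [mem_filter, mem_range] at hy
          rw [show y - h + h = y by omega]
        · intro a ha b hb hab
          simp only [coe_filter, mem_range, Set.mem_ofPred_eq] at ha hb hab
          omega
      rw [e3]
      refine sum_le_sum_of_subset_of_nonneg ?_ fun _ _ _ => sq_nonneg _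
      intro z hz
      simp only [mem_image, mem_filter, mem_range, mem_Ico] at hz ⊢
      omega
  have ha := key (min (2 * h) (N + 1)) (min_le_right _ _)
  have hb := sum_Ico_le_of_blocks (f := fun y => (C (y + h) - C y) ^ 2) (fun y => sq_nonneg _) hh
    (N := N) (B := B * h) (fun Y hY hY' => h2 h Y hh hY hY') (by positivity) (N + 1) le_rfl
  rw [← mul_sum] at hsplit
  -- One factor of the square is bounded by each entry of the minimum; this makes the short range
  -- linear in `h`.
  have hm : ((min (2 * h) (N + 1) : ℕ) : ℝ) ^ 2 ≤ 2 * h * (N + 1) := by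
    rw [sq]
    refine mul_le_mul ?_ ?_ (Nat.cast_nonneg _) (by positivity)
    · exact_mod_cast min_le_left _ _
    · exact_mod_cast min_le_right _ _
  push_cast at hb hm ha
  have : B * (h * (N + 1)) ≤ B * (h * (2 * N)) := by gcongr; linarith
  nlinarith [mul_le_mul_of_nonneg_left hm hB]

/-! ### The Goldbach sum in terms of `psiErr` and `psiOne`. -/

open ArithmeticFunction in
/-- `ψ(n) - n`. -/
noncomputable def psiErr (n : ℕ) : ℝ := ∑ m ∈ Icc 1 n, (vonMangoldt m - 1)

lemma psiErr_zero : psiErr 0 = 0 := by simp [psiErr]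

open ArithmeticFunction in
/-- The Cesàro-smoothed Chebyshev function at integers. -/
noncomputable def psiOne (N : ℕ) : ℝ := ∑ m ∈ Icc 1 N, vonMangoldt m * (N - m)

open ArithmeticFunction in
lemma sum_antidiagonal_upto (f g : ℕ → ℝ) (hf : f 0 = 0) (hg : g 0 = 0) (N : ℕ) :
    ∑ n ∈ Icc 1 N, ∑ p ∈ antidiagonal n, f p.1 * g p.2 =
      ∑ m ∈ Icc 1 N, f m * ∑ k ∈ Icc 1 (N - m), g k := by
  simp_rw [mul_sum]
  rw [sum_sigma', sum_sigma']
  refine sum_bij_ne_zero (fun x _ _ => ⟨x.2.1, x.2.2⟩) ?_ ?_ ?_ ?_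
  · rintro ⟨n, a, b⟩ hx hne
    simp only [mem_sigma, mem_Icc, HasAntidiagonal.mem_antidiagonal] at hx ⊢
    have ha : a ≠ 0 := by rintro rfl; simp [hf] at hne
    have hb : b ≠ 0 := by rintro rfl; simp [hg] at hne
    omega
  · rintro ⟨n, a, b⟩ hx hne ⟨n', a', b'⟩ hx' hne' h
    simp only [mem_sigma, mem_Icc, HasAntidiagonal.mem_antidiagonal] at hx hx'
    simp only [Sigma.mk.injEq, heq_eq_eq] at h
    obtain ⟨rfl, rfl⟩ := h
    obtain rfl : n = n' := by omega
    rfl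
  · rintro ⟨a, b⟩ hx hne
    simp only [mem_sigma, mem_Icc] at hx
    refine ⟨⟨a + b, a, b⟩, ?_, hne, rfl⟩
    simp only [mem_sigma, mem_Icc, HasAntidiagonal.mem_antidiagonal, and_true]
    omega
  · rintro ⟨n, a, b⟩ hx hne
    rfl

open ArithmeticFunction in
-- The unit increments of `psiErr` are `Λ(y) - 1`, so the correlation is `∑ (Λ(m) - 1)(ψ(N - m) - (N
-- - m))`; expanding the product gives the identity.
lemma sum_goldbachR2 (N : ℕ) :
    ∑ n ∈ Icc 1 N, goldbachR2 n =
      shiftCorr psiErr N 1 + 2 * psiOne N - ((N : ℝ) ^ 2 - N) / 2 := by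
  have e1 : shiftCorr psiErr N 1 = ∑ m ∈ Icc 1 N, (vonMangoldt m - 1) * psiErr (N - m) := by
    rw [shiftCorr, range_eq_Ico, sum_eq_sum_Ico_succ_bot (by omega)]
    simp only [zero_le, Nat.sub_eq_zero_of_le, sub_self, zero_mul, zero_add]
    refine sum_congr (by ext; simp) fun y hy => ?_
    simp only [mem_Icc] at hy
    obtain ⟨z, rfl⟩ : ∃ z, y = z + 1 := ⟨y - 1, by omega⟩
    rw [psiErr, Nat.add_sub_cancel, psiErr, sum_Icc_succ_top (by omega)]
    ring
  have e2 : ∑ n ∈ Icc 1 N, goldbachR2 n =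
      ∑ m ∈ Icc 1 N, vonMangoldt m * ∑ k ∈ Icc 1 (N - m), vonMangoldt k :=
    sum_antidiagonal_upto _ _ (by simp) (by simp) N
  -- Both sides count pairs `m + k ≤ N` of positive integers with weight `Λ` on one coordinate; the
  -- swap of the antidiagonal exchanges the roles.
  have e3 : ∑ m ∈ Icc 1 N, ∑ k ∈ Icc 1 (N - m), vonMangoldt k = psiOne N := by
    have := sum_antidiagonal_upto (fun m => vonMangoldt m) (fun m => if m = 0 then 0 else 1)
      (by simp) (by simp) N
    have h2 := sum_antidiagonal_upto (fun m => if m = 0 then 0 else 1) (fun m => vonMangoldt m)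
      (by simp) (by simp) N
    have h3 : ∀ n : ℕ, ∑ p ∈ antidiagonal n, vonMangoldt p.1 * (if p.2 = 0 then (0 : ℝ) else 1) =
        ∑ p ∈ antidiagonal n, (if p.1 = 0 then (0 : ℝ) else 1) * vonMangoldt p.2 := by
      intro n
      rw [← Nat.sum_antidiagonal_swap]
      exact sum_congr rfl fun p _ => by simp [mul_comm]
    simp only [h3] at this
    rw [this] at h2
    rw [psiOne]
    have h4 : ∀ m ∈ Icc 1 N, vonMangoldt m * ∑ k ∈ Icc 1 (N - m), (if k = 0 then (0 : ℝ) else 1) =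
        vonMangoldt m * (N - m) := by
      intro m hm
      simp only [mem_Icc] at hm
      congr 1
      rw [sum_congr rfl (g := fun _ => (1 : ℝ)) (fun k hk => by
        simp only [mem_Icc] at hk; rw [if_neg (by omega)])]
      simp [Nat.cast_sub hm.2]
    rw [sum_congr rfl h4] at h2
    rw [h2]
    refine sum_congr rfl fun m hm => ?_
    simp only [mem_Icc] at hm
    rw [if_neg (by omega), one_mul]
  have e4 : ∑ m ∈ Icc 1 N, ((N : ℝ) - m) = ((N : ℝ) ^ 2 - N) / 2 := by
    rw [sum_sub_distrib]
    have : ∀ n : ℕ, ∑ m ∈ Icc 1 n, (m : ℝ) = n * (n + 1) / 2 := by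
      intro n
      induction n with
      | zero => simp
      | succ n ih => rw [sum_Icc_succ_top (by omega), ih]; push_cast; ring
    rw [this]
    simp
    ring
  have e5 : ∀ m ∈ Icc 1 N, psiErr (N - m) = ∑ k ∈ Icc 1 (N - m), vonMangoldt k - (N - m) := by
    intro m hm
    simp only [mem_Icc] at hm
    rw [psiErr, sum_sub_distrib]
    simp [Nat.cast_sub hm.2]
  have e6 : shiftCorr psiErr N 1 = ∑ m ∈ Icc 1 N,
      (vonMangoldt m - 1) * (∑ k ∈ Icc 1 (N - m), vonMangoldt k - (N - m)) :=
    e1.trans (sum_congr rfl fun m hm => by rw [e5 m hm])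
  rw [e6, e2]
  simp_rw [sub_mul, mul_sub, one_mul]
  have e7 : ∑ m ∈ Icc 1 N, (vonMangoldt m * (N : ℝ) - vonMangoldt m * m) = psiOne N :=
    sum_congr rfl fun m _ => by ring
  simp only [sum_sub_distrib] at e3 e4 e7 ⊢
  linarith

end GoldbachAverage

/-! ### A large sieve with Gaussian weight. -/

namespace GoldbachAverage

open MeasureTheory Complex
open scoped ENNReal ComplexConjugate

lemma integral_gaussian_twist (t : ℝ) :
    ∫ u : ℝ, cexp (I * t * u) * cexp (-(1 : ℂ) * u ^ 2) =
      ((√Real.pi * Real.exp (-t ^ 2 / 4) : ℝ) : ℂ) := by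
  rw [fourierIntegral_gaussian (b := 1) (by simp) t]
  push_cast
  rw [Real.sqrt_eq_rpow, Complex.ofReal_cpow Real.pi_pos.le]
  simp

section
variable {Ω : Type*} [MeasurableSpace Ω] {ν : Measure Ω} [SFinite ν] {τ : Ω → ℝ}

/-- Expand the square as a double integral, exchange by Fubini, and use that the Fourier transform
of a Gaussian is a Gaussian. The measure `ν` is general so that the result serves both sums over
zeros and integrals over a vertical line. -/
lemma integral_normSq_gaussian (hτ : Measurable τ) {b : Ω → ℂ} (hb : Integrable b ν) :
    Integrable (fun u : ℝ => ‖∫ ω, b ω * cexp (I * τ ω * u) ∂ν‖ ^ 2 * Real.exp (-u ^ 2)) ∧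
    ((∫ u : ℝ, ‖∫ ω, b ω * cexp (I * τ ω * u) ∂ν‖ ^ 2 * Real.exp (-u ^ 2) : ℝ) : ℂ) =
      ∫ z : Ω × Ω, b z.1 * conj (b z.2) *
        ((√Real.pi * Real.exp (-(τ z.1 - τ z.2) ^ 2 / 4) : ℝ) : ℂ) ∂(ν.prod ν) := by
  have hconj : Integrable (fun ω => conj (b ω)) ν :=
    ((Complex.conjLIE.toContinuousLinearEquiv : ℂ →L[ℝ] ℂ).integrable_comp hb)
  have step1 : ∀ u : ℝ,
      ((‖∫ ω, b ω * cexp (I * τ ω * u) ∂ν‖ ^ 2 * Real.exp (-u ^ 2) : ℝ) : ℂ) =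
      ∫ z : Ω × Ω, b z.1 * conj (b z.2) *
        (cexp (I * ((τ z.1 - τ z.2 : ℝ) : ℂ) * u) * cexp (-(1 : ℂ) * u ^ 2)) ∂(ν.prod ν) := by
    intro u
    have e1 : ((‖∫ ω, b ω * cexp (I * τ ω * u) ∂ν‖ ^ 2 : ℝ) : ℂ) =
        (∫ ω, b ω * cexp (I * τ ω * u) ∂ν) * ∫ ω, conj (b ω * cexp (I * τ ω * u)) ∂ν := by
      rw [integral_conj, Complex.mul_conj, Complex.normSq_eq_norm_sq]
    rw [Complex.ofReal_mul, e1, ← integral_prod_mul, ← integral_mul_const]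
    congr 1
    ext z
    rw [map_mul, ← Complex.exp_conj]
    simp only [map_mul, conj_I, conj_ofReal]
    have : cexp (I * ((τ z.1 - τ z.2 : ℝ) : ℂ) * u) =
        cexp (I * τ z.1 * u) * cexp (-I * τ z.2 * u) := by
      rw [← Complex.exp_add]; push_cast; ring_nf
    rw [this]
    push_cast
    ring_nf
  have hint : Integrable (Function.uncurry fun (u : ℝ) (z : Ω × Ω) => b z.1 * conj (b z.2) *
        (cexp (I * ((τ z.1 - τ z.2 : ℝ) : ℂ) * u) * cexp (-(1 : ℂ) * u ^ 2)))
        ((volume : Measure ℝ).prod (ν.prod ν)) := by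
    have h1 : Integrable (fun u : ℝ => cexp (-(1 : ℂ) * u ^ 2)) :=
      integrable_cexp_neg_mul_sq (by simp)
    have h2 : Integrable (fun z : Ω × Ω => b z.1 * conj (b z.2)) (ν.prod ν) := hb.mul_prod hconj
    have h3 := h1.mul_prod h2
    have h4 := h3.bdd_mul (c := 1)
      (f := fun p : ℝ × (Ω × Ω) => cexp (I * ((τ p.2.1 - τ p.2.2 : ℝ) : ℂ) * p.1)) ?_ ?_
    · refine h4.congr (Filter.Eventually.of_forall fun p => ?_)
      simp only [Function.uncurry]
      ring
    · have m1 : Measurable fun p : ℝ × (Ω × Ω) => τ p.2.1 :=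
        hτ.comp (measurable_fst.comp measurable_snd)
      have m2 : Measurable fun p : ℝ × (Ω × Ω) => τ p.2.2 :=
        hτ.comp (measurable_snd.comp measurable_snd)
      exact (Complex.measurable_exp.comp ((measurable_const.mul
        (Complex.measurable_ofReal.comp (m1.sub m2))).mul
        (Complex.measurable_ofReal.comp measurable_fst))).aestronglyMeasurable
    · refine Filter.Eventually.of_forall fun p => ?_
      rw [show I * ((τ p.2.1 - τ p.2.2 : ℝ) : ℂ) * p.1 =
        ((τ p.2.1 - τ p.2.2) * p.1 : ℝ) * I by push_cast; ring, Complex.norm_exp_ofReal_mul_I]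
  constructor
  · have h5 := hint.integral_prod_left
    have h6 : Integrable (fun u : ℝ =>
        ((‖∫ ω, b ω * cexp (I * τ ω * u) ∂ν‖ ^ 2 * Real.exp (-u ^ 2) : ℝ) : ℂ)) := by
      refine h5.congr (Filter.Eventually.of_forall fun u => ?_)
      exact (step1 u).symm
    exact h6.re.congr (Filter.Eventually.of_forall fun u => Complex.ofReal_re _)
  · rw [← integral_complex_ofReal]
    simp_rw [step1]
    rw [integral_integral_swap hint]
    congr 1
    ext z
    rw [integral_const_mul, integral_gaussian_twist]

/-- A large-sieve type inequality: the Gaussian-weighted mean square of a superposition of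
exponentials with frequencies `τ ω` and amplitudes `q ω * a ω`. -/
theorem lintegral_normSq_gaussian_le (hτ : Measurable τ) {q : Ω → ℝ} (hq : Measurable q)
    (hq0 : ∀ ω, 0 ≤ q ω) {a : Ω → ℂ} (ha : Measurable a)
    (hint : Integrable (fun ω => q ω * a ω) ν) {W : Ω → ℝ≥0∞}
    (hW : ∀ ω, ∫⁻ ω', ENNReal.ofReal (q ω' * Real.exp (-(τ ω - τ ω') ^ 2 / 4)) ∂ν ≤ W ω) :
    ∫⁻ u : ℝ, ENNReal.ofReal
        (‖∫ ω, q ω * a ω * cexp (I * τ ω * u) ∂ν‖ ^ 2 * Real.exp (-u ^ 2)) ≤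
      ENNReal.ofReal (√Real.pi) * ∫⁻ ω, ENNReal.ofReal (q ω * ‖a ω‖ ^ 2) * W ω ∂ν := by
  obtain ⟨h1, h2⟩ := integral_normSq_gaussian hτ hint
  rw [← ofReal_integral_eq_lintegral_ofReal h1
    (Filter.Eventually.of_forall fun u => by positivity)]
  set Kf : Ω × Ω → ℝ := fun z => Real.exp (-(τ z.1 - τ z.2) ^ 2 / 4) with hKf
  have hKm : Measurable Kf := by
    have m1 : Measurable fun p : Ω × Ω => τ p.1 := hτ.comp measurable_fst
    have m2 : Measurable fun p : Ω × Ω => τ p.2 := hτ.comp measurable_snd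
    exact Real.measurable_exp.comp ((((m1.sub m2).pow_const 2).neg).div_const 4)
  have mq1 : Measurable fun p : Ω × Ω => q p.1 := hq.comp measurable_fst
  have mq2 : Measurable fun p : Ω × Ω => q p.2 := hq.comp measurable_snd
  have ma1 : Measurable fun p : Ω × Ω => ‖a p.1‖ := (ha.comp measurable_fst).norm
  have ma2 : Measurable fun p : Ω × Ω => ‖a p.2‖ := (ha.comp measurable_snd).norm
  set P : Ω × Ω → ℝ≥0∞ := fun z => ENNReal.ofReal (q z.1 * ‖a z.1‖ ^ 2 * (q z.2 * Kf z)) with hP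
  have hPm : Measurable P :=
    ((mq1.mul (ma1.pow_const 2)).mul (mq2.mul hKm)).ennreal_ofReal
  -- The kernel depends only on `(τ z.1 - τ z.2) ^ 2`, so the two halves produced below by AM-GM
  -- have the same integral and only the row sums `W` matter (Schur's test).
  have hsymm : ∫⁻ z, ENNReal.ofReal (q z.2 * ‖a z.2‖ ^ 2 * (q z.1 * Kf z)) ∂(ν.prod ν) =
      ∫⁻ z, P z ∂(ν.prod ν) := by
    rw [← lintegral_prod_swap]
    refine lintegral_congr fun z => ?_
    simp only [hP, hKf, Prod.fst_swap, Prod.snd_swap]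
    rw [show (τ z.2 - τ z.1) ^ 2 = (τ z.1 - τ z.2) ^ 2 by ring]
  have hI : ∫⁻ z, P z ∂(ν.prod ν) ≤ ∫⁻ ω, ENNReal.ofReal (q ω * ‖a ω‖ ^ 2) * W ω ∂ν := by
    rw [lintegral_prod _ hPm.aemeasurable]
    refine lintegral_mono fun ω => ?_
    calc ∫⁻ ω', P (ω, ω') ∂ν
        = ∫⁻ ω', ENNReal.ofReal (q ω * ‖a ω‖ ^ 2) *
            ENNReal.ofReal (q ω' * Real.exp (-(τ ω - τ ω') ^ 2 / 4)) ∂ν := by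
          refine lintegral_congr fun ω' => ?_
          rw [← ENNReal.ofReal_mul (mul_nonneg (hq0 _) (sq_nonneg _))]
      _ = ENNReal.ofReal (q ω * ‖a ω‖ ^ 2) * _ := by
          rw [lintegral_const_mul']
          exact ENNReal.ofReal_ne_top
      _ ≤ _ := by gcongr; exact hW ω
  have hbound : ENNReal.ofReal
      (∫ u : ℝ, ‖∫ ω, q ω * a ω * cexp (I * τ ω * u) ∂ν‖ ^ 2 * Real.exp (-u ^ 2)) ≤
      ∫⁻ z, ENNReal.ofReal (√Real.pi) * (ENNReal.ofReal (1 / 2) * (P z +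
        ENNReal.ofReal (q z.2 * ‖a z.2‖ ^ 2 * (q z.1 * Kf z)))) ∂(ν.prod ν) := by
    have : ENNReal.ofReal
        (∫ u : ℝ, ‖∫ ω, q ω * a ω * cexp (I * τ ω * u) ∂ν‖ ^ 2 * Real.exp (-u ^ 2)) ≤
        ‖((∫ u : ℝ, ‖∫ ω, q ω * a ω * cexp (I * τ ω * u) ∂ν‖ ^ 2 * Real.exp (-u ^ 2) : ℝ) : ℂ)‖ₑ := by
      rw [← ofReal_norm, Complex.norm_real]
      exact ENNReal.ofReal_le_ofReal (le_abs_self _)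
    refine this.trans ?_
    rw [h2]
    refine (enorm_integral_le_lintegral_enorm _).trans (lintegral_mono fun z => ?_)
    have hk : 0 ≤ Kf z := (Real.exp_pos _).le
    rw [← ENNReal.ofReal_add, ← ENNReal.ofReal_mul (by norm_num),
      ← ENNReal.ofReal_mul (Real.sqrt_nonneg _), ← ofReal_norm]
    · refine ENNReal.ofReal_le_ofReal ?_
      rw [norm_mul, norm_mul, RCLike.norm_conj, norm_mul, norm_mul, Complex.norm_real,
        Complex.norm_real, Complex.norm_real, Real.norm_of_nonneg (hq0 _),
        Real.norm_of_nonneg (hq0 _), Real.norm_of_nonneg (by positivity)]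
      have : ‖a z.1‖ * ‖a z.2‖ ≤ 1 / 2 * (‖a z.1‖ ^ 2 + ‖a z.2‖ ^ 2) := by
        nlinarith [sq_nonneg (‖a z.1‖ - ‖a z.2‖)]
      calc q z.1 * ‖a z.1‖ * (q z.2 * ‖a z.2‖) * (√Real.pi * Kf z)
          = √Real.pi * (q z.1 * q z.2 * Kf z) * (‖a z.1‖ * ‖a z.2‖) := by ring
        _ ≤ √Real.pi * (q z.1 * q z.2 * Kf z) * (1 / 2 * (‖a z.1‖ ^ 2 + ‖a z.2‖ ^ 2)) := by
            refine mul_le_mul_of_nonneg_left this (mul_nonneg (Real.sqrt_nonneg _)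
              (mul_nonneg (mul_nonneg (hq0 _) (hq0 _)) hk))
        _ = _ := by ring
    · exact mul_nonneg (mul_nonneg (hq0 _) (sq_nonneg _)) (mul_nonneg (hq0 _) hk)
    · exact mul_nonneg (mul_nonneg (hq0 _) (sq_nonneg _)) (mul_nonneg (hq0 _) hk)
  refine hbound.trans ?_
  rw [lintegral_const_mul' _ _ ENNReal.ofReal_ne_top,
    lintegral_const_mul' _ _ ENNReal.ofReal_ne_top, lintegral_add_left hPm, hsymm, ← two_mul,
    ← mul_assoc (ENNReal.ofReal (1 / 2)),
    show ENNReal.ofReal (1 / 2) * 2 = 1 by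
      rw [show (2 : ℝ≥0∞) = ENNReal.ofReal 2 by simp, ← ENNReal.ofReal_mul (by norm_num)]; simp,
    one_mul]
  gcongr
end

end GoldbachAverage

/-! ### Continuation of `(s - 1) ζ(s)` to `Re s > -1` with polynomial bounds. -/

namespace GoldbachAverage

open MeasureTheory Complex Set Filter Topology

/-- Half the second periodic Bernoulli function, up to a constant. -/
noncomputable def sawPrim (x : ℝ) : ℝ := (Int.fract x ^ 2 - Int.fract x) / 2

lemma continuous_sawPrim : Continuous sawPrim := by
  have h := ContinuousOn.comp_fract (f := fun (_ : ℝ) (x : ℝ) => (x ^ 2 - x) / 2)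
    (s := fun x : ℝ => x) (by fun_prop) continuous_id (by simp)
  exact h

lemma abs_sawPrim_le (x : ℝ) : |sawPrim x| ≤ 1 := by
  have h1 := Int.fract_nonneg x
  have h2 := (Int.fract_lt_one x).le
  rw [sawPrim, abs_le]
  constructor <;> nlinarith

lemma sawPrim_natCast (n : ℕ) : sawPrim n = 0 := by simp [sawPrim]

/-- At an integer only the one-sided derivative is available: the floor is locally constant to the
right of every point. This suffices for integration by parts with right derivatives. -/
lemma hasDerivWithinAt_sawPrim (x : ℝ) :
    HasDerivWithinAt sawPrim (Int.fract x - 1 / 2) (Ioi x) x := by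
  have h1 : HasDerivAt (fun y : ℝ => ((y - ⌊x⌋) ^ 2 - (y - ⌊x⌋)) / 2) (Int.fract x - 1 / 2) x := by
    have := ((((hasDerivAt_id x).sub_const (⌊x⌋ : ℝ)).pow 2).sub
      ((hasDerivAt_id x).sub_const (⌊x⌋ : ℝ))).div_const 2
    refine this.congr_deriv ?_
    simp only [Int.fract, id]
    push_cast
    ring
  refine h1.hasDerivWithinAt.congr_of_eventuallyEq ?_ (by simp only [sawPrim, Int.fract])
  have : Ioo x (⌊x⌋ + 1) ∈ 𝓝[>] x := Ioo_mem_nhdsGT (Int.lt_floor_add_one x)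
  filter_upwards [this] with y hy
  have : ⌊y⌋ = ⌊x⌋ := by
    rw [Int.floor_eq_iff]
    exact ⟨(Int.floor_le x).trans hy.1.le, hy.2⟩
  simp only [sawPrim, Int.fract, this]

/-- The truncation of `sawPrim` to `(1, ∞)`. -/
noncomputable def sawCut : ℝ → ℂ := (Ioi (1 : ℝ)).indicator fun t => (sawPrim t : ℂ)

lemma norm_sawCut_le (x : ℝ) : ‖sawCut x‖ ≤ 1 := by
  rw [sawCut]
  refine (norm_indicator_le_norm_self _ _).trans ?_
  rw [Complex.norm_real]
  exact abs_sawPrim_le x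

lemma mellin_sawCut (s : ℂ) :
    mellin sawCut (-s - 1) = ∫ t in Ioi (1 : ℝ), (t : ℂ) ^ (-s - 2) * sawPrim t := by
  rw [mellin, ← integral_indicator measurableSet_Ioi, ← integral_indicator measurableSet_Ioi]
  congr 1
  ext t
  by_cases ht : 1 < t
  · have h0 : 0 < t := by linarith
    simp only [indicator, mem_Ioi, ht, h0, if_true, sawCut, smul_eq_mul]
    ring_nf
  · simp [indicator, sawCut, ht]

/-- The analytic continuation of `(s - 1) ζ(s)` to `Re s > -1`. -/
noncomputable def zetaPole (s : ℂ) : ℂ :=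
  (s + 1) / 2 - (s - 1) * s * (s + 1) * mellin sawCut (-s - 1)

/-- The function `sawCut` is bounded and vanishes near `0`, so its Mellin transform is holomorphic
at arguments of negative real part, and `Re (-s - 1) < 0`. -/
lemma differentiableAt_mellin_sawCut {s : ℂ} (hs : -1 < s.re) :
    DifferentiableAt ℂ (fun s => mellin sawCut (-s - 1)) s := by
  have h1 : DifferentiableAt ℂ (mellin sawCut) (-s - 1) := by
    refine mellin_differentiableAt_of_isBigO_rpow (a := 0) (b := (-s - 1).re - 1) ?_ ?_ ?_ ?_ ?_
    · refine LocallyIntegrable.locallyIntegrableOn ?_ _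
      have : LocallyIntegrable (fun t : ℝ => (sawPrim t : ℂ)) :=
        (Complex.continuous_ofReal.comp continuous_sawPrim).locallyIntegrable
      exact this.indicator measurableSet_Ioi
    · refine Asymptotics.IsBigO.of_bound 1 (Eventually.of_forall fun x => ?_)
      simpa using norm_sawCut_le x
    · simp; linarith
    · refine Asymptotics.IsBigO.of_bound 1 ?_
      have : Ioo (0 : ℝ) 1 ∈ 𝓝[>] (0 : ℝ) := Ioo_mem_nhdsGT one_pos
      filter_upwards [this] with x hx
      rw [sawCut, indicator_of_notMem (by simp [hx.2.le])]
      simp only [norm_zero]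
      positivity
    · simp
  exact DifferentiableAt.comp (g := mellin sawCut) (f := fun s => -s - 1) s h1 (by fun_prop)

lemma differentiableAt_zetaPole {s : ℂ} (hs : -1 < s.re) : DifferentiableAt ℂ zetaPole s := by
  have := differentiableAt_mellin_sawCut hs
  unfold zetaPole
  fun_prop

lemma isOpen_re_gt (a : ℝ) : IsOpen {s : ℂ | a < s.re} := isOpen_lt continuous_const continuous_re

lemma analyticOnNhd_zetaPole : AnalyticOnNhd ℂ zetaPole {s | -1 < s.re} :=
  DifferentiableOn.analyticOnNhd
    (fun _ hs => (differentiableAt_zetaPole hs).differentiableWithinAt) (isOpen_re_gt _)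

lemma integrableOn_bdd_mul_cpow {f : ℝ → ℝ} (hf : Measurable f) (hb : ∀ x, |f x| ≤ 1) {a : ℂ}
    (ha : a.re < -1) : IntegrableOn (fun t : ℝ => (t : ℂ) ^ a * f t) (Ioi 1) := by
  refine (integrableOn_Ioi_cpow_of_lt ha one_pos).mul_bdd (c := 1)
    (Complex.measurable_ofReal.comp hf).aestronglyMeasurable ?_
  refine Eventually.of_forall fun x => ?_
  rw [Complex.norm_real]
  exact hb x

lemma norm_mellin_sawCut_le {s : ℂ} (hs : -1 < s.re) :
    ‖mellin sawCut (-s - 1)‖ ≤ 1 / (s.re + 1) := by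
  rw [mellin_sawCut]
  have h1 : ∫ t in Ioi (1 : ℝ), t ^ (-s.re - 2) = 1 / (s.re + 1) := by
    rw [integral_Ioi_rpow_of_lt (by linarith) one_pos, Real.one_rpow]
    rw [show -s.re - 2 + 1 = -(s.re + 1) by ring, neg_div_neg_eq]
  rw [← h1]
  refine norm_integral_le_of_norm_le (integrableOn_Ioi_rpow_of_lt (by linarith) one_pos) ?_
  refine (ae_restrict_mem measurableSet_Ioi).mono fun t (ht : 1 < t) => ?_
  rw [norm_mul, Complex.norm_cpow_eq_rpow_re_of_pos (by linarith), Complex.norm_real]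
  have := abs_sawPrim_le t
  have h2 : (-s - 2).re = -s.re - 2 := by simp
  rw [h2]
  have := Real.rpow_nonneg (show (0 : ℝ) ≤ t by linarith) (-s.re - 2)
  rw [Real.norm_eq_abs]
  nlinarith

lemma norm_zetaPole_le {s : ℂ} (hs : -(3 / 5) ≤ s.re) {R : ℝ} (hR : 0 ≤ R) (h : ‖s‖ ≤ R) :
    ‖zetaPole s‖ ≤ 4 * (1 + R) ^ 3 := by
  have h1 := norm_mellin_sawCut_le (s := s) (by linarith)
  have h2 : 1 / (s.re + 1) ≤ 5 / 2 := by
    rw [div_le_iff₀ (by linarith)]; linarith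
  have h3 : ‖s + 1‖ ≤ 1 + R := (norm_add_le _ _).trans (by simp; linarith)
  have h4 : ‖s - 1‖ ≤ 1 + R := (norm_sub_le _ _).trans (by simp; linarith)
  have h5 : ‖s‖ ≤ 1 + R := by linarith
  calc ‖zetaPole s‖ ≤ ‖(s + 1) / 2‖ + ‖(s - 1) * s * (s + 1) * mellin sawCut (-s - 1)‖ :=
        norm_sub_le _ _
    _ = ‖s + 1‖ / 2 + ‖s - 1‖ * ‖s‖ * ‖s + 1‖ * ‖mellin sawCut (-s - 1)‖ := by
        simp
    _ ≤ (1 + R) / 2 + (1 + R) * (1 + R) * (1 + R) * (5 / 2) := by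
        gcongr
        exact h1.trans h2
    _ ≤ _ := by nlinarith [sq_nonneg R, pow_nonneg hR 3]

/-- Integration by parts gains one power of `t`, which is what pushes the continuation from `Re s >
0` to `Re s > -1`. The limit is taken along integers, where `sawPrim` vanishes and no boundary terms
remain. -/
lemma integral_saw_eq {s : ℂ} (hs : 0 < s.re) :
    ∫ t in Ioi (1 : ℝ), (t : ℂ) ^ (-s - 1) * (Int.fract t - 1 / 2 : ℝ) =
      (s + 1) * mellin sawCut (-s - 1) := by
  rw [mellin_sawCut]
  have hm : Measurable fun t : ℝ => Int.fract t - 1 / 2 := measurable_fract.sub_const _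
  have hfb : ∀ x : ℝ, |Int.fract x - 1 / 2| ≤ 1 := fun x => by
    have h1 := Int.fract_nonneg x
    have h2 := (Int.fract_lt_one x).le
    rw [abs_le]
    constructor <;> linarith
  have i1 := integrableOn_bdd_mul_cpow hm hfb (a := -s - 1) (by simp; linarith)
  have i2 := integrableOn_bdd_mul_cpow continuous_sawPrim.measurable abs_sawPrim_le
    (a := -s - 2) (by simp; linarith)
  have t1 := intervalIntegral_tendsto_integral_Ioi 1 i1 tendsto_natCast_atTop_atTop
  have t2 := (intervalIntegral_tendsto_integral_Ioi 1 i2 tendsto_natCast_atTop_atTop).const_mul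
    (s + 1)
  refine tendsto_nhds_unique t1 (t2.congr' ?_)
  filter_upwards [eventually_ge_atTop 1] with n hn
  have hn' : (1 : ℝ) ≤ n := by exact_mod_cast hn
  have hne : -s - 1 ≠ 0 := by
    intro h
    have := congrArg Complex.re h
    simp at this
    linarith
  have hc : ContinuousOn (fun t : ℝ => (t : ℂ) ^ (-s - 1)) (uIcc 1 n) := by
    intro t ht
    rw [uIcc_of_le hn'] at ht
    exact (hasDerivAt_ofReal_cpow_const (by linarith [ht.1]) hne).continuousAt.continuousWithinAt
  have := intervalIntegral.integral_mul_deriv_eq_deriv_mul_of_hasDeriv_right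
    (a := 1) (b := n) (u := fun t : ℝ => (t : ℂ) ^ (-s - 1)) (v := fun t => (sawPrim t : ℂ))
    (u' := fun t : ℝ => (-s - 1) * (t : ℂ) ^ (-s - 1 - 1))
    (v' := fun t => ((Int.fract t - 1 / 2 : ℝ) : ℂ)) hc
    (Complex.continuous_ofReal.comp continuous_sawPrim).continuousOn ?_ ?_ ?_ ?_
  · rw [this]
    have e1 : sawPrim (1 : ℝ) = 0 := by exact_mod_cast sawPrim_natCast 1
    rw [sawPrim_natCast, e1, ← intervalIntegral.integral_const_mul]
    simp only [Complex.ofReal_zero, mul_zero, sub_zero, zero_sub]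
    rw [← intervalIntegral.integral_neg]
    refine intervalIntegral.integral_congr fun t _ => ?_
    rw [show -s - 1 - 1 = -s - 2 by ring]
    ring
  · intro x hx
    rw [min_eq_left hn'] at hx
    exact (hasDerivAt_ofReal_cpow_const (by linarith [hx.1]) hne).hasDerivWithinAt
  · intro x _
    exact (hasDerivWithinAt_sawPrim x).ofReal_comp
  · refine ContinuousOn.intervalIntegrable fun t ht => ?_
    rw [uIcc_of_le hn'] at ht
    refine ContinuousAt.continuousWithinAt ?_
    have : (-s - 1 - 1) ≠ 0 := by
      intro h
      have := congrArg Complex.re h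
      simp at this
      linarith
    exact (hasDerivAt_ofReal_cpow_const (by linarith [ht.1]) this).continuousAt.const_mul _
  · refine intervalIntegrable_const (c := (1 : ℝ)) |>.mono_fun
      (Complex.measurable_ofReal.comp hm).aestronglyMeasurable (Eventually.of_forall fun x => ?_)
    change ‖((Int.fract x - 1 / 2 : ℝ) : ℂ)‖ ≤ ‖(1 : ℝ)‖
    rw [Complex.norm_real, norm_one]
    exact hfb x

/-- Abel summation gives `ζ(s) = s ∫ ⌊t⌋ t ^ (-s - 1)`; then `⌊t⌋ = t - 1/2 - ({t} - 1/2)`, and the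
fractional part is treated by `integral_saw_eq`. -/
lemma zetaPole_eq_of_one_lt_re {s : ℂ} (hs : 1 < s.re) :
    zetaPole s = (s - 1) * riemannZeta s := by
  have hs0 : s ≠ 0 := by rintro rfl; simp at hs; linarith
  have hs1 : s - 1 ≠ 0 := by
    intro h
    have := congrArg Complex.re h
    simp at this
    linarith
  have h1 := LSeries_eq_mul_integral (1 : ℕ → ℂ) (r := 1) zero_le_one hs
    (LSeriesSummable_one_iff.2 hs) (by
      refine Asymptotics.IsBigO.of_bound 1 (Eventually.of_forall fun n => ?_)
      simp)
  rw [LSeries_one_eq_riemannZeta hs] at h1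
  have i1 := integrableOn_Ioi_cpow_of_lt (a := -s) (by simpa using hs) one_pos
  have i2 := integrableOn_Ioi_cpow_of_lt (a := -s - 1) (by simp; linarith) one_pos
  have hm : Measurable fun t : ℝ => Int.fract t - 1 / 2 := measurable_fract.sub_const _
  have hfb : ∀ x : ℝ, |Int.fract x - 1 / 2| ≤ 1 := fun x => by
    have h1 := Int.fract_nonneg x
    have h2 := (Int.fract_lt_one x).le
    rw [abs_le]
    constructor <;> linarith
  have i3 := integrableOn_bdd_mul_cpow hm hfb (a := -s - 1) (by simp; linarith)
  have h2 : ∫ t in Ioi (1 : ℝ), (∑ k ∈ Finset.Icc 1 ⌊t⌋₊, (1 : ℕ → ℂ) k) * (t : ℂ) ^ (-(s + 1)) =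
      ∫ t in Ioi (1 : ℝ), ((t : ℂ) ^ (-s) - (1 / 2) * (t : ℂ) ^ (-s - 1)
        - (t : ℂ) ^ (-s - 1) * (Int.fract t - 1 / 2 : ℝ)) := by
    refine setIntegral_congr_fun measurableSet_Ioi fun t (ht : 1 < t) => ?_
    have ht0 : (t : ℂ) ≠ 0 := by exact_mod_cast (by linarith : t ≠ 0)
    have e1 : (t : ℂ) ^ (-s) = t * (t : ℂ) ^ (-s - 1) := by
      rw [Complex.cpow_sub _ _ ht0, Complex.cpow_one]; field_simp
    have e2 : ((⌊t⌋₊ : ℝ) : ℂ) = t - Int.fract t := by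
      rw [natCast_floor_eq_intCast_floor (by linarith), ← Complex.ofReal_sub, Int.self_sub_fract]
    simp only [Pi.one_apply, Finset.sum_const, Nat.card_Icc, Nat.add_sub_cancel, nsmul_eq_mul,
      mul_one]
    rw [show ((⌊t⌋₊ : ℕ) : ℂ) = ((⌊t⌋₊ : ℝ) : ℂ) by simp, e2, e1, show -(s + 1) = -s - 1 by ring]
    push_cast
    ring
  rw [h2, integral_sub (f := fun t : ℝ => (t : ℂ) ^ (-s) - (1 / 2) * (t : ℂ) ^ (-s - 1))
      (i1.sub (i2.const_mul _)) i3, integral_sub i1 (i2.const_mul _),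
    integral_const_mul, integral_saw_eq (by linarith),
    integral_Ioi_cpow_of_lt (by simpa using hs) one_pos,
    integral_Ioi_cpow_of_lt (by simp; linarith) one_pos] at h1
  simp only [Complex.ofReal_one, Complex.one_cpow] at h1
  have e3 : -s + 1 = -(s - 1) := by ring
  have e4 : -s - 1 + 1 = -s := by ring
  rw [e3, e4, neg_div_neg_eq, neg_div_neg_eq] at h1
  rw [h1, zetaPole]
  field_simp
  ring

/-- Identity theorem on the half-plane, applied to `(s - 1) ζ(s)` completed by its residue `1` at `s
= 1`. -/
lemma zetaPole_eq {s : ℂ} (hs : -1 < s.re) (h1 : s ≠ 1) :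
    zetaPole s = (s - 1) * riemannZeta s := by
  set f : ℂ → ℂ := Function.update (fun s => (s - 1) * riemannZeta s) 1 1 with hf
  have hfa : AnalyticOnNhd ℂ f {s | -1 < s.re} := by
    intro z _
    by_cases hz : z = 1
    · subst hz
      refine Complex.analyticAt_of_differentiable_on_punctured_nhds_of_continuousAt ?_ ?_
      · filter_upwards [self_mem_nhdsWithin] with w hw
        have : f =ᶠ[𝓝 w] fun s => (s - 1) * riemannZeta s := by
          filter_upwards [isOpen_ne.mem_nhds hw] with v hv
          exact Function.update_of_ne hv _ _
        exact (((differentiableAt_id.sub_const _).mul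
          (differentiableAt_riemannZeta hw))).congr_of_eventuallyEq this
      · rw [hf, continuousAt_update_same]
        exact riemannZeta_residue_one
    · have : f =ᶠ[𝓝 z] fun s => (s - 1) * riemannZeta s := by
        filter_upwards [isOpen_ne.mem_nhds hz] with v hv
        exact Function.update_of_ne hv _ _
      refine AnalyticAt.congr ?_ this.symm
      exact (analyticAt_id.sub analyticAt_const).mul (analyticOn_riemannZeta z hz)
  have hpre : IsPreconnected {s : ℂ | -1 < s.re} :=
    (convex_halfSpace_re_gt (-1)).isPreconnected
  have h2 : (2 : ℂ) ∈ {s : ℂ | -1 < s.re} := by simp; norm_num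
  have heq := analyticOnNhd_zetaPole.eqOn_of_preconnected_of_eventuallyEq hfa hpre h2 (by
    filter_upwards [(isOpen_re_gt 1).mem_nhds (show (1 : ℝ) < (2 : ℂ).re by simp)] with z hz
    have hz1 : z ≠ 1 := by rintro rfl; simp at hz
    rw [zetaPole_eq_of_one_lt_re hz, hf, Function.update_of_ne hz1])
  rw [heq hs, hf, Function.update_of_ne h1]

lemma zetaPole_one : zetaPole 1 = 1 := by
  rw [zetaPole]; norm_num

/-- The terms after the first have total modulus at most `ζ(2) - 1 = π² / 6 - 1 ≤ 2 / 3`. Jensen's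
formula and Landau's lemma need this lower bound at the disc centres. -/
lemma norm_riemannZeta_two_add_ge (t : ℝ) : 1 / 3 ≤ ‖riemannZeta (2 + t * I)‖ := by
  have hre : (2 + t * I : ℂ).re = 2 := by simp
  have h2 : 1 < (2 + t * I : ℂ).re := by rw [hre]; norm_num
  have hs := hasSum_zeta_two
  have hs' : HasSum (fun n : ℕ => 1 / ((n : ℝ) + 2) ^ 2) (Real.pi ^ 2 / 6 - 1) := by
    have := (hasSum_nat_add_iff' 2).2 hs
    simp [Finset.sum_range_succ] at this
    simpa using this
  have hz := zeta_eq_tsum_one_div_nat_add_one_cpow h2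
  have hsum : Summable fun n : ℕ => 1 / (n + 1 : ℂ) ^ (2 + t * I) := by
    have := (Complex.summable_one_div_nat_cpow (p := 2 + t * I)).2 h2
    have := (summable_nat_add_iff 1).2 this
    exact_mod_cast this
  rw [hsum.tsum_eq_zero_add] at hz
  have hb : ‖∑' n : ℕ, 1 / ((n + 1 : ℕ) + 1 : ℂ) ^ (2 + t * I)‖ ≤ Real.pi ^ 2 / 6 - 1 := by
    refine tsum_of_norm_bounded hs' fun n => ?_
    have e : ((n + 1 : ℕ) + 1 : ℂ) = ((n + 2 : ℝ) : ℂ) := by push_cast; ring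
    rw [e, norm_div, norm_one, Complex.norm_cpow_eq_rpow_re_of_pos (by positivity), hre]
    norm_num
  have hpi : Real.pi ^ 2 / 6 - 1 ≤ 2 / 3 := by nlinarith [Real.pi_lt_d2, Real.pi_pos]
  rw [hz]
  have e0 : (1 : ℂ) / ((0 : ℕ) + 1 : ℂ) ^ (2 + t * I) = 1 := by simp
  rw [e0]
  set S := ∑' n : ℕ, 1 / ((n + 1 : ℕ) + 1 : ℂ) ^ (2 + t * I)
  have := norm_sub_le_norm_add (1 : ℂ) S
  rw [norm_one] at this
  linarith

lemma norm_zetaPole_two_add_ge (t : ℝ) : 1 / 3 ≤ ‖zetaPole (2 + t * I)‖ := by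
  rw [zetaPole_eq_of_one_lt_re (by simp), norm_mul]
  have h1 := norm_riemannZeta_two_add_ge t
  have h2 : 1 ≤ ‖(2 + t * I - 1 : ℂ)‖ := by
    refine le_trans ?_ (Complex.abs_re_le_norm _)
    simp; norm_num
  nlinarith

end GoldbachAverage

/-! ### Factoring out zeros and Landau's lemma. -/

namespace GoldbachAverage

open Complex Set Filter Topology Metric

lemma exists_factor_point {f : ℂ → ℂ} {U : Set ℂ} (hf : AnalyticOnNhd ℂ f U) {u : ℂ} (hu : u ∈ U)
    (htop : analyticOrderAt f u ≠ ⊤) :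
    ∃ g : ℂ → ℂ, AnalyticOnNhd ℂ g U ∧ g u ≠ 0 ∧
      ∀ z, f z = (z - u) ^ analyticOrderNatAt f u * g z := by
  obtain ⟨h, ha, h0, he⟩ := (hf u hu).analyticOrderAt_ne_top.1 htop
  set m := analyticOrderNatAt f u
  set g : ℂ → ℂ := Function.update (fun z => f z / (z - u) ^ m) u (h u) with hg
  have hne : ∀ z, z ≠ u → f z = (z - u) ^ m * g z := by
    intro z hz
    have : (z - u) ^ m ≠ 0 := pow_ne_zero _ (sub_ne_zero.2 hz)
    rw [hg, Function.update_of_ne hz]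
    field_simp
  have hgh : g =ᶠ[𝓝 u] h := by
    filter_upwards [he] with z hz
    by_cases hzu : z = u
    · rw [hzu, hg, Function.update_self]
    · have : (z - u) ^ m ≠ 0 := pow_ne_zero _ (sub_ne_zero.2 hzu)
      have h2 := hne z hzu
      rw [hz, smul_eq_mul] at h2
      exact (mul_left_cancel₀ this h2).symm
  refine ⟨g, fun z hz => ?_, by rwa [hgh.eq_of_nhds], fun z => ?_⟩
  · by_cases hzu : z = u
    · rw [hzu]; exact ha.congr hgh.symm
    · have : g =ᶠ[𝓝 z] fun z => f z / (z - u) ^ m := by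
        filter_upwards [isOpen_ne.mem_nhds hzu] with w hw
        exact Function.update_of_ne hw _ _
      refine AnalyticAt.congr ?_ this.symm
      exact (hf z hz).fun_div ((analyticAt_id.sub analyticAt_const).pow m)
        (pow_ne_zero _ (sub_ne_zero.2 hzu))
  · by_cases hzu : z = u
    · subst hzu
      have := he.eq_of_nhds
      rw [this, hgh.eq_of_nhds, smul_eq_mul]
    · exact hne z hzu

/-- Induction on the finite set: factors already removed do not vanish at the new point, so the
order of the cofactor there equals the order of `f` itself. -/
lemma exists_factor_finset {f : ℂ → ℂ} {U : Set ℂ} (hf : AnalyticOnNhd ℂ f U)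
    (S : Finset ℂ) (hS : ∀ u ∈ S, u ∈ U) (htop : ∀ u ∈ U, analyticOrderAt f u ≠ ⊤) :
    ∃ g : ℂ → ℂ, AnalyticOnNhd ℂ g U ∧ (∀ u ∈ S, g u ≠ 0) ∧
      ∀ z, f z = (∏ u ∈ S, (z - u) ^ analyticOrderNatAt f u) * g z := by
  classical
  induction S using Finset.induction_on with
  | empty => exact ⟨f, hf, by simp, by simp⟩
  | insert v S hv ih =>
    obtain ⟨g, hg, hg0, hfg⟩ := ih fun u hu => hS u (Finset.mem_insert_of_mem hu)
    have hvU := hS v (Finset.mem_insert_self _ _)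
    set P : ℂ → ℂ := fun z => ∏ u ∈ S, (z - u) ^ analyticOrderNatAt f u with hP
    have hPa : AnalyticAt ℂ P v := by
      refine Finset.analyticAt_fun_prod _ fun u _ => ?_
      exact (analyticAt_id.sub analyticAt_const).pow _
    have hP0 : P v ≠ 0 := by
      refine Finset.prod_ne_zero_iff.2 fun u hu => pow_ne_zero _ (sub_ne_zero.2 ?_)
      rintro rfl
      exact hv hu
    have hord : analyticOrderAt f v = analyticOrderAt g v := by
      have e : f = P * g := funext fun z => hfg z
      rw [e, analyticOrderAt_mul hPa (hg v hvU), hPa.analyticOrderAt_eq_zero.2 hP0, zero_add]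
    have hordN : analyticOrderNatAt f v = analyticOrderNatAt g v := by
      rw [analyticOrderNatAt, analyticOrderNatAt, hord]
    obtain ⟨k, hk, hk0, hgk⟩ := exists_factor_point hg hvU (by rw [← hord]; exact htop v hvU)
    refine ⟨k, hk, ?_, ?_⟩
    · intro u hu
      rcases Finset.mem_insert.1 hu with rfl | hu
      · exact hk0
      · intro h
        exact hg0 u hu (by rw [hgk, h, mul_zero])
    · intro z
      rw [hfg z, hgk z, Finset.prod_insert hv, hordN]
      ring

lemma norm_logDeriv_le {g : ℂ → ℂ} {c : ℂ} {r₁ r₂ B : ℝ} (h2 : 0 < r₂) (h12 : r₂ < r₁)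
    (hg : DifferentiableOn ℂ g (ball c r₁)) (hg0 : ∀ z ∈ ball c r₁, g z ≠ 0) (hB : 0 < B)
    (hle : ∀ z ∈ ball c r₁, ‖g z‖ ≤ Real.exp B * ‖g c‖) {z : ℂ} (hz : z ∈ closedBall c r₂) :
    ‖logDeriv g z‖ ≤ 8 * r₁ / (r₁ - r₂) ^ 2 * B := by
  have hr1 : 0 < r₁ := h2.trans h12
  have hc : c ∈ ball c r₁ := mem_ball_self hr1
  have hdg : DifferentiableOn ℂ (logDeriv g) (ball c r₁) := by
    have : DifferentiableOn ℂ (deriv g) (ball c r₁) := hg.deriv isOpen_ball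
    exact this.div hg hg0
  obtain ⟨F, hF⟩ := hdg.isExactOn_ball
  have hdiff : ∀ w ∈ ball c r₁, HasDerivAt g (deriv g w) w := fun w hw =>
    (hg.differentiableAt (isOpen_ball.mem_nhds hw)).hasDerivAt
  have hd : ∀ w ∈ ball c r₁, HasDerivAt (fun w => g w * cexp (-(F w - F c))) 0 w := by
    intro w hw
    have := (hdiff w hw).mul (((hF w hw).sub_const (F c)).neg.cexp)
    refine this.congr_deriv ?_
    rw [logDeriv_apply]
    field_simp [hg0 w hw]
    ring
  have hconst : ∀ w ∈ ball c r₁, g w * cexp (-(F w - F c)) = g c := by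
    intro w hw
    have := isOpen_ball.is_const_of_deriv_eq_zero (convex_ball c r₁).isPreconnected
      (fun w hw => (hd w hw).differentiableAt.differentiableWithinAt)
      (fun w hw => (hd w hw).deriv) hw hc
    simpa using this
  have hre : ∀ w ∈ ball c r₁, (F w - F c).re ≤ B := by
    intro w hw
    have h1 : g w = g c * cexp (F w - F c) := by
      rw [← hconst w hw, mul_assoc, ← Complex.exp_add]
      simp
    have h3 := hle w hw
    rw [h1, norm_mul, Complex.norm_exp, mul_comm] at h3
    have h4 : 0 < ‖g c‖ := norm_pos_iff.2 (hg0 c hc)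
    exact Real.exp_le_exp.1 (le_of_mul_le_mul_right h3 h4)
  set r₃ := (r₁ + r₂) / 2 with hr3
  have hFb : ∀ w, ‖w - c‖ ≤ r₃ → ‖F w - F c‖ ≤ 2 * B * r₃ / (r₁ - r₃) := by
    intro w hw
    have hlt : ‖w - c‖ < r₁ := by linarith
    have hmap : ∀ v ∈ ball (0 : ℂ) r₁, v + c ∈ ball c r₁ := fun v hv => by
      simpa [mem_ball, dist_eq_norm] using hv
    have := borelCaratheodory_zero (f := fun v => F (v + c) - F c) (M := B) (R := r₁)
      (z := w - c) hB ?_ ?_ hr1 ?_ (by simp)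
    · simp only [sub_add_cancel] at this
      refine this.trans ?_
      have : 0 < r₁ - r₃ := by linarith
      gcongr
    · intro v hv
      have h1 := (hF (v + c) (hmap v hv)).comp_add_const v c
      exact (h1.sub_const _).differentiableAt.differentiableWithinAt
    · intro v hv
      exact hre _ (hmap v hv)
    · simpa [mem_ball, dist_eq_norm] using hlt
  have hzc : ‖z - c‖ ≤ r₂ := by simpa [mem_closedBall, dist_eq_norm] using hz
  have hsub : ∀ w, ‖w - z‖ ≤ r₃ - r₂ → ‖w - c‖ ≤ r₃ := by
    intro w hw
    have := norm_add_le (w - z) (z - c)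
    rw [sub_add_sub_cancel] at this
    linarith
  have hmem : ∀ w, ‖w - z‖ ≤ r₃ - r₂ → w ∈ ball c r₁ := by
    intro w hw
    have := hsub w hw
    rw [mem_ball, dist_eq_norm]
    linarith
  have hder := Complex.norm_deriv_le_of_forall_mem_sphere_norm_le (c := z) (R := r₃ - r₂)
    (f := fun w => F w - F c) (C := 2 * B * r₃ / (r₁ - r₃)) (by linarith) ?_ ?_
  · have : deriv (fun w => F w - F c) z = logDeriv g z :=
      ((hF z (hmem z (by simp; linarith))).sub_const _).deriv
    rw [this] at hder
    refine hder.trans ?_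
    have e1 : r₁ - r₃ = (r₁ - r₂) / 2 := by rw [hr3]; ring
    have e2 : r₃ - r₂ = (r₁ - r₂) / 2 := by rw [hr3]; ring
    have hpos : 0 < r₁ - r₂ := by linarith
    have e3 : 2 * B * r₃ / ((r₁ - r₂) / 2) / ((r₁ - r₂) / 2) = 8 * r₃ / (r₁ - r₂) ^ 2 * B := by
      field_simp
      ring
    rw [e1, e2, e3]
    have : r₃ ≤ r₁ := by linarith
    gcongr
  · refine DifferentiableOn.diffContOnCl fun w hw => ?_
    rw [closure_ball _ (by linarith : r₃ - r₂ ≠ 0)] at hw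
    have hw' := hmem w (by simpa [mem_closedBall, dist_eq_norm] using hw)
    exact ((hF w hw').sub_const _).differentiableAt.differentiableWithinAt
  · intro w hw
    exact hFb w (hsub w (by simpa [mem_sphere, dist_eq_norm] using hw.le))

/-- Jensen's bound for the divisor on the smaller disc, restricted to a chosen finite set, which
only drops nonnegative terms. -/
lemma sum_analyticOrderNatAt_le {f : ℂ → ℂ} {c : ℂ} {r R M : ℝ} (hr : 0 < r) (hrR : r < R)
    (hM : 1 ≤ M) (hf : AnalyticOnNhd ℂ f (closedBall c R)) (hfc : f c ≠ 0)
    (hb : ∀ z ∈ sphere c R, ‖f z‖ ≤ M) (S : Finset ℂ) (hS : ∀ u ∈ S, u ∈ closedBall c r) :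
    (∑ u ∈ S, (analyticOrderNatAt f u : ℝ)) ≤ Real.log (M / ‖f c‖) / Real.log (R / r) := by
  have hR : 0 < R := hr.trans hrR
  have h := AnalyticOnNhd.sum_divisor_le (c := c) (r := r) (R := R) (M := M) (f := f)
    (by simpa using hr.ne') (by rwa [abs_of_pos hr, abs_of_pos hR]) hM
    (by rwa [abs_of_pos hR]) hfc (by rwa [abs_of_pos hR])
  rw [abs_of_pos hr] at h
  refine le_trans ?_ h
  have hf' : AnalyticOnNhd ℂ f (closedBall c r) := hf.mono (closedBall_subset_closedBall hrR.le)
  set D := MeromorphicOn.divisor f (closedBall c r) with hD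
  have hfin := D.finiteSupport (isCompact_closedBall c r)
  have hnn : ∀ u, 0 ≤ D u := fun u => MeromorphicOn.AnalyticOnNhd.divisor_nonneg hf' u
  classical
  have hval : ∀ u ∈ S, ((analyticOrderNatAt f u : ℕ) : ℤ) = D u := by
    intro u hu
    rw [hD, MeromorphicOn.divisor_apply hf'.meromorphicOn (hS u hu),
      (hf' u (hS u hu)).meromorphicOrderAt_eq, analyticOrderNatAt]
    cases analyticOrderAt f u <;> simp
  rw [finsum_eq_sum_of_support_subset (s := hfin.toFinset ∪ S) _ (by
    intro x hx; simp only [Finset.coe_union, Set.Finite.coe_toFinset]; exact Or.inl hx)]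
  push_cast
  calc (∑ u ∈ S, (analyticOrderNatAt f u : ℝ)) = ∑ u ∈ S, (D u : ℝ) :=
        Finset.sum_congr rfl fun u hu => by rw [← hval u hu]; simp
    _ ≤ _ := Finset.sum_le_sum_of_subset_of_nonneg Finset.subset_union_right fun u _ _ => by
        exact_mod_cast hnn u

/-- Landau's lemma: the logarithmic derivative of a bounded analytic function on a disc is the sum
over the nearby zeros, up to an analytic term controlled by the logarithmic growth. -/
theorem exists_logDeriv_eq_sum_add {f : ℂ → ℂ} {c : ℂ} {r₁ r₂ R M : ℝ} (h2 : 0 < r₂) (h12 : r₂ < r₁)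
    (h1R : r₁ < R) (hM : 1 ≤ M) (hf : AnalyticOnNhd ℂ f (closedBall c R)) (hfc : f c ≠ 0)
    (hfM : ‖f c‖ ≤ M) (hrR : R ≤ 2 * r₁)
    (hb : ∀ z ∈ sphere c R, ‖f z‖ ≤ M) (S : Finset ℂ) (hS : ∀ u ∈ S, u ∈ closedBall c r₁)
    (hS' : ∀ u ∈ closedBall c r₁, f u = 0 → u ∈ S) :
    ∃ H : ℂ → ℂ, AnalyticOnNhd ℂ H (ball c r₁) ∧
      (∀ z ∈ ball c r₁, f z ≠ 0 →
        logDeriv f z = ∑ u ∈ S, (analyticOrderNatAt f u : ℂ) / (z - u) + H z) ∧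
      ∀ z ∈ closedBall c r₂, ‖H z‖ ≤ 8 * r₁ / (r₁ - r₂) ^ 2 *
        (1 + Real.log (M / ‖f c‖) * (1 + Real.log (r₁ / (R - r₁)) / Real.log (R / r₁))) := by
  have hr1 : 0 < r₁ := h2.trans h12
  have hR : 0 < R := hr1.trans h1R
  have hcR : c ∈ closedBall c R := mem_closedBall_self hR.le
  have hpre : IsPreconnected (closedBall c R) := (convex_closedBall c R).isPreconnected
  have htop : ∀ u ∈ closedBall c R, analyticOrderAt f u ≠ ⊤ := fun u hu =>
    hf.analyticOrderAt_ne_top_of_isPreconnected hpre hcR hu (by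
      rw [(hf c hcR).analyticOrderAt_eq_zero.2 hfc]; exact ENat.zero_ne_top)
  have hsub : closedBall c r₁ ⊆ closedBall c R := closedBall_subset_closedBall h1R.le
  obtain ⟨g, hg, hg0, hfg⟩ := exists_factor_finset hf S (fun u hu => hsub (hS u hu)) htop
  have hg0' : ∀ z ∈ closedBall c r₁, g z ≠ 0 := by
    intro z hz h
    exact hg0 z (hS' z hz (by rw [hfg, h, mul_zero])) h
  have hgball : AnalyticOnNhd ℂ g (ball c r₁) := hg.mono (ball_subset_closedBall.trans hsub)
  set n := ∑ u ∈ S, analyticOrderNatAt f u with hn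
  set B₀ := Real.log (M / ‖f c‖) with hB0
  have hB0' : 0 ≤ B₀ := Real.log_nonneg ((one_le_div (norm_pos_iff.2 hfc)).2 hfM)
  have hnle : (n : ℝ) ≤ B₀ / Real.log (R / r₁) := by
    have := sum_analyticOrderNatAt_le hr1 h1R hM hf hfc hb S hS
    rw [hn]; exact_mod_cast this
  have hRr : 0 < R - r₁ := by linarith
  -- Maximum principle: on the outer circle each of the `n` removed factors has modulus at least `R
  -- - r₁`. At the centre each is at most `r₁`, so the quotient `‖g z‖ / ‖g c‖` loses at most `(r₁ /
  -- (R - r₁)) ^ n`.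
  have hgs : ∀ z ∈ closedBall c R, ‖g z‖ ≤ M / (R - r₁) ^ n := by
    intro z hz
    refine Complex.norm_le_of_forall_mem_frontier_norm_le (U := ball c R) isBounded_ball ?_ ?_ ?_
    · refine DifferentiableOn.diffContOnCl ?_
      rw [closure_ball _ hR.ne']
      exact hg.differentiableOn
    · intro w hw
      rw [frontier_ball _ hR.ne'] at hw
      have h1 := hb w hw
      rw [hfg w, norm_mul, norm_prod] at h1
      have h3 : (R - r₁) ^ n ≤ ∏ u ∈ S, ‖(w - u) ^ analyticOrderNatAt f u‖ := by
        rw [hn, ← Finset.prod_pow_eq_pow_sum]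
        refine Finset.prod_le_prod (fun _ _ => by positivity) fun u hu => ?_
        rw [norm_pow]
        refine pow_le_pow_left₀ hRr.le ?_ _
        have h4 := hS u hu
        rw [mem_closedBall, dist_eq_norm] at h4
        rw [mem_sphere, dist_eq_norm] at hw
        have := norm_sub_norm_le (w - c) (u - c)
        rw [sub_sub_sub_cancel_right] at this
        linarith
      rw [le_div_iff₀ (by positivity), mul_comm]
      exact (mul_le_mul_of_nonneg_right h3 (norm_nonneg _)).trans h1
    · rwa [closure_ball _ hR.ne']
  have hgc : ‖f c‖ ≤ r₁ ^ n * ‖g c‖ := by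
    rw [hfg c, norm_mul, norm_prod]
    refine mul_le_mul_of_nonneg_right ?_ (norm_nonneg _)
    rw [hn, ← Finset.prod_pow_eq_pow_sum]
    refine Finset.prod_le_prod (fun _ _ => norm_nonneg _) fun u hu => ?_
    rw [norm_pow]
    refine pow_le_pow_left₀ (norm_nonneg _) ?_ _
    have h4 := hS u hu
    rwa [mem_closedBall, dist_eq_norm, norm_sub_rev] at h4
  -- This sign, which comes from `R ≤ 2 r₁`, lets the Jensen bound for `n` be inserted; the summand
  -- `1` in `B` below makes it strictly positive.
  have hlog2 : 0 ≤ Real.log (r₁ / (R - r₁)) := Real.log_nonneg ((one_le_div hRr).2 (by linarith))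
  have hlogR : 0 < Real.log (R / r₁) := Real.log_pos ((one_lt_div hr1).2 h1R)
  set B := 1 + B₀ * (1 + Real.log (r₁ / (R - r₁)) / Real.log (R / r₁)) with hB
  have hBpos : 0 < B := by positivity
  have hle : ∀ z ∈ ball c r₁, ‖g z‖ ≤ Real.exp B * ‖g c‖ := by
    intro z hz
    refine (hgs z (hsub (ball_subset_closedBall hz))).trans ?_
    have hfpos : 0 < ‖f c‖ := norm_pos_iff.2 hfc
    have h5 : B₀ + n * Real.log (r₁ / (R - r₁)) ≤ B := by
      have : n * Real.log (r₁ / (R - r₁)) ≤ B₀ / Real.log (R / r₁) * Real.log (r₁ / (R - r₁)) :=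
        mul_le_mul_of_nonneg_right hnle hlog2
      have e : B₀ / Real.log (R / r₁) * Real.log (r₁ / (R - r₁)) =
        B₀ * (Real.log (r₁ / (R - r₁)) / Real.log (R / r₁)) := by ring
      rw [hB]
      linarith
    have h6 : M / ‖f c‖ * (r₁ / (R - r₁)) ^ n ≤ Real.exp B := by
      refine le_trans (le_of_eq ?_) (Real.exp_le_exp.2 h5)
      rw [Real.exp_add, Real.exp_log (by positivity), Real.exp_nat_mul,
        Real.exp_log (by positivity)]
    calc M / (R - r₁) ^ n = M / ‖f c‖ * (r₁ / (R - r₁)) ^ n * (‖f c‖ / r₁ ^ n) := by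
          rw [div_pow]; field_simp
      _ ≤ Real.exp B * ‖g c‖ := by
          refine mul_le_mul h6 ?_ (by positivity) (Real.exp_pos _).le
          rw [div_le_iff₀ (by positivity), mul_comm]
          exact hgc
  refine ⟨logDeriv g, ?_, ?_, fun z hz => norm_logDeriv_le h2 h12 hgball.differentiableOn
    (fun z hz => hg0' z (ball_subset_closedBall hz)) hBpos hle hz⟩
  · exact fun z hz => (hgball z hz).deriv.div (hgball z hz) (hg0' z (ball_subset_closedBall hz))
  · intro z hz hfz
    have e : f = fun z => (∏ u ∈ S, (z - u) ^ analyticOrderNatAt f u) * g z := funext hfg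
    have hprod : (∏ u ∈ S, (z - u) ^ analyticOrderNatAt f u) ≠ 0 := by
      intro h; rw [hfg z, h, zero_mul] at hfz; exact hfz rfl
    have hfac : ∀ u ∈ S, (z - u) ^ analyticOrderNatAt f u ≠ 0 := Finset.prod_ne_zero_iff.1 hprod
    have hdf : ∀ u ∈ S, DifferentiableAt ℂ (fun z => (z - u) ^ analyticOrderNatAt f u) z :=
      fun u _ => by fun_prop
    conv_lhs => rw [e]
    rw [logDeriv_mul z hprod (hg0' z (ball_subset_closedBall hz))
      (DifferentiableAt.fun_finsetProd hdf) (hgball z hz).differentiableAt,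
      logDeriv_prod hfac hdf]
    congr 1
    refine Finset.sum_congr rfl fun u _ => ?_
    rw [logDeriv_fun_pow (by fun_prop), logDeriv_apply]
    simp [div_eq_mul_inv]

end GoldbachAverage

/-! ### Local count of zeros and local partial fractions of the logarithmic derivative. -/

namespace GoldbachAverage

open Complex Set Filter Topology Metric

/-- The logarithmic weight `log (|t| + 2)`. -/
noncomputable def logWt (t : ℝ) : ℝ := Real.log (|t| + 2)

lemma logWt_pos (t : ℝ) : 0 < logWt t := Real.log_pos (by linarith [abs_nonneg t])

lemma half_le_logWt (t : ℝ) : 1 / 2 ≤ logWt t := by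
  have : Real.log 2 ≤ logWt t := Real.log_le_log (by norm_num) (by linarith [abs_nonneg t])
  linarith [Real.log_two_gt_d9]

lemma logWt_add_le (s t : ℝ) : logWt (s + t) ≤ logWt s + logWt t := by
  have hs := abs_nonneg s
  have ht := abs_nonneg t
  rw [logWt, logWt, logWt, ← Real.log_mul (by positivity) (by positivity)]
  refine Real.log_le_log (by positivity) ?_
  nlinarith [abs_add_le s t]

lemma re_eq_half_of_mem (hRH : RiemannHypothesis) {ρ : ℂ} (h : ρ ∈ nontrivialZetaZeros) :
    ρ.re = 1 / 2 := by
  refine hRH ρ h.1 ?_ ?_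
  · rintro ⟨n, rfl⟩
    have := h.2.1
    simp at this
    linarith [(Nat.cast_nonneg n : (0 : ℝ) ≤ n)]
  · rintro rfl
    have := h.2.2
    simp at this

/-- The trivial zeros have real part at most `-2`, and RH places every other zero on the critical
line; hence all zeros met in the discs below are nontrivial ones. -/
lemma zetaPole_eq_zero_iff (hRH : RiemannHypothesis) {s : ℂ} (hs : -1 < s.re) :
    zetaPole s = 0 ↔ s ∈ nontrivialZetaZeros := by
  by_cases h1 : s = 1
  · subst h1
    rw [zetaPole_one]
    simp [nontrivialZetaZeros]
  · rw [zetaPole_eq hs h1, mul_eq_zero, or_iff_right (sub_ne_zero.2 h1)]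
    refine ⟨fun h => ?_, fun h => h.1⟩
    have : s.re = 1 / 2 := by
      refine hRH s h ?_ h1
      rintro ⟨n, rfl⟩
      simp at hs
      linarith [(Nat.cast_nonneg n : (0 : ℝ) ≤ n)]
    exact ⟨h, by rw [this]; norm_num, by rw [this]; norm_num⟩

lemma zetaZeroMult_eq {s : ℂ} (hs : s ∈ nontrivialZetaZeros) :
    zetaZeroMult s = analyticOrderNatAt zetaPole s := by
  have h1 : s ≠ 1 := by rintro rfl; simpa using hs.2.2
  have hre : -1 < s.re := by linarith [hs.2.1]
  have e : zetaPole =ᶠ[𝓝 s] (fun z => z - 1) * riemannZeta := by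
    filter_upwards [isOpen_ne.mem_nhds h1, (isOpen_re_gt (-1)).mem_nhds hre] with z hz hz'
    exact zetaPole_eq hz' hz
  have ha : AnalyticAt ℂ (fun z : ℂ => z - 1) s := analyticAt_id.sub analyticAt_const
  rw [zetaZeroMult, analyticOrderNatAt, analyticOrderNatAt, analyticOrderAt_congr e,
    analyticOrderAt_mul ha (analyticOn_riemannZeta s h1),
    ha.analyticOrderAt_eq_zero.2 (sub_ne_zero.2 h1), zero_add]

lemma finite_zeros_inter_closedBall (c : ℂ) (r : ℝ) :
    (nontrivialZetaZeros ∩ closedBall c r).Finite := by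
  refine ((isCompact_closedBall c r).inter_riemannZetaZeros_finite).subset ?_
  exact fun z hz => ⟨hz.2, hz.1.1⟩

/-- The nontrivial zeros at distance at most `11 / 5` from `2 + i t`. -/
noncomputable def nearZeros (t : ℝ) : Finset ℂ :=
  (finite_zeros_inter_closedBall (2 + t * I) (11 / 5)).toFinset

lemma mem_nearZeros {t : ℝ} {z : ℂ} :
    z ∈ nearZeros t ↔ z ∈ nontrivialZetaZeros ∧ ‖z - (2 + t * I)‖ ≤ 11 / 5 := by
  simp [nearZeros, dist_eq_norm]

lemma mem_nearZeros_of_abs_sub_le (hRH : RiemannHypothesis) {t : ℝ} {ρ : ℂ}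
    (h : ρ ∈ nontrivialZetaZeros) (ht : |ρ.im - t| ≤ 3 / 2) : ρ ∈ nearZeros t := by
  refine mem_nearZeros.2 ⟨h, ?_⟩
  have h1 := re_eq_half_of_mem hRH h
  rw [← sq_le_sq₀ (norm_nonneg _) (by norm_num), Complex.sq_norm, Complex.normSq_apply]
  have e1 : (ρ - (2 + t * I)).re = -(3 / 2) := by simp [h1]; norm_num
  have e2 : (ρ - (2 + t * I)).im = ρ.im - t := by simp
  rw [e1, e2]
  -- The numbers fit because `(3/2)² + (3/2)² = 4.5` is below `(11/5)² = 4.84`.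
  nlinarith [abs_le.1 ht]

/-- The radius `13/5` keeps the disc in `Re z ≥ -3/5`, inside the domain of `zetaPole`. With `x =
|t| + 2 ≥ 2`, the exponent `13` comes from `6 + |t| ≤ x ^ 3` and `12 ≤ x ^ 4`. -/
lemma zetaPole_disc_data (t : ℝ) :
    AnalyticOnNhd ℂ zetaPole (closedBall (2 + t * I) (13 / 5)) ∧
    (∀ z ∈ closedBall (2 + t * I : ℂ) (13 / 5), ‖zetaPole z‖ ≤ 4 * (6 + |t|) ^ 3) ∧
    Real.log (4 * (6 + |t|) ^ 3 / ‖zetaPole (2 + t * I)‖) ≤ 13 * logWt t := by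
  have key : ∀ z ∈ closedBall (2 + t * I : ℂ) (13 / 5), -(3 / 5) ≤ z.re ∧ ‖z‖ ≤ 5 + |t| := by
    intro z hz
    rw [mem_closedBall, dist_eq_norm] at hz
    constructor
    · have := (abs_le.1 ((Complex.abs_re_le_norm _).trans hz)).1
      simp at this
      linarith
    · have h1 := norm_add_le (z - (2 + t * I)) (2 + t * I)
      rw [sub_add_cancel] at h1
      have h2 : ‖(2 + t * I : ℂ)‖ ≤ 2 + |t| := by
        refine (norm_add_le _ _).trans ?_
        simp
      linarith
  refine ⟨analyticOnNhd_zetaPole.mono fun z hz => ?_, fun z hz => ?_, ?_⟩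
  · have := (key z hz).1
    simp only [mem_ofPred_eq]
    linarith
  · have := norm_zetaPole_le (key z hz).1 (by positivity) (key z hz).2
    rwa [show 1 + (5 + |t|) = 6 + |t| by ring] at this
  · have h1 := norm_zetaPole_two_add_ge t
    have hx := abs_nonneg t
    rw [logWt, ← Real.log_rpow (by positivity)]
    refine Real.log_le_log (by positivity) ?_
    rw [div_le_iff₀ (by linarith)]
    have e : (|t| + 2) ^ (13 : ℝ) = (|t| + 2) ^ 13 := by norm_cast
    rw [e]
    set x := |t| + 2 with hxd
    have hx2 : 2 ≤ x := by linarith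
    have h3 : 6 + |t| ≤ x ^ 3 := by nlinarith [sq_nonneg x]
    have h4 : (6 + |t|) ^ 3 ≤ (x ^ 3) ^ 3 := pow_le_pow_left₀ (by positivity) h3 3
    have h5 : (16 : ℝ) ≤ x ^ 4 := by
      have := pow_le_pow_left₀ (by norm_num) hx2 4
      norm_num at this
      exact this
    have h6 : (0 : ℝ) ≤ x ^ 9 := by positivity
    have : 4 * (6 + |t|) ^ 3 ≤ x ^ 13 * (1 / 3) := by
      have e2 : x ^ 13 = x ^ 9 * x ^ 4 := by ring
      have e3 : (x ^ 3) ^ 3 = x ^ 9 := by ring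
      rw [e3] at h4
      rw [e2]
      nlinarith
    refine this.trans ?_
    gcongr

lemma one_le_disc_bound (t : ℝ) : 1 ≤ 4 * (6 + |t|) ^ 3 := by
  have : (1 : ℝ) ≤ (6 + |t|) ^ 3 := one_le_pow₀ (by linarith [abs_nonneg t])
  linarith

lemma zetaPole_two_add_ne_zero (t : ℝ) : zetaPole (2 + t * I) ≠ 0 := by
  intro h
  have := norm_zetaPole_two_add_ge t
  rw [h, norm_zero] at this
  norm_num at this

theorem exists_sum_nearZeros_le : ∃ A : ℝ, 0 < A ∧
    ∀ t : ℝ, ∑ ρ ∈ nearZeros t, (zetaZeroMult ρ : ℝ) ≤ A * logWt t := by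
  have hlog : 0 < Real.log (13 / 5 / (11 / 5)) := Real.log_pos (by norm_num)
  refine ⟨13 / Real.log (13 / 5 / (11 / 5)), by positivity, fun t => ?_⟩
  obtain ⟨h1, h2, h3⟩ := zetaPole_disc_data t
  have h4 := sum_analyticOrderNatAt_le (r := 11 / 5) (R := 13 / 5) (by norm_num) (by norm_num)
    (one_le_disc_bound t) h1 (zetaPole_two_add_ne_zero t)
    (fun z hz => h2 z (sphere_subset_closedBall hz)) (nearZeros t)
    (fun u hu => by rw [mem_closedBall, dist_eq_norm]; exact (mem_nearZeros.1 hu).2)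
  calc ∑ ρ ∈ nearZeros t, (zetaZeroMult ρ : ℝ)
      = ∑ ρ ∈ nearZeros t, (analyticOrderNatAt zetaPole ρ : ℝ) :=
        Finset.sum_congr rfl fun u hu => by rw [zetaZeroMult_eq (mem_nearZeros.1 hu).1]
    _ ≤ _ := h4
    _ ≤ 13 * logWt t / Real.log (13 / 5 / (11 / 5)) := by gcongr
    _ = _ := by ring

theorem exists_logDeriv_zetaPole_eq (hRH : RiemannHypothesis) : ∃ A : ℝ, 0 < A ∧
    ∀ t : ℝ, ∃ H : ℂ → ℂ, AnalyticOnNhd ℂ H (ball (2 + t * I) (11 / 5)) ∧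
      (∀ z ∈ ball (2 + t * I : ℂ) (11 / 5), zetaPole z ≠ 0 →
        logDeriv zetaPole z = ∑ ρ ∈ nearZeros t, (zetaZeroMult ρ : ℂ) / (z - ρ) + H z) ∧
      ∀ z ∈ closedBall (2 + t * I : ℂ) 2, ‖H z‖ ≤ A * logWt t := by
  set K : ℝ := 1 + Real.log (11 / 5 / (13 / 5 - 11 / 5)) / Real.log (13 / 5 / (11 / 5)) with hK
  have hK0 : 0 < K := by
    have h1 : 0 < Real.log (13 / 5 / (11 / 5)) := Real.log_pos (by norm_num)
    have h2 : 0 < Real.log (11 / 5 / (13 / 5 - 11 / 5)) := Real.log_pos (by norm_num)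
    positivity
  refine ⟨8 * (11 / 5) / (11 / 5 - 2) ^ 2 * (2 + 13 * K), by positivity, fun t => ?_⟩
  obtain ⟨h1, h2, h3⟩ := zetaPole_disc_data t
  obtain ⟨H, hH1, hH2, hH3⟩ := exists_logDeriv_eq_sum_add (r₁ := 11 / 5) (r₂ := 2) (R := 13 / 5)
    (by norm_num) (by norm_num) (by norm_num)
    (one_le_disc_bound t) h1 (zetaPole_two_add_ne_zero t)
    (h2 _ (mem_closedBall_self (by norm_num))) (by norm_num)
    (fun z hz => h2 z (sphere_subset_closedBall hz)) (nearZeros t)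
    (fun u hu => by rw [mem_closedBall, dist_eq_norm]; exact (mem_nearZeros.1 hu).2)
    (fun u hu hu0 => by
      rw [mem_closedBall, dist_eq_norm] at hu
      refine mem_nearZeros.2 ⟨(zetaPole_eq_zero_iff hRH ?_).1 hu0, hu⟩
      have := (abs_le.1 ((Complex.abs_re_le_norm _).trans hu)).1
      simp at this
      linarith)
  refine ⟨H, hH1, fun z hz hz0 => ?_, fun z hz => (hH3 z hz).trans ?_⟩
  · rw [hH2 z hz hz0]
    congr 1
    exact Finset.sum_congr rfl fun u hu => by rw [zetaZeroMult_eq (mem_nearZeros.1 hu).1]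
  · rw [← hK, mul_assoc]
    refine mul_le_mul_of_nonneg_left ?_ (by positivity)
    have := half_le_logWt t
    nlinarith [mul_le_mul_of_nonneg_right h3 hK0.le]

lemma summable_and_tsum_le_of_ennreal {ι : Type*} {f : ι → ℝ} (hf : ∀ i, 0 ≤ f i) {C : ℝ}
    (hC : 0 ≤ C) (h : ∑' i, ENNReal.ofReal (f i) ≤ ENNReal.ofReal C) :
    Summable f ∧ ∑' i, f i ≤ C := by
  have hle : ∀ s : Finset ι, ∑ i ∈ s, f i ≤ C := by
    intro s
    have := (ENNReal.sum_le_tsum s).trans h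
    rw [← ENNReal.ofReal_sum_of_nonneg fun i _ => hf i] at this
    exact (ENNReal.ofReal_le_ofReal_iff hC).1 this
  have hs := summable_of_sum_le hf hle
  exact ⟨hs, hs.tsum_le_of_sum_le hle⟩

/-- Sums over zeros are controlled by the unit-interval zero count. -/
theorem exists_sum_zeros_le (hRH : RiemannHypothesis) : ∃ A : ℝ, 0 < A ∧
    ∀ (t : ℝ) (f : ℝ → ℝ) (F : ℤ → ℝ), (∀ x, 0 ≤ f x) →
      (∀ (k : ℤ) (x : ℝ), k ≤ x - t → x - t < k + 1 → f x ≤ F k) →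
      Summable (fun k : ℤ => (logWt t + logWt k) * F k) →
      Summable (fun ρ : nontrivialZetaZeros => (zetaZeroMult ρ : ℝ) * f (ρ : ℂ).im) ∧
      ∑' ρ : nontrivialZetaZeros, (zetaZeroMult ρ : ℝ) * f (ρ : ℂ).im ≤
        A * ∑' k : ℤ, (logWt t + logWt k) * F k := by
  obtain ⟨A, hA, hcount⟩ := exists_sum_nearZeros_le
  refine ⟨A, hA, fun t f F hf hF hsum => ?_⟩
  have hF0 : ∀ k, 0 ≤ F k := fun k =>
    (hf (k + t)).trans (hF k (k + t) (by linarith) (by linarith))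
  have hw : ∀ k : ℤ, 0 ≤ (logWt t + logWt k) * F k := fun k =>
    mul_nonneg (add_nonneg (logWt_pos _).le (logWt_pos _).le) (hF0 k)
  refine summable_and_tsum_le_of_ennreal (fun ρ => mul_nonneg (Nat.cast_nonneg _) (hf _))
    (mul_nonneg hA.le (tsum_nonneg hw)) ?_
  set g : nontrivialZetaZeros → ENNReal :=
    fun ρ => ENNReal.ofReal ((zetaZeroMult ρ : ℝ) * f (ρ : ℂ).im) with hg
  set π : nontrivialZetaZeros → ℤ := fun ρ => ⌊(ρ : ℂ).im - t⌋ with hπ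
  -- The zeros are grouped by the integer part of `Im ρ - t`. Working in `ENNReal` allows the
  -- regrouping before summability is known.
  rw [← (Equiv.sigmaFiberEquiv π).tsum_eq g, ENNReal.tsum_sigma', ← tsum_mul_left,
    ENNReal.ofReal_tsum_of_nonneg (fun k => mul_nonneg hA.le (hw k)) (hsum.mul_left A)]
  refine ENNReal.tsum_le_tsum fun k => ?_
  rw [ENNReal.tsum_eq_iSup_sum]
  refine iSup_le fun s => ?_
  have hinj : Function.Injective fun ρ : {ρ : nontrivialZetaZeros // π ρ = k} => ((ρ : nontrivialZetaZeros) : ℂ) :=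
    fun a b h => Subtype.ext (Subtype.ext h)
  classical
  have hmem : ∀ ρ : {ρ : nontrivialZetaZeros // π ρ = k},
      (k : ℝ) ≤ ((ρ : nontrivialZetaZeros) : ℂ).im - t ∧
        ((ρ : nontrivialZetaZeros) : ℂ).im - t < k + 1 := fun ρ => Int.floor_eq_iff.1 ρ.2
  calc ∑ ρ ∈ s, g ((Equiv.sigmaFiberEquiv π) ⟨k, ρ⟩)
      ≤ ∑ ρ ∈ s, ENNReal.ofReal ((zetaZeroMult ((ρ : nontrivialZetaZeros) : ℂ) : ℝ) * F k) := by
        refine Finset.sum_le_sum fun ρ _ => ENNReal.ofReal_le_ofReal ?_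
        exact mul_le_mul_of_nonneg_left (hF k _ (hmem ρ).1 (hmem ρ).2) (Nat.cast_nonneg _)
    _ = ENNReal.ofReal (∑ ρ ∈ s, (zetaZeroMult ((ρ : nontrivialZetaZeros) : ℂ) : ℝ) * F k) := by
        rw [ENNReal.ofReal_sum_of_nonneg]
        exact fun ρ _ => mul_nonneg (Nat.cast_nonneg _) (hF0 k)
    _ ≤ _ := by
        refine ENNReal.ofReal_le_ofReal ?_
        rw [← Finset.sum_mul]
        have e : ∑ ρ ∈ s, (zetaZeroMult ((ρ : nontrivialZetaZeros) : ℂ) : ℝ) =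
            ∑ z ∈ s.image (fun ρ : {ρ : nontrivialZetaZeros // π ρ = k} =>
              ((ρ : nontrivialZetaZeros) : ℂ)), (zetaZeroMult z : ℝ) := by
          rw [Finset.sum_image fun a _ b _ h => hinj h]
        -- All zeros of the `k`-th group have ordinate within `1` of `t + k`, so the local count at
        -- height `t + k` applies.
        have h1 : ∑ z ∈ s.image (fun ρ : {ρ : nontrivialZetaZeros // π ρ = k} =>
              ((ρ : nontrivialZetaZeros) : ℂ)), (zetaZeroMult z : ℝ) ≤
            ∑ z ∈ nearZeros (t + k), (zetaZeroMult z : ℝ) := by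
          refine Finset.sum_le_sum_of_subset_of_nonneg ?_ fun _ _ _ => Nat.cast_nonneg _
          intro z hz
          obtain ⟨ρ, _, rfl⟩ := Finset.mem_image.1 hz
          refine mem_nearZeros_of_abs_sub_le hRH ρ.1.2 ?_
          rw [abs_le]
          have := hmem ρ
          constructor <;> linarith
        have h2 := hcount (t + k)
        have h3 := logWt_add_le t k
        rw [e, ← mul_assoc]
        refine mul_le_mul_of_nonneg_right ?_ (hF0 k)
        nlinarith

end GoldbachAverage

/-! ### Weighted sums over the zeros. -/

namespace GoldbachAverage

open Complex Set Filter Topology Metric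

lemma summable_int_of_summable_nat_abs {f : ℝ → ℝ} (h : Summable fun n : ℕ => f n) :
    Summable fun k : ℤ => f |(k : ℝ)| := by
  refine Summable.of_nat_of_neg ?_ ?_
  · simpa using h
  · simpa using h

lemma logWt_le_rpow {t ε : ℝ} (hε : 0 < ε) : logWt t ≤ (|t| + 2) ^ ε / ε :=
  Real.log_le_rpow_div (by positivity) hε

/-- The decay weight `(1 + |x|) ^ (-5/4)`. -/
noncomputable def decayWt (x : ℝ) : ℝ := (1 + |x|) ^ (-(5 / 4) : ℝ)

lemma decayWt_pos (x : ℝ) : 0 < decayWt x := by unfold decayWt; positivity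

lemma decayWt_le_of_two_mul {x y : ℝ} (h : 1 + |y| ≤ 4 * (1 + |x|)) :
    decayWt x ≤ 16 * decayWt y := by
  unfold decayWt
  have h1 : 0 < 1 + |x| := by positivity
  have h2 : 0 < 1 + |y| := by positivity
  have h3 : ((1 + |y|) / 4) ^ (5 / 4 : ℝ) ≤ (1 + |x|) ^ (5 / 4 : ℝ) :=
    Real.rpow_le_rpow (by positivity) (by linarith) (by norm_num)
  have h4 : (4 : ℝ) ^ (5 / 4 : ℝ) ≤ 16 := by
    calc (4 : ℝ) ^ (5 / 4 : ℝ) ≤ (4 : ℝ) ^ (2 : ℝ) :=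
          Real.rpow_le_rpow_of_exponent_le (by norm_num) (by norm_num)
      _ = 16 := by norm_num
  rw [Real.div_rpow h2.le (by norm_num)] at h3
  rw [Real.rpow_neg h1.le, Real.rpow_neg h2.le, ← div_eq_mul_inv,
    inv_le_comm₀ (by positivity) (by positivity), inv_div]
  refine le_trans ?_ h3
  gcongr

lemma summable_decayWt : Summable fun k : ℤ => decayWt k := by
  have : Summable fun n : ℕ => (1 + (n : ℝ)) ^ (-(5 / 4) : ℝ) := by
    have := (summable_nat_add_iff 1).2 (Real.summable_nat_rpow.2 (by norm_num : (-(5 / 4) : ℝ) < -1))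
    refine this.congr fun n => ?_
    push_cast
    rw [add_comm]
  exact summable_int_of_summable_nat_abs (f := fun x => (1 + x) ^ (-(5 / 4) : ℝ)) this

/-- The logarithm is absorbed into a power `1/8`, which leaves the exponent `-5/4 + 1/8 = -9/8`,
still below `-1`. -/
lemma summable_logWt_mul_decayWt : Summable fun k : ℤ => logWt k * decayWt k := by
  have h1 : Summable fun n : ℕ => (1 + (n : ℝ)) ^ (-(9 / 8) : ℝ) := by
    have := (summable_nat_add_iff 1).2 (Real.summable_nat_rpow.2 (by norm_num : (-(9 / 8) : ℝ) < -1))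
    refine this.congr fun n => ?_
    push_cast
    rw [add_comm]
  have h2 := (summable_int_of_summable_nat_abs (f := fun x => (1 + x) ^ (-(9 / 8) : ℝ)) h1).mul_left 16
  refine Summable.of_nonneg_of_le (fun k => mul_nonneg (logWt_pos _).le (decayWt_pos _).le) ?_ h2
  intro k
  have hx := abs_nonneg (k : ℝ)
  have h3 := logWt_le_rpow (t := k) (ε := 1 / 8) (by norm_num)
  have h4 : (|(k : ℝ)| + 2) ^ (1 / 8 : ℝ) ≤ 2 * (1 + |(k : ℝ)|) ^ (1 / 8 : ℝ) := by
    calc (|(k : ℝ)| + 2) ^ (1 / 8 : ℝ) ≤ (2 * (1 + |(k : ℝ)|)) ^ (1 / 8 : ℝ) :=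
          Real.rpow_le_rpow (by positivity) (by linarith) (by norm_num)
      _ = 2 ^ (1 / 8 : ℝ) * (1 + |(k : ℝ)|) ^ (1 / 8 : ℝ) :=
          Real.mul_rpow (by norm_num) (by positivity)
      _ ≤ 2 * (1 + |(k : ℝ)|) ^ (1 / 8 : ℝ) := by
          gcongr
          calc (2 : ℝ) ^ (1 / 8 : ℝ) ≤ 2 ^ (1 : ℝ) :=
                Real.rpow_le_rpow_of_exponent_le (by norm_num) (by norm_num)
            _ = 2 := by simp
  have h5 : logWt k ≤ 16 * (1 + |(k : ℝ)|) ^ (1 / 8 : ℝ) := by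
    rw [div_eq_mul_inv] at h3
    norm_num at h3
    norm_num at h4 ⊢
    linarith
  calc logWt k * decayWt k ≤ 16 * (1 + |(k : ℝ)|) ^ (1 / 8 : ℝ) * decayWt k :=
        mul_le_mul_of_nonneg_right h5 (decayWt_pos _).le
    _ = 16 * (1 + |(k : ℝ)|) ^ (-(9 / 8) : ℝ) := by
        rw [decayWt, mul_assoc, ← Real.rpow_add (by positivity)]
        norm_num

lemma one_add_abs_int_le {k : ℤ} {x : ℝ} (h1 : k ≤ x) (h2 : x < k + 1) :
    1 + |(k : ℝ)| ≤ 2 * (1 + |x|) := by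
  have h3 : |(k : ℝ)| ≤ |x| + 1 := by
    have h4 : |(k : ℝ) - x| ≤ 1 := by rw [abs_le]; constructor <;> linarith
    have := abs_add_le ((k : ℝ) - x) x
    rw [sub_add_cancel] at this
    linarith
  linarith [abs_nonneg x]

theorem exists_sum_decayWt_le (hRH : RiemannHypothesis) : ∃ A : ℝ, 0 < A ∧ ∀ t : ℝ,
    Summable (fun ρ : nontrivialZetaZeros => (zetaZeroMult ρ : ℝ) * decayWt ((ρ : ℂ).im - t)) ∧
    ∑' ρ : nontrivialZetaZeros, (zetaZeroMult ρ : ℝ) * decayWt ((ρ : ℂ).im - t) ≤ A * logWt t := by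
  obtain ⟨A, hA, h⟩ := exists_sum_zeros_le hRH
  set K₁ := ∑' k : ℤ, decayWt k
  set K₂ := ∑' k : ℤ, logWt k * decayWt k
  have hK1 : 0 ≤ K₁ := tsum_nonneg fun k => (decayWt_pos _).le
  have hK2 : 0 ≤ K₂ := tsum_nonneg fun k => mul_nonneg (logWt_pos _).le (decayWt_pos _).le
  refine ⟨A * (16 * K₁ + 32 * K₂) + 1, by positivity, fun t => ?_⟩
  have hs1 : Summable fun k : ℤ => logWt t * (16 * decayWt k) :=
    (summable_decayWt.mul_left 16).mul_left _
  have hs2 : Summable fun k : ℤ => logWt k * (16 * decayWt k) := by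
    refine (summable_logWt_mul_decayWt.mul_left 16).congr fun k => ?_
    ring
  have hs : Summable fun k : ℤ => (logWt t + logWt k) * (16 * decayWt k) := by
    refine (hs1.add hs2).congr fun k => ?_
    ring
  obtain ⟨h1, h2⟩ := h t (fun x => decayWt (x - t)) (fun k => 16 * decayWt k)
    (fun x => (decayWt_pos _).le) (fun k x hk hk' => by
      refine decayWt_le_of_two_mul ?_
      have := one_add_abs_int_le hk hk'
      linarith [abs_nonneg (x - t)]) hs
  refine ⟨h1, h2.trans ?_⟩
  have e : ∑' k : ℤ, (logWt t + logWt k) * (16 * decayWt k) = 16 * (logWt t * K₁) + 16 * K₂ := by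
    rw [← tsum_mul_left, ← tsum_mul_left, ← tsum_mul_left, ← Summable.tsum_add]
    · exact tsum_congr fun k => by ring
    · exact (summable_decayWt.mul_left _).mul_left _
    · exact summable_logWt_mul_decayWt.mul_left _
  rw [e]
  have := half_le_logWt t
  have h3 : A * K₂ ≤ A * K₂ * (2 * logWt t) := by
    refine le_mul_of_one_le_right (by positivity) (by linarith)
  nlinarith

lemma exp_neg_sq_le_decayWt (x : ℝ) : Real.exp (-x ^ 2 / 4) ≤ 8 * decayWt x := by
  unfold decayWt
  have hx := abs_nonneg x
  have h1 : 1 + x ^ 2 / 4 ≤ Real.exp (x ^ 2 / 4) := by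
    linarith [Real.add_one_le_exp (x ^ 2 / 4)]
  have h2 : (1 + |x|) ^ (5 / 4 : ℝ) ≤ (1 + |x|) ^ (2 : ℝ) :=
    Real.rpow_le_rpow_of_exponent_le (by linarith) (by norm_num)
  have h3 : (1 + |x|) ^ (2 : ℝ) ≤ 8 * (1 + x ^ 2 / 4) := by
    rw [Real.rpow_two]
    nlinarith [sq_abs x, sq_nonneg (|x| - 1)]
  rw [neg_div, Real.exp_neg, Real.rpow_neg (by positivity), ← div_eq_mul_inv,
    inv_le_comm₀ (Real.exp_pos _) (by positivity), inv_div, div_le_iff₀ (by norm_num)]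
  linarith

/-- These are the row sums of the large sieve kernel for the zeros. -/
theorem exists_sum_gaussian_le (hRH : RiemannHypothesis) : ∃ A : ℝ, 0 < A ∧ ∀ t : ℝ,
    Summable (fun ρ : nontrivialZetaZeros =>
      (zetaZeroMult ρ : ℝ) * Real.exp (-(t - (ρ : ℂ).im) ^ 2 / 4)) ∧
    ∑' ρ : nontrivialZetaZeros, (zetaZeroMult ρ : ℝ) * Real.exp (-(t - (ρ : ℂ).im) ^ 2 / 4) ≤
      A * logWt t := by
  obtain ⟨A, hA, h⟩ := exists_sum_decayWt_le hRH
  refine ⟨8 * A, by positivity, fun t => ?_⟩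
  obtain ⟨h1, h2⟩ := h t
  have hle : ∀ ρ : nontrivialZetaZeros,
      (zetaZeroMult ρ : ℝ) * Real.exp (-(t - (ρ : ℂ).im) ^ 2 / 4) ≤
      8 * ((zetaZeroMult ρ : ℝ) * decayWt ((ρ : ℂ).im - t)) := fun ρ => by
    rw [show (t - (ρ : ℂ).im) ^ 2 = ((ρ : ℂ).im - t) ^ 2 by ring, mul_left_comm]
    exact mul_le_mul_of_nonneg_left (exp_neg_sq_le_decayWt _) (Nat.cast_nonneg _)
  have hs := Summable.of_nonneg_of_le (fun ρ => by positivity) hle (h1.mul_left 8)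
  refine ⟨hs, (hs.tsum_le_tsum hle (h1.mul_left 8)).trans ?_⟩
  rw [tsum_mul_left, mul_assoc]
  linarith

/-- The scale function `√(1 + x / T)`. -/
noncomputable def scaleWt (T x : ℝ) : ℝ := √(1 + x / T)

lemma one_le_scaleWt {T x : ℝ} (hT : 0 < T) (hx : 0 ≤ x) : 1 ≤ scaleWt T x :=
  Real.one_le_sqrt.2 (by have := div_nonneg hx hT.le; linarith)

lemma scaleWt_sq {T x : ℝ} (hT : 0 < T) (hx : 0 ≤ x) : scaleWt T x ^ 2 = 1 + x / T :=
  Real.sq_sqrt (by have := div_nonneg hx hT.le; linarith)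

/-- Discrete form of the fact that `-2 T (1 + x / T) ^ (-1/2)` has derivative `(1 + x / T) ^
(-3/2)`; the right side telescopes. -/
lemma inv_scaleWt_cube_le {T : ℝ} (hT : 0 < T) (n : ℕ) :
    (scaleWt T (n + 1))⁻¹ ^ 3 ≤ 2 * T * ((scaleWt T n)⁻¹ - (scaleWt T (n + 1))⁻¹) := by
  have ha := one_le_scaleWt hT (Nat.cast_nonneg n)
  have hb := one_le_scaleWt hT (show (0 : ℝ) ≤ n + 1 by positivity)
  have ha2 := scaleWt_sq hT (Nat.cast_nonneg n)
  have hb2 := scaleWt_sq hT (show (0 : ℝ) ≤ n + 1 by positivity)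
  set a := scaleWt T n
  set b := scaleWt T (n + 1)
  have hab : a ≤ b := by
    refine Real.sqrt_le_sqrt ?_
    gcongr
    linarith
  have hd : T * (b ^ 2 - a ^ 2) = 1 := by rw [ha2, hb2]; field_simp; ring
  have hap : 0 < a := by linarith
  have hbp : 0 < b := by linarith
  have e : 2 * T * (a⁻¹ - b⁻¹) = 2 * T * (b - a) / (a * b) := by field_simp
  rw [e, ← one_div, div_pow, one_pow, div_le_div_iff₀ (by positivity) (by positivity), ← hd]
  have h1 : (a + b) * (a * b) ≤ 2 * b * (b * b) := by
    have : a * b ≤ b * b := by nlinarith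
    nlinarith [mul_pos hap hbp]
  have h2 : 0 ≤ T * (b - a) := mul_nonneg hT.le (by linarith)
  nlinarith [mul_le_mul_of_nonneg_left h1 h2]

lemma summable_inv_scaleWt_cube {T : ℝ} (hT : 1 ≤ T) :
    Summable (fun k : ℤ => (scaleWt T |(k : ℝ)|)⁻¹ ^ 3) ∧
      ∑' k : ℤ, (scaleWt T |(k : ℝ)|)⁻¹ ^ 3 ≤ 5 * T := by
  have hT0 : 0 < T := by linarith
  have hnn : ∀ n : ℕ, 0 ≤ (scaleWt T (n + 1))⁻¹ ^ 3 := fun n => by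
    have := one_le_scaleWt hT0 (show (0 : ℝ) ≤ n + 1 by positivity)
    positivity
  have hpart : ∀ N : ℕ, ∑ n ∈ Finset.range N, (scaleWt T (n + 1))⁻¹ ^ 3 ≤ 2 * T := by
    intro N
    calc _ ≤ ∑ n ∈ Finset.range N, 2 * T * ((scaleWt T n)⁻¹ - (scaleWt T ((n + 1 : ℕ) : ℝ))⁻¹) :=
          Finset.sum_le_sum fun n _ => by
            have := inv_scaleWt_cube_le hT0 n
            push_cast
            exact this
      _ = 2 * T * ((scaleWt T (0 : ℕ))⁻¹ - (scaleWt T N)⁻¹) := by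
          rw [← Finset.mul_sum, Finset.sum_range_sub']
      _ ≤ 2 * T * 1 := by
          have h0 : scaleWt T ((0 : ℕ) : ℝ) = 1 := by simp [scaleWt]
          rw [h0, inv_one]
          have := one_le_scaleWt hT0 (Nat.cast_nonneg N)
          have h1 : 0 ≤ (scaleWt T N)⁻¹ := by positivity
          exact mul_le_mul_of_nonneg_left (by linarith) (by positivity)
      _ = 2 * T := by ring
  have hs := summable_of_sum_range_le hnn hpart
  have hle := Real.tsum_le_of_sum_range_le hnn hpart
  have h0 : (scaleWt T 0)⁻¹ ^ 3 = 1 := by simp [scaleWt]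
  have e1 : (fun n : ℕ => (scaleWt T |((n + 1 : ℕ) : ℤ)|)⁻¹ ^ 3) =
      fun n : ℕ => (scaleWt T (n + 1))⁻¹ ^ 3 := by
    funext n
    congr 3
    push_cast
    exact abs_of_nonneg (by positivity)
  have hsn : Summable fun n : ℕ => (scaleWt T (n : ℝ))⁻¹ ^ 3 := by
    refine (summable_nat_add_iff 1).1 ?_
    refine hs.congr fun n => ?_
    push_cast
    rfl
  have hsum := summable_int_of_summable_nat_abs (f := fun x => (scaleWt T x)⁻¹ ^ 3) hsn
  refine ⟨hsum, ?_⟩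
  have h3 : HasSum (fun k : ℤ => (scaleWt T |(k : ℝ)|)⁻¹ ^ 3)
      ((∑' n : ℕ, (scaleWt T (n : ℝ))⁻¹ ^ 3) + ∑' n : ℕ, (scaleWt T (n + 1))⁻¹ ^ 3) := by
    refine HasSum.of_nat_of_neg_add_one ?_ ?_
    · simpa using hsn.hasSum
    · convert hs.hasSum using 3 with n
      push_cast
      rw [abs_of_nonpos (by have : (0 : ℝ) ≤ n := Nat.cast_nonneg n; linarith)]
      congr 2
      ring
  -- The term `k = 0` contributes `1`, and each sign of `k` at most `2 T`; `T ≥ 1` gives `5 T`.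
  rw [h3.tsum_eq, hsn.tsum_eq_zero_add]
  push_cast
  rw [h0]
  linarith

end GoldbachAverage

namespace GoldbachAverage

open Complex Set Filter Topology Metric

lemma logWt_le_two_mul {k : ℤ} {x : ℝ} (h1 : k ≤ x) (h2 : x < k + 1) :
    logWt x ≤ 2 * logWt k := by
  have h3 : |x| ≤ |(k : ℝ)| + 1 := by
    have h4 : |x - k| ≤ 1 := by rw [abs_le]; constructor <;> linarith
    have := abs_add_le (x - k) (k : ℝ)
    rw [sub_add_cancel] at this
    linarith
  have hk := abs_nonneg (k : ℝ)
  have h4 : Real.log 2 ≤ logWt k := Real.log_le_log (by norm_num) (by linarith)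
  calc logWt x ≤ Real.log (2 * (|(k : ℝ)| + 2)) :=
        Real.log_le_log (by positivity) (by linarith)
    _ = Real.log 2 + logWt k := Real.log_mul (by norm_num) (by positivity)
    _ ≤ _ := by linarith

lemma logWt_zero_le (x : ℝ) : logWt 0 ≤ logWt x :=
  Real.log_le_log (by positivity) (by simp)

/-- Above height `T` the logarithm exceeds `log T` only by `O(log (1 + |x| / T))`. Trading this for
half a power of `scaleWt` means that `logWt ^ 2` costs one factor, taking `scaleWt⁻¹ ^ 4` to the
summable `scaleWt⁻¹ ^ 3`. -/
lemma logWt_le_sqrt_scaleWt {T x : ℝ} (hT : 1 ≤ T) :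
    logWt x ≤ 9 * logWt T * √(scaleWt T |x|) := by
  have hT0 : 0 < T := by linarith
  have hx := abs_nonneg x
  have h1 := one_le_scaleWt hT0 hx
  have h2 := scaleWt_sq hT0 hx
  set s := scaleWt T |x|
  have hr : 1 ≤ √s := Real.one_le_sqrt.2 h1
  have hrs : √s ^ 2 = s := Real.sq_sqrt (by linarith)
  have h3 : |x| + 2 ≤ (|T| + 2) * s ^ 2 := by
    rw [h2, abs_of_pos hT0]
    have e : (T + 2) * (1 + |x| / T) = T + 2 + |x| + 2 * |x| / T := by field_simp; ring
    rw [e]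
    have : 0 ≤ 2 * |x| / T := by positivity
    linarith
  have h4 : logWt x ≤ logWt T + 4 * Real.log √s := by
    calc logWt x ≤ Real.log ((|T| + 2) * s ^ 2) := Real.log_le_log (by positivity) h3
      _ = logWt T + Real.log (s ^ 2) := Real.log_mul (by positivity) (by positivity)
      _ = _ := by
        rw [← hrs, ← pow_mul, Real.log_pow, Real.sqrt_sq (by linarith)]
        norm_num
  have h5 : Real.log √s ≤ √s := (Real.log_le_sub_one_of_pos (by linarith)).trans (by linarith)
  have h6 := half_le_logWt T
  nlinarith

lemma zeros_weight_le {T x : ℝ} (hT : 1 ≤ T) {k : ℤ} (h1 : k ≤ x) (h2 : x < k + 1) :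
    logWt x / (1 + |x| / T) ^ 2 ≤ 8 * logWt k * (scaleWt T |(k : ℝ)|)⁻¹ ^ 4 := by
  have hT0 : 0 < T := by linarith
  have hs := scaleWt_sq hT0 (abs_nonneg (k : ℝ))
  have hs1 := one_le_scaleWt hT0 (abs_nonneg (k : ℝ))
  set s := scaleWt T |(k : ℝ)|
  have h3 : |(k : ℝ)| ≤ |x| + 1 := by
    have h4 : |(k : ℝ) - x| ≤ 1 := by rw [abs_le]; constructor <;> linarith
    have := abs_add_le ((k : ℝ) - x) x
    rw [sub_add_cancel] at this
    linarith
  have h4 : s ^ 2 ≤ 2 * (1 + |x| / T) := by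
    rw [hs]
    have h5 : |(k : ℝ)| / T ≤ |x| / T + 1 := by
      rw [div_add_one hT0.ne']
      gcongr
      linarith
    have : 0 ≤ |x| / T := by positivity
    linarith
  have h5 : (s ^ 2) ^ 2 ≤ (2 * (1 + |x| / T)) ^ 2 := pow_le_pow_left₀ (by positivity) h4 2
  have h6 := logWt_le_two_mul h1 h2
  have h7 := logWt_pos k
  have e : 8 * logWt k * s⁻¹ ^ 4 = 2 * logWt k / (s ^ 2 / 2) ^ 2 := by
    field_simp
    ring
  rw [e]
  have h8 : s ^ 2 / 2 ≤ 1 + |x| / T := by linarith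
  gcongr

/-- There are `O(T log T)` zeros up to height `T`, each weighted by a logarithm, and the square in
the denominator makes the tail comparable. This is the diagonal sum of the large sieve, one
logarithm coming from the density of zeros and one from the row sums. -/
theorem exists_sum_logWt_le (hRH : RiemannHypothesis) : ∃ A : ℝ, 0 < A ∧ ∀ T : ℝ, 1 ≤ T →
    Summable (fun ρ : nontrivialZetaZeros =>
      (zetaZeroMult ρ : ℝ) * (logWt (ρ : ℂ).im / (1 + |(ρ : ℂ).im| / T) ^ 2)) ∧
    ∑' ρ : nontrivialZetaZeros,
      (zetaZeroMult ρ : ℝ) * (logWt (ρ : ℂ).im / (1 + |(ρ : ℂ).im| / T) ^ 2) ≤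
        A * (T * logWt T ^ 2) := by
  obtain ⟨A, hA, h⟩ := exists_sum_zeros_le hRH
  -- Here `6480 = 5 * 1296` and `1296 = 16 * 81`, from `5 T` and the square of `9 logWt T`.
  refine ⟨A * 6480, by positivity, fun T hT => ?_⟩
  have hT0 : 0 < T := by linarith
  obtain ⟨hs, hs'⟩ := summable_inv_scaleWt_cube hT
  have hF0 : ∀ k : ℤ, 0 ≤ 8 * logWt k * (scaleWt T |(k : ℝ)|)⁻¹ ^ 4 := fun k => by
    have := logWt_pos k
    positivity
  have hle : ∀ k : ℤ, (logWt 0 + logWt k) * (8 * logWt k * (scaleWt T |(k : ℝ)|)⁻¹ ^ 4) ≤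
      1296 * logWt T ^ 2 * (scaleWt T |(k : ℝ)|)⁻¹ ^ 3 := by
    intro k
    have hs1 := one_le_scaleWt hT0 (abs_nonneg (k : ℝ))
    have h1 := logWt_le_sqrt_scaleWt (x := k) hT
    set s := scaleWt T |(k : ℝ)|
    have h2 := logWt_pos k
    have h3 : logWt k ^ 2 ≤ 81 * logWt T ^ 2 * s := by
      calc logWt k ^ 2 ≤ (9 * logWt T * √s) ^ 2 := pow_le_pow_left₀ h2.le h1 2
        _ = 81 * logWt T ^ 2 * √s ^ 2 := by ring
        _ = _ := by rw [Real.sq_sqrt (by linarith)]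
    have h4 := logWt_zero_le k
    calc (logWt 0 + logWt k) * (8 * logWt k * s⁻¹ ^ 4)
        ≤ (2 * logWt k) * (8 * logWt k * s⁻¹ ^ 4) := by gcongr; linarith
      _ = 16 * s⁻¹ ^ 4 * logWt k ^ 2 := by ring
      _ ≤ 16 * s⁻¹ ^ 4 * (81 * logWt T ^ 2 * s) := by gcongr
      _ = _ := by field_simp; ring
  have hsum : Summable fun k : ℤ =>
      (logWt 0 + logWt k) * (8 * logWt k * (scaleWt T |(k : ℝ)|)⁻¹ ^ 4) :=
    Summable.of_nonneg_of_le (fun k => mul_nonneg (add_nonneg (logWt_pos _).le (logWt_pos _).le)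
      (hF0 k)) hle (hs.mul_left _)
  obtain ⟨h1, h2⟩ := h 0 (fun x => logWt x / (1 + |x| / T) ^ 2)
    (fun k => 8 * logWt k * (scaleWt T |(k : ℝ)|)⁻¹ ^ 4)
    (fun x => div_nonneg (logWt_pos _).le (by positivity))
    (fun k x hk hk' => zeros_weight_le hT (by linarith) (by linarith)) hsum
  refine ⟨h1, h2.trans ?_⟩
  rw [mul_assoc A]
  refine mul_le_mul_of_nonneg_left ?_ hA.le
  refine (hsum.tsum_le_tsum hle (hs.mul_left _)).trans ?_
  rw [tsum_mul_left]
  nlinarith [sq_nonneg (logWt T)]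

end GoldbachAverage

/-! ### The regular part of `-ζ'/ζ` in the strip `0 < Re s < 4`. -/

namespace GoldbachAverage

open Complex Set Filter Topology Metric

lemma one_add_abs_im_le (hRH : RiemannHypothesis) {ρ : ℂ} (h : ρ ∈ nontrivialZetaZeros) :
    1 + |ρ.im| ≤ 3 * ‖ρ‖ := by
  have h1 := Complex.abs_re_le_norm ρ
  have h2 := Complex.abs_im_le_norm ρ
  rw [re_eq_half_of_mem hRH h] at h1
  rw [abs_of_pos (by norm_num)] at h1
  linarith

lemma ne_zero_of_mem {ρ : ℂ} (h : ρ ∈ nontrivialZetaZeros) : ρ ≠ 0 := by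
  rintro rfl
  simpa using h.2.1

lemma add_one_ne_zero_of_mem {ρ : ℂ} (h : ρ ∈ nontrivialZetaZeros) : ρ + 1 ≠ 0 := by
  intro h0
  have h1 := congrArg Complex.re h0
  have := h.2.1
  simp at h1
  linarith

/-- The larger of `|a|`, `|b|` is at least `|t| / 2`. From its factor a power `3/4` becomes decay in
`t`, and the other `1/4` is lent to the smaller variable, giving the exponent `-5/4` that is
summable over zeros. -/
lemma inv_mul_inv_le_decayWt {a b t : ℝ} (h : |t| ≤ |a| + |b|) :
    (1 + |a|)⁻¹ * (1 + |b|)⁻¹ ≤ 2 * (1 + |t|) ^ (-(3 / 4) : ℝ) * (decayWt a + decayWt b) := by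
  wlog hab : |a| ≤ |b| generalizing a b
  · rw [mul_comm (1 + |a|)⁻¹, add_comm (decayWt a)]
    exact this (by linarith) (by linarith)
  have ha := abs_nonneg a
  have hb := abs_nonneg b
  have ht := abs_nonneg t
  have h1 : (1 + |b|)⁻¹ = (1 + |b|) ^ (-(1 / 4) : ℝ) * (1 + |b|) ^ (-(3 / 4) : ℝ) := by
    rw [← Real.rpow_add (by positivity), ← Real.rpow_neg_one]
    norm_num
  have h2 : (1 + |b|) ^ (-(1 / 4) : ℝ) ≤ (1 + |a|) ^ (-(1 / 4) : ℝ) :=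
    Real.rpow_le_rpow_of_nonpos (by positivity) (by linarith) (by norm_num)
  have h3 : (1 + |b|) ^ (-(3 / 4) : ℝ) ≤ 2 * (1 + |t|) ^ (-(3 / 4) : ℝ) := by
    calc (1 + |b|) ^ (-(3 / 4) : ℝ) ≤ ((1 + |t|) / 2) ^ (-(3 / 4) : ℝ) :=
          Real.rpow_le_rpow_of_nonpos (by positivity) (by linarith) (by norm_num)
      _ = 2 ^ (3 / 4 : ℝ) * (1 + |t|) ^ (-(3 / 4) : ℝ) := by
          rw [Real.div_rpow (by positivity) (by norm_num), Real.rpow_neg (by norm_num : (0:ℝ) ≤ 2),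
            div_inv_eq_mul, mul_comm]
      _ ≤ 2 ^ (1 : ℝ) * (1 + |t|) ^ (-(3 / 4) : ℝ) := by
          gcongr
          · norm_num
          · norm_num
      _ = _ := by simp
  have h4 : (1 + |a|)⁻¹ * (1 + |a|) ^ (-(1 / 4) : ℝ) = decayWt a := by
    rw [decayWt, ← Real.rpow_neg_one, ← Real.rpow_add (by positivity)]
    norm_num
  have h5 := decayWt_pos b
  calc (1 + |a|)⁻¹ * (1 + |b|)⁻¹
      ≤ (1 + |a|)⁻¹ * ((1 + |a|) ^ (-(1 / 4) : ℝ) * (2 * (1 + |t|) ^ (-(3 / 4) : ℝ))) := by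
        rw [h1]; gcongr
    _ = 2 * (1 + |t|) ^ (-(3 / 4) : ℝ) * decayWt a := by rw [← mul_assoc, h4]; ring
    _ ≤ _ := by gcongr; linarith

/-- The summand of the partial fraction expansion of `ζ' / ζ` attached to a zero. -/
noncomputable def zeroFrac (ρ z : ℂ) : ℂ := (zetaZeroMult ρ : ℂ) * (1 / (z - ρ) + 1 / ρ)

/-- The convergence factor makes the term `z / (ρ (z - ρ))`, with `|z| ≪ 1 + |t|` and quadratic
decay in `ρ`. A far zero is at distance at least `11/5 - 2 = 1/5` from `z`, so `‖z - ρ‖` is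
comparable to `1 + |Im ρ - t|`. -/
lemma norm_zeroFrac_le (hRH : RiemannHypothesis) {t : ℝ} {z ρ : ℂ}
    (hz : z ∈ closedBall (2 + t * I : ℂ) 2) (hρ : ρ ∈ nontrivialZetaZeros)
    (hfar : ρ ∉ nearZeros t) :
    ‖zeroFrac ρ z‖ ≤ 384 * (1 + |t|) ^ (1 / 4 : ℝ) *
      ((zetaZeroMult ρ : ℝ) * decayWt ρ.im + (zetaZeroMult ρ : ℝ) * decayWt (ρ.im - t)) := by
  rw [mem_closedBall, dist_eq_norm] at hz
  have hd : 1 / 5 ≤ ‖z - ρ‖ := by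
    by_contra! h
    refine hfar (mem_nearZeros.2 ⟨hρ, ?_⟩)
    have := norm_sub_le (z - (2 + t * I)) (z - ρ)
    rw [sub_sub_sub_cancel_left] at this
    linarith
  have h1 := one_add_abs_im_le hRH hρ
  have h2 : 1 + |ρ.im - t| ≤ 16 * ‖z - ρ‖ := by
    have h3 : |z.im - t| ≤ 2 := by
      have := (Complex.abs_im_le_norm (z - (2 + t * I))).trans hz
      simpa using this
    have h4 : |z.im - ρ.im| ≤ ‖z - ρ‖ := by
      simpa using Complex.abs_im_le_norm (z - ρ)
    have h5 : |ρ.im - t| ≤ |z.im - t| + |z.im - ρ.im| := by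
      have := abs_sub (z.im - t) (z.im - ρ.im)
      rwa [sub_sub_sub_cancel_left] at this
    linarith
  have h3 : ‖z‖ ≤ 4 * (1 + |t|) := by
    have h4 := norm_add_le (z - (2 + t * I)) (2 + t * I)
    rw [sub_add_cancel] at h4
    have h5 : ‖(2 + t * I : ℂ)‖ ≤ 2 + |t| := by
      refine (norm_add_le _ _).trans ?_
      simp
    linarith [abs_nonneg t]
  have hz0 : z - ρ ≠ 0 := by
    intro h; rw [h, norm_zero] at hd; norm_num at hd
  have hρ0 := ne_zero_of_mem hρ
  have e : zeroFrac ρ z = (zetaZeroMult ρ : ℂ) * (z / (ρ * (z - ρ))) := by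
    rw [zeroFrac]
    field_simp
    ring
  have hp1 : 0 < ‖ρ‖ := norm_pos_iff.2 hρ0
  have hp2 : 0 < ‖z - ρ‖ := norm_pos_iff.2 hz0
  have hm : (0 : ℝ) ≤ zetaZeroMult ρ := Nat.cast_nonneg _
  have ht := abs_nonneg t
  have h6 : ‖z / (ρ * (z - ρ))‖ ≤ 4 * (1 + |t|) * (48 * ((1 + |ρ.im|)⁻¹ * (1 + |ρ.im - t|)⁻¹)) := by
    rw [norm_div, norm_mul, div_eq_mul_inv]
    refine mul_le_mul h3 ?_ (by positivity) (by positivity)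
    rw [mul_inv]
    have i1 : ‖ρ‖⁻¹ ≤ 3 * (1 + |ρ.im|)⁻¹ := by
      rw [inv_le_comm₀ hp1 (by positivity), mul_inv, inv_inv]
      linarith
    have i2 : ‖z - ρ‖⁻¹ ≤ 16 * (1 + |ρ.im - t|)⁻¹ := by
      rw [inv_le_comm₀ hp2 (by positivity), mul_inv, inv_inv]
      linarith
    calc ‖ρ‖⁻¹ * ‖z - ρ‖⁻¹ ≤ 3 * (1 + |ρ.im|)⁻¹ * (16 * (1 + |ρ.im - t|)⁻¹) := by gcongr
      _ = _ := by ring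
  have h7 := inv_mul_inv_le_decayWt (a := ρ.im) (b := ρ.im - t) (t := t) (by
    have := abs_sub ρ.im (ρ.im - t)
    rwa [sub_sub_cancel] at this)
  have h8 : (1 + |t|) * (1 + |t|) ^ (-(3 / 4) : ℝ) = (1 + |t|) ^ (1 / 4 : ℝ) := by
    rw [← Real.rpow_one_add' (by positivity) (by norm_num)]
    norm_num
  rw [e, norm_mul, Complex.norm_natCast]
  calc (zetaZeroMult ρ : ℝ) * ‖z / (ρ * (z - ρ))‖
      ≤ zetaZeroMult ρ * (4 * (1 + |t|) * (48 * (2 * (1 + |t|) ^ (-(3 / 4) : ℝ) *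
          (decayWt ρ.im + decayWt (ρ.im - t))))) := by
        refine mul_le_mul_of_nonneg_left (h6.trans ?_) hm
        gcongr
    _ = 384 * ((1 + |t|) * (1 + |t|) ^ (-(3 / 4) : ℝ)) * ((zetaZeroMult ρ : ℝ) * decayWt ρ.im +
          (zetaZeroMult ρ : ℝ) * decayWt (ρ.im - t)) := by ring
    _ = _ := by rw [h8]

lemma tsum_zeros_indicator {A : Finset ℂ} (hA : ∀ z ∈ A, z ∈ nontrivialZetaZeros) (f : ℂ → ℂ)
    [DecidablePred (· ∈ A)] :
    HasSum (fun ρ : nontrivialZetaZeros => if (ρ : ℂ) ∈ A then f ρ else 0) (∑ z ∈ A, f z) := by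
  have h1 : HasSum (fun z => if z ∈ A then f z else 0) (∑ z ∈ A, f z) := by
    have : HasSum (fun z => if z ∈ A then f z else 0) (∑ z ∈ A, if z ∈ A then f z else 0) :=
      hasSum_sum_of_ne_finset_zero fun z hz => if_neg hz
    rwa [Finset.sum_congr rfl fun z hz => if_pos hz] at this
  exact (hasSum_subtype_iff_of_support_subset (f := fun z => if z ∈ A then f z else 0)
    (fun z hz => by
      by_contra h
      exact hz (if_neg fun h' => h (hA z h')))).2 h1

/-- The regular part `-ζ'/ζ(s) - 1/(s-1) + ∑ (1/(s-ρ) + 1/ρ)`, by its formula. -/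
noncomputable def regFormula (z : ℂ) : ℂ :=
  -logDeriv zetaPole z + ∑' ρ : nontrivialZetaZeros, zeroFrac ρ z

/-- The regular part of `-ζ'/ζ`, extended over the removable singularities. -/
noncomputable def regPart (z : ℂ) : ℂ := limUnder (𝓝[≠] z) regFormula

/-- The polar terms of Landau's lemma cancel the near zeros of the series. What is left is Landau's
remainder, finitely many constants `m / ρ`, and a normally convergent sum over far zeros. The
exponent is `3/8 = 1/4 + 1/8`, the `1/8` absorbing a logarithm. -/
theorem exists_local_regPart (hRH : RiemannHypothesis) : ∃ C : ℝ, 0 < C ∧ ∀ t : ℝ,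
    ∃ h : ℂ → ℂ, DifferentiableOn ℂ h (ball (2 + t * I) 2) ∧
      (∀ z ∈ ball (2 + t * I : ℂ) 2, zetaPole z ≠ 0 →
        Summable (fun ρ : nontrivialZetaZeros => zeroFrac ρ z) ∧ regFormula z = h z) ∧
      ∀ z ∈ ball (2 + t * I : ℂ) 2, ‖h z‖ ≤ C * (1 + |t|) ^ (3 / 8 : ℝ) := by
  classical
  obtain ⟨A, hA, hH⟩ := exists_logDeriv_zetaPole_eq hRH
  obtain ⟨B, hB, hD⟩ := exists_sum_decayWt_le hRH
  obtain ⟨D, hD0, hN⟩ := exists_sum_nearZeros_le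
  refine ⟨16 * (A + 3 * D + 768 * B), by positivity, fun t => ?_⟩
  obtain ⟨H, hH1, hH2, hH3⟩ := hH t
  set K := 384 * (1 + |t|) ^ (1 / 4 : ℝ) with hK
  set u : nontrivialZetaZeros → ℝ := fun ρ =>
    K * ((zetaZeroMult ρ : ℝ) * decayWt (ρ : ℂ).im +
      (zetaZeroMult ρ : ℝ) * decayWt ((ρ : ℂ).im - t)) with hu
  have hd0 := hD 0
  simp only [sub_zero] at hd0
  have hus : Summable u := (hd0.1.add (hD t).1).mul_left K
  have hut : ∑' ρ, u ρ ≤ K * (2 * B * logWt t) := by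
    rw [tsum_mul_left, Summable.tsum_add hd0.1 (hD t).1]
    have h1 := hd0.2
    have h2 := (hD t).2
    have h3 := mul_le_mul_of_nonneg_left (logWt_zero_le t) hB.le
    have : 0 ≤ K := by positivity
    exact mul_le_mul_of_nonneg_left (by linarith) this
  set far : nontrivialZetaZeros → ℂ → ℂ := fun ρ z =>
    if (ρ : ℂ) ∈ nearZeros t then 0 else zeroFrac ρ z with hfar
  have hfu : ∀ ρ : nontrivialZetaZeros, ∀ z ∈ ball (2 + t * I : ℂ) 2, ‖far ρ z‖ ≤ u ρ := by
    intro ρ z hz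
    simp only [hfar]
    split_ifs with h
    · rw [norm_zero]
      have h1 := decayWt_pos (ρ : ℂ).im
      have h2 := decayWt_pos ((ρ : ℂ).im - t)
      positivity
    · exact norm_zeroFrac_le hRH (ball_subset_closedBall hz) ρ.2 h
  have hfd : ∀ ρ : nontrivialZetaZeros, DifferentiableOn ℂ (far ρ) (ball (2 + t * I : ℂ) 2) := by
    intro ρ
    by_cases h : (ρ : ℂ) ∈ nearZeros t
    · simp only [hfar, if_pos h]
      exact differentiableOn_const _
    · simp only [hfar, if_neg h, zeroFrac]
      intro z hz
      have : z - ρ ≠ 0 := by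
        intro h0
        rw [sub_eq_zero] at h0
        refine h (mem_nearZeros.2 ⟨ρ.2, ?_⟩)
        rw [← h0, ← dist_eq_norm]
        exact (mem_ball.1 hz).le.trans (by norm_num)
      refine DifferentiableAt.differentiableWithinAt ?_
      fun_prop (disch := assumption)
  have hnear : ∀ z ∈ nearZeros t, z ∈ nontrivialZetaZeros := fun z hz => (mem_nearZeros.1 hz).1
  have hsub : ball (2 + t * I : ℂ) 2 ⊆ ball (2 + t * I : ℂ) (11 / 5) :=
    ball_subset_ball (by norm_num)
  refine ⟨fun z => -H z + ∑ ρ ∈ nearZeros t, (zetaZeroMult ρ : ℂ) * (1 / ρ) + ∑' ρ, far ρ z,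
    ?_, ?_, ?_⟩
  · refine ((hH1.differentiableOn.mono hsub).neg.add (differentiableOn_const _)).add ?_
    exact differentiableOn_tsum_of_summable_norm hus hfd isOpen_ball hfu
  · intro z hz hz0
    have h1 := tsum_zeros_indicator hnear (fun ρ => zeroFrac ρ z)
    have h2 : HasSum (fun ρ => far ρ z) (∑' ρ, far ρ z) :=
      (Summable.of_norm_bounded hus fun ρ => hfu ρ z hz).hasSum
    have h3 : HasSum (fun ρ : nontrivialZetaZeros => zeroFrac ρ z)
        (∑ ρ ∈ nearZeros t, zeroFrac ρ z + ∑' ρ, far ρ z) := by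
      refine (h1.add h2).congr_fun ?_
      intro ρ
      simp only [hfar]
      split_ifs <;> simp
    refine ⟨h3.summable, ?_⟩
    rw [regFormula, h3.tsum_eq, hH2 z (hsub hz) hz0]
    simp only [zeroFrac, mul_add, Finset.sum_add_distrib, mul_one_div]
    ring
  · intro z hz
    have h1 := hH3 z (ball_subset_closedBall hz)
    have h2 : ‖∑ ρ ∈ nearZeros t, (zetaZeroMult ρ : ℂ) * (1 / ρ)‖ ≤ 3 * D * logWt t := by
      calc _ ≤ ∑ ρ ∈ nearZeros t, (zetaZeroMult ρ : ℝ) * 3 := by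
            refine norm_sum_le_of_le _ fun ρ hρ => ?_
            rw [norm_mul, Complex.norm_natCast, norm_div, norm_one]
            refine mul_le_mul_of_nonneg_left ?_ (Nat.cast_nonneg _)
            have := one_add_abs_im_le hRH (hnear ρ hρ)
            have h0 := abs_nonneg ρ.im
            rw [div_le_iff₀ (by linarith)]
            linarith
        _ ≤ _ := by rw [← Finset.sum_mul]; linarith [hN t]
    have h3 : ‖∑' ρ, far ρ z‖ ≤ K * (2 * B * logWt t) :=
      (tsum_of_norm_bounded hus.hasSum fun ρ => hfu ρ z hz).trans hut
    have ht := abs_nonneg t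
    have h4 : logWt t ≤ 16 * (1 + |t|) ^ (1 / 8 : ℝ) := by
      refine (logWt_le_rpow (ε := 1 / 8) (by norm_num)).trans ?_
      have : (|t| + 2) ^ (1 / 8 : ℝ) ≤ 2 * (1 + |t|) ^ (1 / 8 : ℝ) := by
        calc (|t| + 2) ^ (1 / 8 : ℝ) ≤ (2 * (1 + |t|)) ^ (1 / 8 : ℝ) :=
              Real.rpow_le_rpow (by positivity) (by linarith) (by norm_num)
          _ = 2 ^ (1 / 8 : ℝ) * (1 + |t|) ^ (1 / 8 : ℝ) :=
              Real.mul_rpow (by norm_num) (by positivity)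
          _ ≤ 2 ^ (1 : ℝ) * (1 + |t|) ^ (1 / 8 : ℝ) := by
              gcongr
              · norm_num
              · norm_num
          _ = _ := by simp
      rw [div_le_iff₀ (by norm_num)]
      linarith
    have h5 : (1 + |t|) ^ (1 / 4 : ℝ) * (1 + |t|) ^ (1 / 8 : ℝ) = (1 + |t|) ^ (3 / 8 : ℝ) := by
      rw [← Real.rpow_add (by positivity)]
      norm_num
    have h6 : 1 ≤ (1 + |t|) ^ (1 / 4 : ℝ) := Real.one_le_rpow (by linarith) (by norm_num)
    have h7 := logWt_pos t
    set P := (1 + |t|) ^ (1 / 4 : ℝ)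
    set Q := (1 + |t|) ^ (1 / 8 : ℝ)
    have hQ : 0 < Q := by positivity
    rw [← h5]
    calc _ ≤ ‖-H z‖ + ‖∑ ρ ∈ nearZeros t, (zetaZeroMult ρ : ℂ) * (1 / ρ)‖ + ‖∑' ρ, far ρ z‖ :=
          norm_add₃_le
      _ ≤ A * logWt t + 3 * D * logWt t + K * (2 * B * logWt t) := by
          rw [norm_neg]; gcongr
      _ = (A + 3 * D) * 1 * logWt t + 768 * B * P * logWt t := by rw [hK]; ring
      _ ≤ (A + 3 * D) * P * logWt t + 768 * B * P * logWt t := by gcongr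
      _ = (A + 3 * D + 768 * B) * P * logWt t := by ring
      _ ≤ (A + 3 * D + 768 * B) * P * (16 * Q) := by gcongr
      _ = _ := by ring

lemma mem_ball_two_add {z : ℂ} (h1 : 0 < z.re) (h2 : z.re < 4) :
    z ∈ ball (2 + (z.im : ℂ) * I) 2 := by
  rw [mem_ball, dist_eq_norm]
  have : z - (2 + (z.im : ℂ) * I) = ((z.re - 2 : ℝ) : ℂ) := by
    apply Complex.ext <;> simp
  rw [this, Complex.norm_real, Real.norm_eq_abs, abs_lt]
  constructor <;> linarith

lemma eventually_zetaPole_ne_zero {z : ℂ} (hz : -1 < z.re) : ∀ᶠ w in 𝓝[≠] z, zetaPole w ≠ 0 := by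
  rcases (analyticOnNhd_zetaPole z hz).eventually_eq_zero_or_eventually_ne_zero with h | h
  · exfalso
    have hc : IsPreconnected {s : ℂ | -1 < s.re} := (convex_halfSpace_re_gt (-1)).isPreconnected
    have := analyticOnNhd_zetaPole.eqOn_zero_of_preconnected_of_eventuallyEq_zero hc hz h
    have h1 : zetaPole 1 = 0 := this (by simp)
    rw [zetaPole_one] at h1
    exact one_ne_zero h1
  · exact h

/-- The balls of radius `2` about `2 + i t` cover the strip. Zeros of `zetaPole` are isolated, so
the punctured limit defining `regPart` agrees with every local holomorphic extension. -/
theorem exists_regPart_bound (hRH : RiemannHypothesis) : ∃ C : ℝ, 0 < C ∧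
    (∀ z : ℂ, 0 < z.re → z.re < 4 → DifferentiableAt ℂ regPart z) ∧
    (∀ z : ℂ, 0 < z.re → z.re < 4 → zetaPole z ≠ 0 →
      Summable (fun ρ : nontrivialZetaZeros => zeroFrac ρ z) ∧ regPart z = regFormula z) ∧
    ∀ z : ℂ, 0 < z.re → z.re < 4 → ‖regPart z‖ ≤ C * (1 + |z.im|) ^ (3 / 8 : ℝ) := by
  obtain ⟨C, hC, hloc⟩ := exists_local_regPart hRH
  have key : ∀ t : ℝ, ∃ h : ℂ → ℂ, DifferentiableOn ℂ h (ball (2 + t * I) 2) ∧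
      (∀ z ∈ ball (2 + t * I : ℂ) 2, zetaPole z ≠ 0 →
        Summable (fun ρ : nontrivialZetaZeros => zeroFrac ρ z) ∧ regFormula z = h z) ∧
      (∀ z ∈ ball (2 + t * I : ℂ) 2, ‖h z‖ ≤ C * (1 + |t|) ^ (3 / 8 : ℝ)) ∧
      EqOn regPart h (ball (2 + t * I) 2) := by
    intro t
    obtain ⟨h, h1, h2, h3⟩ := hloc t
    refine ⟨h, h1, h2, h3, fun z hz => ?_⟩
    have hre : -1 < z.re := by
      have := (Complex.abs_re_le_norm (z - (2 + t * I))).trans_lt (mem_ball_iff_norm.1 hz)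
      have := (abs_lt.1 this).1
      simp at this
      linarith
    have hc : Tendsto h (𝓝[≠] z) (𝓝 (h z)) :=
      ((h1.differentiableAt (isOpen_ball.mem_nhds hz)).continuousAt).tendsto.mono_left
        nhdsWithin_le_nhds
    refine (hc.congr' ?_).limUnder_eq
    filter_upwards [eventually_zetaPole_ne_zero hre,
      nhdsWithin_le_nhds (isOpen_ball.mem_nhds hz)] with w hw hw'
    exact (h2 w hw' hw).2.symm
  refine ⟨C, hC, fun z hz hz' => ?_, fun z hz hz' hz0 => ?_, fun z hz hz' => ?_⟩ <;>
    obtain ⟨h, h1, h2, h3, h4⟩ := key z.im <;> have hm := mem_ball_two_add hz hz'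
  · exact (h1.differentiableAt (isOpen_ball.mem_nhds hm)).congr_of_eventuallyEq
      (h4.eventuallyEq_of_mem (isOpen_ball.mem_nhds hm))
  · exact ⟨(h2 z hm hz0).1, (h4 hm).trans (h2 z hm hz0).2.symm⟩
  · rw [h4 hm]
    exact h3 z hm

end GoldbachAverage

/-! ### Mellin transforms of the terms of the explicit formula. -/

namespace GoldbachAverage

open Complex Set Filter Topology Metric MeasureTheory

lemma countable_nontrivialZetaZeros : nontrivialZetaZeros.Countable := by
  have : nontrivialZetaZeros = ⋃ n : ℕ, nontrivialZetaZeros ∩ closedBall 0 n := by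
    ext z
    simp only [mem_iUnion, mem_inter_iff, exists_and_left, mem_closedBall, dist_zero_right]
    exact ⟨fun h => ⟨h, exists_nat_ge _⟩, fun h => h.1⟩
  rw [this]
  exact countable_iUnion fun n => (finite_zeros_inter_closedBall 0 n).countable

instance : Countable nontrivialZetaZeros := countable_nontrivialZetaZeros.to_subtype

/-- The coefficient `m / (ρ (ρ + 1))` of a zero of multiplicity `m`. -/
noncomputable def zeroCoef (ρ : ℂ) : ℂ := (zetaZeroMult ρ : ℂ) / (ρ * (ρ + 1))

lemma one_add_abs_im_le' (hRH : RiemannHypothesis) {ρ : ℂ} (h : ρ ∈ nontrivialZetaZeros) :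
    1 + |ρ.im| ≤ 3 * ‖ρ + 1‖ := by
  have h1 := Complex.abs_re_le_norm (ρ + 1)
  have h2 := Complex.abs_im_le_norm (ρ + 1)
  simp only [add_re, add_im, one_re, one_im, add_zero, re_eq_half_of_mem hRH h] at h1 h2
  rw [abs_of_pos (by norm_num)] at h1
  linarith

lemma inv_sq_le_decayWt (x : ℝ) : ((1 + |x|) ^ 2)⁻¹ ≤ decayWt x := by
  have hx := abs_nonneg x
  rw [decayWt, Real.rpow_neg (by positivity)]
  refine inv_anti₀ (by positivity) ?_
  calc (1 + |x|) ^ (5 / 4 : ℝ) ≤ (1 + |x|) ^ (2 : ℝ) :=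
        Real.rpow_le_rpow_of_exponent_le (by linarith) (by norm_num)
    _ = _ := Real.rpow_two _

lemma norm_zeroCoef_le (hRH : RiemannHypothesis) {ρ : ℂ} (h : ρ ∈ nontrivialZetaZeros) :
    ‖zeroCoef ρ‖ ≤ 9 * ((zetaZeroMult ρ : ℝ) * decayWt ρ.im) := by
  have h1 := one_add_abs_im_le hRH h
  have h2 := one_add_abs_im_le' hRH h
  have h3 := inv_sq_le_decayWt ρ.im
  have hx := abs_nonneg ρ.im
  have hp : 0 < ‖ρ‖ := by linarith
  have hp' : 0 < ‖ρ + 1‖ := by linarith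
  rw [zeroCoef, norm_div, norm_mul, Complex.norm_natCast]
  have h4 : (‖ρ‖ * ‖ρ + 1‖)⁻¹ ≤ 9 * ((1 + |ρ.im|) ^ 2)⁻¹ := by
    rw [inv_le_comm₀ (by positivity) (by positivity), mul_inv, inv_inv]
    have : (1 + |ρ.im|) * (1 + |ρ.im|) ≤ (3 * ‖ρ‖) * (3 * ‖ρ + 1‖) := by gcongr
    linarith
  rw [div_eq_mul_inv]
  have hm : (0 : ℝ) ≤ zetaZeroMult ρ := Nat.cast_nonneg _
  calc _ ≤ (zetaZeroMult ρ : ℝ) * (9 * decayWt ρ.im) :=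
        mul_le_mul_of_nonneg_left (h4.trans (by linarith)) hm
    _ = _ := by ring

lemma summable_mult_mul_decayWt (hRH : RiemannHypothesis) :
    Summable fun ρ : nontrivialZetaZeros => (zetaZeroMult ρ : ℝ) * decayWt (ρ : ℂ).im := by
  obtain ⟨A, -, h⟩ := exists_sum_decayWt_le hRH
  simpa using (h 0).1

lemma summable_norm_zeroCoef (hRH : RiemannHypothesis) :
    Summable fun ρ : nontrivialZetaZeros => ‖zeroCoef ρ‖ :=
  Summable.of_nonneg_of_le (fun _ => norm_nonneg _) (fun ρ => norm_zeroCoef_le hRH ρ.2)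
    ((summable_mult_mul_decayWt hRH).mul_left 9)

/-- `∑ Λ(n) (x - n)₊`. -/
noncomputable def smoothPsi (x : ℝ) : ℝ :=
  ∑' n : ℕ, ArithmeticFunction.vonMangoldt n * max (x - n) 0

lemma smoothPsi_eq_sum {x : ℝ} {M : ℕ} (h : x ≤ M) : smoothPsi x =
    ∑ n ∈ Finset.range M, ArithmeticFunction.vonMangoldt n * max (x - n) 0 := by
  refine tsum_eq_sum fun n hn => ?_
  rw [Finset.mem_range, not_lt] at hn
  have : (M : ℝ) ≤ n := by exact_mod_cast hn
  rw [max_eq_right (by linarith), mul_zero]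

lemma continuous_smoothPsi : Continuous smoothPsi := by
  refine continuous_iff_continuousAt.2 fun x => ?_
  obtain ⟨M, hM⟩ := exists_nat_gt x
  have : smoothPsi =ᶠ[𝓝 x] fun y =>
      ∑ n ∈ Finset.range M, ArithmeticFunction.vonMangoldt n * max (y - n) 0 := by
    filter_upwards [Iio_mem_nhds hM] with y hy
    exact smoothPsi_eq_sum (le_of_lt hy)
  rw [continuousAt_congr this]
  fun_prop

/-- The primitive `(x ^ (ρ + 1) - 1) / (ρ (ρ + 1))`, with multiplicity, frozen for `x ≤ 1`. -/
noncomputable def zeroPrim (ρ : ℂ) (x : ℝ) : ℂ :=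
  zeroCoef ρ * (((max x 1 : ℝ) : ℂ) ^ (ρ + 1) - 1)

/-- The error term in the explicit formula for `smoothPsi`. -/
noncomputable def smoothErr (x : ℝ) : ℂ :=
  smoothPsi x - (((max x 1 - 1) ^ 2 / 2 : ℝ) : ℂ) + ∑' ρ : nontrivialZetaZeros, zeroPrim ρ x

lemma continuous_zeroPrim (ρ : ℂ) : Continuous (zeroPrim ρ) := by
  have : Continuous fun x : ℝ => ((max x 1 : ℝ) : ℂ) ^ (ρ + 1) := by
    refine Continuous.cpow (by fun_prop) continuous_const fun x => ?_
    refine Or.inl ?_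
    rw [ofReal_re]
    positivity
  unfold zeroPrim
  fun_prop

lemma norm_zeroPrim_le (hRH : RiemannHypothesis) {ρ : ℂ} (h : ρ ∈ nontrivialZetaZeros) (x : ℝ) :
    ‖zeroPrim ρ x‖ ≤ ‖zeroCoef ρ‖ * (2 * (max x 1) ^ (3 / 2 : ℝ)) := by
  have h1 : 1 ≤ max x 1 := le_max_right _ _
  rw [zeroPrim, norm_mul]
  refine mul_le_mul_of_nonneg_left ?_ (norm_nonneg _)
  refine (norm_sub_le _ _).trans ?_
  rw [norm_cpow_eq_rpow_re_of_pos (by linarith), add_re, re_eq_half_of_mem hRH h, one_re, norm_one]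
  have := Real.one_le_rpow h1 (by norm_num : (0 : ℝ) ≤ 3 / 2)
  norm_num at this ⊢
  linarith

lemma continuous_tsum_zeroPrim (hRH : RiemannHypothesis) :
    Continuous fun x => ∑' ρ : nontrivialZetaZeros, zeroPrim ρ x := by
  refine continuous_iff_continuousAt.2 fun x => ?_
  have hc : ContinuousOn (fun x => ∑' ρ : nontrivialZetaZeros, zeroPrim ρ x) (Iio (x + 1)) := by
    refine continuousOn_tsum (u := fun ρ : nontrivialZetaZeros =>
        ‖zeroCoef ρ‖ * (2 * (max (x + 1) 1) ^ (3 / 2 : ℝ)))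
      (fun ρ => (continuous_zeroPrim ρ).continuousOn)
      ((summable_norm_zeroCoef hRH).mul_right _) fun ρ y hy => ?_
    refine (norm_zeroPrim_le hRH ρ.2 y).trans ?_
    have : max y 1 ≤ max (x + 1) 1 := max_le_max_right _ (le_of_lt hy)
    gcongr
  exact hc.continuousAt (Iio_mem_nhds (by linarith))

lemma continuous_smoothErr (hRH : RiemannHypothesis) : Continuous smoothErr := by
  have h1 := continuous_tsum_zeroPrim hRH
  have h2 := continuous_smoothPsi
  unfold smoothErr
  fun_prop

/-- Exchange of sum and integral under a summable bound for the `L¹` norms; continuity of the sum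
supplies measurability. -/
lemma hasMellin_tsum {ι : Type*} [Countable ι] {f : ι → ℝ → ℂ} {w : ℂ} {B : ι → ℝ}
    (hf : ∀ i, MellinConvergent (f i) w)
    (hB : ∀ i, ∫ t : ℝ in Ioi 0, ‖(t : ℂ) ^ (w - 1) • f i t‖ ≤ B i) (hBs : Summable B)
    (hm : Continuous fun t => ∑' i, f i t) :
    HasMellin (fun t => ∑' i, f i t) w (∑' i, mellin (f i) w) := by
  have hs : Summable fun i => ∫ t : ℝ in Ioi 0, ‖(t : ℂ) ^ (w - 1) • f i t‖ :=
    Summable.of_nonneg_of_le (fun i => integral_nonneg fun t => norm_nonneg _) hB hBs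
  have h1 := integral_tsum_of_summable_integral_norm hf hs
  have e : ∀ t : ℝ, ∑' i, (t : ℂ) ^ (w - 1) • f i t = (t : ℂ) ^ (w - 1) • ∑' i, f i t := fun t => by
    simp only [smul_eq_mul, tsum_mul_left]
  constructor
  · refine ⟨?_, ?_⟩
    · refine ContinuousOn.aestronglyMeasurable (fun t ht => ?_) measurableSet_Ioi
      have hp : ContinuousWithinAt (fun t : ℝ => (t : ℂ) ^ (w - 1)) (Ioi 0) t :=
        (continuousAt_ofReal_cpow_const _ _ (Or.inr (ne_of_gt ht))).continuousWithinAt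
      exact hp.mul hm.continuousWithinAt
    · rw [hasFiniteIntegral_iff_enorm]
      have h2 : ∀ t : ℝ, ‖(t : ℂ) ^ (w - 1) • ∑' i, f i t‖ₑ ≤
          ∑' i, ‖(t : ℂ) ^ (w - 1) • f i t‖ₑ := fun t => by
        rw [← e]
        exact enorm_tsum_le_tsum_enorm
      refine (lintegral_mono h2).trans_lt ?_
      rw [lintegral_tsum fun i => (hf i).1.enorm]
      have h3 : ∀ i, ∫⁻ t : ℝ in Ioi 0, ‖(t : ℂ) ^ (w - 1) • f i t‖ₑ =
          ENNReal.ofReal (∫ t : ℝ in Ioi 0, ‖(t : ℂ) ^ (w - 1) • f i t‖) := fun i =>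
        (ofReal_integral_norm_eq_lintegral_enorm (hf i)).symm
      simp only [h3]
      rw [← ENNReal.ofReal_tsum_of_nonneg (fun i => integral_nonneg fun t => norm_nonneg _) hs]
      exact ENNReal.ofReal_lt_top
  · rw [mellin, ← integral_congr_ae (Eventually.of_forall e), ← h1]
    rfl

lemma hasMellin_of_eqOn {f F : ℝ → ℂ} {w : ℂ} {c : ℝ} (hc : 0 ≤ c)
    (h0 : ∀ x, 0 < x → x ≤ c → f x = 0) (h1 : ∀ x : ℝ, c < x → (x : ℂ) ^ (w - 1) * f x = F x)
    (hF : IntegrableOn F (Ioi c)) :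
    HasMellin f w (∫ x in Ioi c, F x) ∧
      ∫ t : ℝ in Ioi 0, ‖(t : ℂ) ^ (w - 1) • f t‖ = ∫ x in Ioi c, ‖F x‖ := by
  have hsub : Ioi c ⊆ Ioi (0 : ℝ) := Ioi_subset_Ioi hc
  have hz : ∀ x ∈ Ioi (0 : ℝ) \ Ioi c, (x : ℂ) ^ (w - 1) • f x = 0 := fun x hx => by
    rw [h0 x hx.1 (not_lt.1 hx.2), smul_zero]
  have hi : IntegrableOn (fun x : ℝ => (x : ℂ) ^ (w - 1) • f x) (Ioi c) :=
    hF.congr_fun (fun x hx => (h1 x hx).symm) measurableSet_Ioi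
  refine ⟨⟨?_, ?_⟩, ?_⟩
  · exact hi.of_forall_sdiff_eq_zero measurableSet_Ioi hz
  · rw [mellin, setIntegral_eq_of_subset_of_forall_sdiff_eq_zero measurableSet_Ioi hsub hz]
    exact setIntegral_congr_fun measurableSet_Ioi fun x hx => h1 x hx
  · rw [setIntegral_eq_of_subset_of_forall_sdiff_eq_zero measurableSet_Ioi hsub
      fun x hx => by rw [hz x hx, norm_zero]]
    exact setIntegral_congr_fun measurableSet_Ioi fun x hx => by
      simp only [smul_eq_mul, h1 x hx]

/-- The Mellin transform of `x ↦ (x - c)₊`. -/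
lemma hasMellin_posPart {w : ℂ} {c : ℝ} (hc : 0 < c) (hw : w.re < -1) :
    HasMellin (fun x : ℝ => ((max (x - c) 0 : ℝ) : ℂ)) w ((c : ℂ) ^ (w + 1) / (w * (w + 1))) ∧
      ∫ t : ℝ in Ioi 0, ‖(t : ℂ) ^ (w - 1) • ((max (t - c) 0 : ℝ) : ℂ)‖ ≤
        c ^ (w.re + 1) / (-(w.re + 1)) := by
  have hw1 : w + 1 ≠ 0 := fun h => by
    have := congrArg re h
    simp at this
    linarith
  have hw0 : w ≠ 0 := fun h => by
    have := congrArg re h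
    simp at this
    linarith
  have hi1 := integrableOn_Ioi_cpow_of_lt (a := w) hw hc
  have hi2 := integrableOn_Ioi_cpow_of_lt (a := w - 1) (by simp; linarith) hc
  have hF : IntegrableOn (fun x : ℝ => (x : ℂ) ^ w - c * (x : ℂ) ^ (w - 1)) (Ioi c) :=
    hi1.sub (hi2.const_mul _)
  have h1 : ∀ x : ℝ, c < x → (x : ℂ) ^ (w - 1) * ((max (x - c) 0 : ℝ) : ℂ) =
      (x : ℂ) ^ w - c * (x : ℂ) ^ (w - 1) := fun x hx => by
    have hx0 : (x : ℂ) ≠ 0 := ofReal_ne_zero.2 (by linarith)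
    rw [max_eq_left (by linarith), cpow_sub _ _ hx0, cpow_one]
    push_cast
    field_simp
  obtain ⟨h2, h3⟩ := hasMellin_of_eqOn (f := fun x : ℝ => ((max (x - c) 0 : ℝ) : ℂ)) hc.le
    (fun x _ hx => by simp [hx]) h1 hF
  constructor
  · convert h2 using 1
    rw [integral_sub hi1 (hi2.const_mul _), integral_const_mul, integral_Ioi_cpow_of_lt hw hc,
      integral_Ioi_cpow_of_lt (by simp; linarith) hc, sub_add_cancel]
    rw [cpow_add _ _ (ofReal_ne_zero.2 hc.ne'), cpow_one]
    field_simp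
    ring
  · rw [h3]
    have hb : IntegrableOn (fun x : ℝ => x ^ w.re) (Ioi c) := integrableOn_Ioi_rpow_of_lt hw hc
    calc _ ≤ ∫ x in Ioi c, x ^ w.re := by
          refine setIntegral_mono_on hF.norm hb measurableSet_Ioi fun x hx => ?_
          have hx' : c < x := hx
          have hx0 : 0 < x := hc.trans hx'
          rw [← h1 x hx, norm_mul, norm_cpow_eq_rpow_re_of_pos hx0, Complex.norm_real,
            max_eq_left (by linarith), Real.norm_of_nonneg (by linarith), sub_re, one_re,
            Real.rpow_sub_one hx0.ne', div_mul_eq_mul_div, div_le_iff₀ hx0]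
          gcongr
          linarith
      _ = _ := by
          rw [integral_Ioi_rpow_of_lt hw hc, div_neg, neg_div]

/-- With `w = -s - 1` the value is `1 / ((s - 1) s (s + 1))`, the polar part of `-ζ'/ζ` at `s = 1`
over `s (s + 1)`. -/
lemma hasMellin_pole {w : ℂ} (hw : w.re < -2) :
    HasMellin (fun x : ℝ => (((max x 1 - 1) ^ 2 / 2 : ℝ) : ℂ)) w
      (-(1 / (w * (w + 1) * (w + 2)))) := by
  have hne : ∀ a : ℝ, a ≤ 2 → w + a ≠ 0 := fun a ha h => by
    have := congrArg re h
    simp at this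
    linarith
  have hw0 : w ≠ 0 := by simpa using hne 0 (by norm_num)
  have hw1 : w + 1 ≠ 0 := by simpa using hne 1 (by norm_num)
  have hw2 : w + 2 ≠ 0 := by simpa using hne 2 (by norm_num)
  have hi0 := integrableOn_Ioi_cpow_of_lt (a := w + 1) (c := 1) (by simp; linarith) one_pos
  have hi1 := integrableOn_Ioi_cpow_of_lt (a := w) (c := 1) (by linarith) one_pos
  have hi2 := integrableOn_Ioi_cpow_of_lt (a := w - 1) (c := 1) (by simp; linarith) one_pos
  have hi01 : IntegrableOn (fun x : ℝ => (1 / 2) * (x : ℂ) ^ (w + 1) - (x : ℂ) ^ w) (Ioi 1) :=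
    (hi0.const_mul _).sub hi1
  have hF : IntegrableOn (fun x : ℝ => (1 / 2) * (x : ℂ) ^ (w + 1) - (x : ℂ) ^ w +
      (1 / 2) * (x : ℂ) ^ (w - 1)) (Ioi 1) :=
    hi01.add (hi2.const_mul _)
  obtain ⟨h2, -⟩ := hasMellin_of_eqOn (w := w)
    (f := fun x : ℝ => (((max x 1 - 1) ^ 2 / 2 : ℝ) : ℂ)) zero_le_one
    (fun x _ hx => by simp [hx]) (fun x hx => by
      have hx0 : (x : ℂ) ≠ 0 := ofReal_ne_zero.2 (by linarith)
      rw [max_eq_left (by linarith), cpow_sub _ _ hx0, cpow_add _ _ hx0, cpow_one]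
      push_cast
      field_simp
      ring) hF
  convert h2 using 1
  rw [integral_add hi01 (hi2.const_mul _),
    integral_sub (hi0.const_mul _) hi1, integral_const_mul, integral_const_mul,
    integral_Ioi_cpow_of_lt (by simp; linarith) one_pos,
    integral_Ioi_cpow_of_lt (by linarith) one_pos,
    integral_Ioi_cpow_of_lt (by simp; linarith) one_pos, sub_add_cancel]
  simp only [ofReal_one, one_cpow]
  rw [show w + 1 + 1 = w + 2 by ring]
  field_simp
  ring

/-- With `w = -s - 1` the value is `zeroFrac ρ s / (s (s + 1))`: subtracting `1` in `zeroPrim`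
produces exactly the convergence factor `1 / ρ`, and makes the function vanish for `x ≤ 1`. -/
lemma hasMellin_zeroPrim (hRH : RiemannHypothesis) {ρ w : ℂ} (hρ : ρ ∈ nontrivialZetaZeros)
    (hw : w.re < -2) :
    HasMellin (zeroPrim ρ) w (zeroCoef ρ * (1 / w - 1 / (w + ρ + 1))) ∧
      ∫ t : ℝ in Ioi 0, ‖(t : ℂ) ^ (w - 1) • zeroPrim ρ t‖ ≤
        ‖zeroCoef ρ‖ * (2 * (1 / (-(w.re + 3 / 2)))) := by
  have hre := re_eq_half_of_mem hRH hρ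
  have hw0 : w ≠ 0 := fun h => by
    have := congrArg re h
    simp at this
    linarith
  have hw1 : w + ρ + 1 ≠ 0 := fun h => by
    have := congrArg re h
    simp [hre] at this
    linarith
  have hi1 := integrableOn_Ioi_cpow_of_lt (a := w + ρ) (c := 1) (by simp [hre]; linarith) one_pos
  have hi2 := integrableOn_Ioi_cpow_of_lt (a := w - 1) (c := 1) (by simp; linarith) one_pos
  have hF : IntegrableOn (fun x : ℝ => zeroCoef ρ * ((x : ℂ) ^ (w + ρ) - (x : ℂ) ^ (w - 1)))
      (Ioi 1) := (hi1.sub hi2).const_mul _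
  have h1 : ∀ x : ℝ, 1 < x → (x : ℂ) ^ (w - 1) * zeroPrim ρ x =
      zeroCoef ρ * ((x : ℂ) ^ (w + ρ) - (x : ℂ) ^ (w - 1)) := fun x hx => by
    have hx0 : (x : ℂ) ≠ 0 := ofReal_ne_zero.2 (by linarith)
    rw [zeroPrim, max_eq_left (by linarith), show w + ρ = (w - 1) + (ρ + 1) by ring,
      cpow_add _ (ρ + 1) hx0]
    ring
  obtain ⟨h2, h3⟩ := hasMellin_of_eqOn (w := w) (f := zeroPrim ρ) zero_le_one
    (fun x _ hx => by simp [zeroPrim, hx]) h1 hF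
  constructor
  · convert h2 using 1
    rw [integral_const_mul, integral_sub hi1 hi2,
      integral_Ioi_cpow_of_lt (by simp [hre]; linarith) one_pos,
      integral_Ioi_cpow_of_lt (by simp; linarith) one_pos, sub_add_cancel]
    simp only [ofReal_one, one_cpow]
    field_simp
    ring
  · rw [h3]
    have hr : w.re - 1 + 3 / 2 < -1 := by linarith
    have hb : IntegrableOn (fun x : ℝ => ‖zeroCoef ρ‖ * (2 * x ^ (w.re - 1 + 3 / 2))) (Ioi 1) :=
      ((integrableOn_Ioi_rpow_of_lt hr one_pos).const_mul _).const_mul _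
    calc _ ≤ ∫ x in Ioi (1 : ℝ), ‖zeroCoef ρ‖ * (2 * x ^ (w.re - 1 + 3 / 2)) := by
          refine setIntegral_mono_on hF.norm hb measurableSet_Ioi fun x hx => ?_
          have hx' : 1 < x := hx
          have hx0 : 0 < x := by linarith
          rw [← h1 x hx, norm_mul, norm_cpow_eq_rpow_re_of_pos hx0, sub_re, one_re,
            Real.rpow_add hx0]
          have := norm_zeroPrim_le hRH hρ x
          rw [max_eq_left hx'.le] at this
          calc _ ≤ x ^ (w.re - 1) * (‖zeroCoef ρ‖ * (2 * x ^ (3 / 2 : ℝ))) := by gcongr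
            _ = _ := by ring
      _ = _ := by
          rw [integral_const_mul, integral_const_mul, integral_Ioi_rpow_of_lt hr one_pos,
            Real.one_rpow, div_neg, neg_div]
          congr 4
          ring

lemma hasMellin_smoothPsi {w : ℂ} (hw : w.re < -2) :
    HasMellin (fun x => (smoothPsi x : ℂ)) w
      (LSeries (fun n => (ArithmeticFunction.vonMangoldt n : ℂ)) (-w - 1) / (w * (w + 1))) := by
  set f : ℕ → ℝ → ℂ := fun n x =>
    (ArithmeticFunction.vonMangoldt n : ℂ) * ((max (x - n) 0 : ℝ) : ℂ) with hf
  have e : (fun x => (smoothPsi x : ℂ)) = fun x => ∑' n, f n x := by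
    funext x
    rw [smoothPsi, ofReal_tsum]
    simp [hf]
  have hΛ := ArithmeticFunction.LSeriesSummable_vonMangoldt (s := -w - 1) (by simp; linarith)
  have hterm : ∀ n : ℕ, HasMellin (f n) w
      (LSeries.term (fun n => (ArithmeticFunction.vonMangoldt n : ℂ)) (-w - 1) n /
        (w * (w + 1))) ∧ ∫ t : ℝ in Ioi 0, ‖(t : ℂ) ^ (w - 1) • f n t‖ ≤
      ‖LSeries.term (fun n => (ArithmeticFunction.vonMangoldt n : ℂ)) (-w - 1) n‖ *
        (1 / (-(w.re + 1))) := by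
    intro n
    rcases Nat.eq_zero_or_pos n with rfl | hn
    · have h0 : f 0 = fun _ => 0 := by funext x; simp [hf]
      rw [h0]
      simp [HasMellin, MellinConvergent, mellin]
    · have hn' : (0 : ℝ) < n := by exact_mod_cast hn
      obtain ⟨h1, h2⟩ := hasMellin_posPart (w := w) hn' (by linarith)
      have h3 : LSeries.term (fun n => (ArithmeticFunction.vonMangoldt n : ℂ)) (-w - 1) n =
          (ArithmeticFunction.vonMangoldt n : ℂ) * ((n : ℝ) : ℂ) ^ (w + 1) := by
        rw [LSeries.term_of_ne_zero hn.ne', show -w - 1 = -(w + 1) by ring, cpow_neg, div_inv_eq_mul]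
        simp
      rw [h3]
      constructor
      · have := hasMellin_const_smul h1.1 (ArithmeticFunction.vonMangoldt n : ℂ)
        rw [h1.2] at this
        simpa only [smul_eq_mul, mul_div_assoc] using this
      · have e2 : ∀ t : ℝ, ‖(t : ℂ) ^ (w - 1) • f n t‖ = ‖(ArithmeticFunction.vonMangoldt n : ℂ)‖ *
            ‖(t : ℂ) ^ (w - 1) • ((max (t - n) 0 : ℝ) : ℂ)‖ := fun t => by
          simp only [hf, smul_eq_mul, norm_mul]
          ring
        simp only [e2]
        rw [integral_const_mul, norm_mul, norm_cpow_eq_rpow_re_of_pos hn', add_re, one_re,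
          mul_assoc, mul_one_div]
        exact mul_le_mul_of_nonneg_left h2 (norm_nonneg _)
  rw [e]
  have hc : Continuous fun x => ∑' n, f n x := by
    rw [← e]
    exact continuous_ofReal.comp continuous_smoothPsi
  have := hasMellin_tsum (fun n => (hterm n).1.1) (fun n => (hterm n).2)
    ((summable_norm_iff.2 hΛ).mul_right _) hc
  convert this using 1
  rw [LSeries, ← tsum_div_const]
  exact tsum_congr fun n => (hterm n).1.2.symm

/-- Since `w (w + 1) = s (s + 1)` for `s = -w - 1`, the three transforms add up to `-ζ'/ζ(s)`, minus
its pole at `1`, plus the partial fractions of the zeros, over a common denominator. -/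
theorem hasMellin_smoothErr (hRH : RiemannHypothesis) {w : ℂ} (hw : w.re < -2) :
    HasMellin smoothErr w (regFormula (-w - 1) / (w * (w + 1))) := by
  set s := -w - 1 with hs
  have hsre : 1 < s.re := by simp [hs]; linarith
  have hs0 : s ≠ 0 := fun h => by rw [h] at hsre; norm_num at hsre
  have hs1 : s - 1 ≠ 0 := fun h => by
    have := congrArg re h
    simp at this
    linarith
  have hsp : s + 1 ≠ 0 := fun h => by
    have := congrArg re h
    simp at this
    linarith
  have hws : w = -(s + 1) := by rw [hs]; ring
  have hζ : riemannZeta s ≠ 0 := riemannZeta_ne_zero_of_one_lt_re hsre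
  have h1 := hasMellin_smoothPsi hw
  have h2 := hasMellin_pole hw
  have h3 : HasMellin (fun x => ∑' ρ : nontrivialZetaZeros, zeroPrim ρ x) w
      (∑' ρ : nontrivialZetaZeros, mellin (zeroPrim ρ) w) :=
    hasMellin_tsum (fun ρ : nontrivialZetaZeros => (hasMellin_zeroPrim hRH ρ.2 hw).1.1)
      (fun ρ => (hasMellin_zeroPrim hRH ρ.2 hw).2)
      ((summable_norm_zeroCoef hRH).mul_right _) (continuous_tsum_zeroPrim hRH)
  have h4 := hasMellin_add (hasMellin_sub h1.1 h2.1).1 h3.1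
  have hlog : logDeriv zetaPole s = 1 / (s - 1) + deriv riemannZeta s / riemannZeta s := by
    have hsne : s ≠ 1 := sub_ne_zero.1 hs1
    have e : zetaPole =ᶠ[𝓝 s] fun z => (z - 1) * riemannZeta z := by
      filter_upwards [isOpen_ne.mem_nhds hsne, (isOpen_re_gt (-1)).mem_nhds
        (show -1 < s.re by linarith)] with z hz hz'
      exact zetaPole_eq hz' hz
    rw [logDeriv_apply, e.deriv_eq, e.self_of_nhds]
    rw [← logDeriv_apply (fun z => (z - 1) * riemannZeta z), 
      logDeriv_mul (f := fun z => z - 1) (g := riemannZeta) s hs1 hζ (by fun_prop)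
      (differentiableAt_riemannZeta hsne), logDeriv_apply, logDeriv_apply]
    simp
  have hz : ∀ ρ : nontrivialZetaZeros, mellin (zeroPrim ρ) w = zeroFrac ρ s / (w * (w + 1)) := by
    intro ρ
    rw [(hasMellin_zeroPrim hRH ρ.2 hw).1.2, zeroCoef, zeroFrac]
    have hρ0 := ne_zero_of_mem ρ.2
    have hρ1 := add_one_ne_zero_of_mem ρ.2
    have hsρ : s - ρ ≠ 0 := fun h => by
      have := congrArg re h
      have h5 := ρ.2.2.2
      simp at this
      linarith
    rw [hws, show -(s + 1) + (ρ : ℂ) + 1 = -(s - ρ) by ring, show -(s + 1) + 1 = -s by ring]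
    field_simp
    ring
  convert h4 using 1
  · rfl
  · rw [(hasMellin_sub h1.1 h2.1).2, h1.2, h2.2, h3.2, tsum_congr hz, tsum_div_const, regFormula, hlog,
      ArithmeticFunction.LSeries_vonMangoldt_eq_deriv_riemannZeta_div hsre]
    rw [hws, show -(s + 1) + 1 = -s by ring, show -(s + 1) + 2 = -(s - 1) by ring]
    field_simp
    ring

end GoldbachAverage

/-! ### Mellin inversion and the shift of the line of integration. -/

namespace GoldbachAverage

open Complex Set Filter Topology Metric MeasureTheory

/-- Shifting a vertical line of integration. -/
theorem integral_vertical_eq {f : ℂ → ℂ} {a b : ℝ} (hab : a ≤ b)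
    (hd : ∀ z : ℂ, a ≤ z.re → z.re ≤ b → DifferentiableAt ℂ f z)
    (ha : Integrable fun y : ℝ => f (a + y * I)) (hb : Integrable fun y : ℝ => f (b + y * I))
    {B : ℝ → ℝ} (hB : Tendsto B atTop (𝓝 0))
    (hf : ∀ x : ℝ, a ≤ x → x ≤ b → ∀ y : ℝ, ‖f (x + y * I)‖ ≤ B |y|) :
    ∫ y : ℝ, f (a + y * I) = ∫ y : ℝ, f (b + y * I) := by
  have h1 : ∀ T : ℝ, 0 < T → ‖(∫ y in (-T)..T, f (b + y * I)) - ∫ y in (-T)..T, f (a + y * I)‖ ≤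
      2 * (b - a) * B T := by
    intro T hT
    have key := integral_boundary_rect_eq_zero_of_differentiableOn f (a + ((-T : ℝ) : ℂ) * I)
      (b + ((T : ℝ) : ℂ) * I) (by
        intro z hz
        rw [mem_reProdIm] at hz
        simp only [add_re, ofReal_re, mul_re, I_re, mul_zero, ofReal_im, I_im, mul_one, sub_self,
          add_zero, uIcc_of_le hab] at hz
        exact (hd z hz.1.1 hz.1.2).differentiableWithinAt)
    simp only [add_re, ofReal_re, mul_re, I_re, mul_zero, ofReal_im, I_im, mul_one, sub_self,
      add_zero, add_im, mul_im, zero_add] at key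
    have hb1 : ‖∫ x in a..b, f (x + ((-T : ℝ) : ℂ) * I)‖ ≤ B T * |b - a| := by
      refine intervalIntegral.norm_integral_le_of_norm_le_const fun x hx => ?_
      rw [uIoc_of_le hab] at hx
      have := hf x hx.1.le hx.2 (-T)
      rwa [abs_neg, abs_of_pos hT] at this
    have hb2 : ‖∫ x in a..b, f (x + (T : ℂ) * I)‖ ≤ B T * |b - a| := by
      refine intervalIntegral.norm_integral_le_of_norm_le_const fun x hx => ?_
      rw [uIoc_of_le hab] at hx
      have := hf x hx.1.le hx.2 T
      rwa [abs_of_pos hT] at this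
    rw [abs_of_nonneg (by linarith)] at hb1 hb2
    set V := (∫ y in (-T)..T, f (b + y * I)) - ∫ y in (-T)..T, f (a + y * I) with hV
    have e : I * V = (∫ x in a..b, f (x + (T : ℂ) * I)) -
        ∫ x in a..b, f (x + ((-T : ℝ) : ℂ) * I) := by
      rw [hV, mul_sub]
      simp only [smul_eq_mul] at key
      linear_combination key
    have e2 : ‖V‖ = ‖I * V‖ := by rw [norm_mul, norm_I, one_mul]
    rw [e2, e]
    refine (norm_sub_le _ _).trans ?_
    linarith
  have h2 : Tendsto (fun T : ℝ => (∫ y in (-T)..T, f (b + y * I)) - ∫ y in (-T)..T, f (a + y * I))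
      atTop (𝓝 ((∫ y : ℝ, f (b + y * I)) - ∫ y : ℝ, f (a + y * I))) :=
    (intervalIntegral_tendsto_integral hb tendsto_neg_atTop_atBot tendsto_id).sub
      (intervalIntegral_tendsto_integral ha tendsto_neg_atTop_atBot tendsto_id)
  have h3 : Tendsto (fun T : ℝ => (∫ y in (-T)..T, f (b + y * I)) - ∫ y in (-T)..T, f (a + y * I))
      atTop (𝓝 0) := by
    refine squeeze_zero_norm' (a := fun T => 2 * (b - a) * B T) ?_ ?_
    · filter_upwards [eventually_gt_atTop 0] with T hT using h1 T hT
    · simpa using hB.const_mul (2 * (b - a))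
  exact (sub_eq_zero.1 (tendsto_nhds_unique h2 h3)).symm

/-- The Mellin kernel of `smoothErr`. -/
noncomputable def regKernel (s : ℂ) : ℂ := regPart s / (s * (s + 1))

lemma one_add_abs_im_le_of_re {δ : ℝ} (hδ1 : δ ≤ 1) {s : ℂ} (hs : δ ≤ s.re) :
    δ * (1 + |s.im|) ≤ 2 * ‖s‖ := by
  have h1 := (le_abs_self _).trans (Complex.abs_re_le_norm s)
  have h2 := Complex.abs_im_le_norm s
  nlinarith [abs_nonneg s.im]

/-- Dividing by `s (s + 1)` turns the exponent `3/8` into `-13/8 < -1`, hence absolute integrability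
on vertical lines. The factor `1 / δ` comes from `|s|` alone, which may be as small as `δ`. -/
theorem exists_regKernel_bound (hRH : RiemannHypothesis) : ∃ C : ℝ, 0 < C ∧
    ∀ δ : ℝ, 0 < δ → δ ≤ 1 → ∀ s : ℂ, δ ≤ s.re → s.re < 4 →
      ‖regPart s‖ ≤ C * (1 + |s.im|) ^ (3 / 8 : ℝ) ∧
      ‖regKernel s‖ ≤ C / δ * (1 + |s.im|) ^ (-(13 / 8) : ℝ) := by
  obtain ⟨C, hC, -, -, h⟩ := exists_regPart_bound hRH
  refine ⟨4 * C, by positivity, fun δ hδ hδ1 s hs hs' => ?_⟩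
  have h0 := h s (by linarith) hs'
  have h1 := one_add_abs_im_le_of_re hδ1 hs
  have h2 := one_add_abs_im_le_of_re (δ := 1) le_rfl (s := s + 1) (by simp; linarith)
  simp only [add_im, one_im, add_zero, one_mul] at h2
  have hy := abs_nonneg s.im
  set Y := 1 + |s.im| with hY
  have hYp : 0 < Y := by positivity
  have hP : 0 < Y ^ (3 / 8 : ℝ) := by positivity
  refine ⟨h0.trans (by nlinarith), ?_⟩
  have e : Y ^ (-(13 / 8) : ℝ) = Y ^ (3 / 8 : ℝ) / Y ^ 2 := by
    rw [← Real.rpow_two, ← Real.rpow_sub hYp]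
    norm_num
  have hs0 : 0 < ‖s‖ := by nlinarith
  have hs1 : 0 < ‖s + 1‖ := by nlinarith
  rw [regKernel, norm_div, norm_mul, e]
  have h3 : δ * Y ^ 2 / 4 ≤ ‖s‖ * ‖s + 1‖ := by
    have : (δ * Y) * Y ≤ (2 * ‖s‖) * (2 * ‖s + 1‖) := by gcongr
    linarith
  calc ‖regPart s‖ / (‖s‖ * ‖s + 1‖) ≤ (C * Y ^ (3 / 8 : ℝ)) / (δ * Y ^ 2 / 4) := by gcongr
    _ = _ := by field_simp

lemma continuous_regPart_vertical (hRH : RiemannHypothesis) {δ : ℝ} (hδ : 0 < δ) (hδ4 : δ < 4) :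
    Continuous fun y : ℝ => regPart (δ + y * I) := by
  obtain ⟨C, -, h, -, -⟩ := exists_regPart_bound hRH
  refine continuous_iff_continuousAt.2 fun y => ?_
  have h1 : ContinuousAt regPart (δ + y * I) := (h _ (by simpa) (by simpa)).continuousAt
  exact ContinuousAt.comp (f := fun y : ℝ => (δ + y * I : ℂ)) h1 (by fun_prop)

lemma vertical_ne_zero {δ : ℝ} (hδ : 0 < δ) (y : ℝ) : (δ + y * I : ℂ) ≠ 0 := fun h => by
  have := congrArg re h
  simp at this
  linarith

lemma vertical_add_one_ne_zero {δ : ℝ} (hδ : 0 < δ) (y : ℝ) : (δ + y * I + 1 : ℂ) ≠ 0 :=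
  fun h => by
  have := congrArg re h
  simp at this
  linarith

lemma continuous_regKernel_vertical (hRH : RiemannHypothesis) {δ : ℝ} (hδ : 0 < δ) (hδ4 : δ < 4) :
    Continuous fun y : ℝ => regKernel (δ + y * I) := by
  have h1 := continuous_regPart_vertical hRH hδ hδ4
  unfold regKernel
  refine h1.div (by fun_prop) fun y => mul_ne_zero (vertical_ne_zero hδ y)
    (vertical_add_one_ne_zero hδ y)

lemma integrable_one_add_abs_rpow {r : ℝ} (hr : 1 < r) :
    Integrable fun y : ℝ => (1 + |y|) ^ (-r) := by
  have := integrable_one_add_norm (E := ℝ) (μ := volume) (r := r) (by simpa using hr)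
  simpa only [Real.norm_eq_abs] using this

lemma norm_cpow_vertical {x : ℝ} (hx : 0 < x) (δ y : ℝ) :
    ‖(x : ℂ) ^ (δ + y * I + 1 : ℂ)‖ = x ^ (δ + 1) := by
  rw [norm_cpow_eq_rpow_re_of_pos hx]
  simp

lemma integrable_regKernel_vertical (hRH : RiemannHypothesis) {δ : ℝ} (hδ : 0 < δ) (hδ4 : δ < 4) :
    Integrable fun y : ℝ => regKernel (δ + y * I) := by
  obtain ⟨C, hC, h⟩ := exists_regKernel_bound hRH
  have hm : 0 < min δ 1 := lt_min hδ one_pos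
  refine ((integrable_one_add_abs_rpow (r := 13 / 8) (by norm_num)).const_mul
    (C / min δ 1)).mono' (continuous_regKernel_vertical hRH hδ hδ4).aestronglyMeasurable
    (Eventually.of_forall fun y => ?_)
  have := (h (min δ 1) hm (min_le_right _ _) (δ + y * I) (by simp) (by simpa)).2
  simpa using this

lemma integrable_cpow_mul_regKernel (hRH : RiemannHypothesis) {δ x : ℝ} (hδ : 0 < δ) (hδ4 : δ < 4)
    (hx : 0 < x) :
    Integrable fun y : ℝ => (x : ℂ) ^ (δ + y * I + 1 : ℂ) * regKernel (δ + y * I) := by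
  refine (integrable_regKernel_vertical hRH hδ hδ4).bdd_mul (c := x ^ (δ + 1)) ?_ ?_
  · refine Continuous.aestronglyMeasurable ?_
    refine Continuous.const_cpow (by fun_prop) (Or.inl (ofReal_ne_zero.2 hx.ne'))
  · exact Eventually.of_forall fun y => (norm_cpow_vertical hx δ y).le

/-- Inversion takes place at `Re w = -5/2`, that is `Re s = 3/2`. As `regKernel` is holomorphic and
decaying for `δ ≤ Re s ≤ 3/2`, the line moves to `Re s = δ` without residues. -/
theorem smoothErr_eq_integral (hRH : RiemannHypothesis) {δ x : ℝ} (hδ : 0 < δ) (hδ1 : δ ≤ 1)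
    (hx : 0 < x) : smoothErr x =
      (1 / (2 * Real.pi)) * ∫ y : ℝ, (x : ℂ) ^ (δ + y * I + 1 : ℂ) * regKernel (δ + y * I) := by
  obtain ⟨C₀, -, hdiff, heq, -⟩ := exists_regPart_bound hRH
  have hM : ∀ y : ℝ, mellin smoothErr (((-(5 / 2) : ℝ) : ℂ) + y * I) =
      regKernel (((3 / 2 : ℝ) : ℂ) + ((-y : ℝ) : ℂ) * I) := by
    intro y
    have h1 : (((-(5 / 2) : ℝ) : ℂ) + y * I).re < -2 := by simp; norm_num
    have e : -(((-(5 / 2) : ℝ) : ℂ) + y * I) - 1 = ((3 / 2 : ℝ) : ℂ) + ((-y : ℝ) : ℂ) * I := by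
      push_cast
      ring
    rw [(hasMellin_smoothErr hRH h1).2, regKernel, e, (heq _ (by simp) (by simp; norm_num) ?_).2]
    · congr 1
      push_cast
      ring
    · rw [Ne, zetaPole_eq_zero_iff hRH (by simp; norm_num)]
      intro h
      have := h.2.2
      simp at this
      norm_num at this
  have hconv : MellinConvergent smoothErr ((-(5 / 2) : ℝ) : ℂ) :=
    (hasMellin_smoothErr hRH (by simp; norm_num)).1
  have hint := integrable_regKernel_vertical hRH (δ := 3 / 2) (by norm_num) (by norm_num)
  have hvert : VerticalIntegrable (mellin smoothErr) (-(5 / 2)) := by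
    rw [VerticalIntegrable]
    simp only [hM]
    exact hint.comp_neg
  have h1 := mellinInv_mellin_eq (-(5 / 2)) smoothErr hx hconv hvert
    (continuous_smoothErr hRH).continuousAt
  rw [mellinInv] at h1
  simp only [hM] at h1
  -- The substitution `s = -w - 1` reverses the line, hence the change `y ↦ -y`.
  have h2 : ∫ y : ℝ, (x : ℂ) ^ (-(((-(5 / 2) : ℝ) : ℂ) + y * I)) •
      regKernel (((3 / 2 : ℝ) : ℂ) + ((-y : ℝ) : ℂ) * I) =
      ∫ y : ℝ, (x : ℂ) ^ (((3 / 2 : ℝ) : ℂ) + y * I + 1 : ℂ) *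
        regKernel (((3 / 2 : ℝ) : ℂ) + y * I) := by
    rw [← integral_neg_eq_self]
    refine integral_congr_ae (Eventually.of_forall fun y => ?_)
    simp only [smul_eq_mul]
    congr 2
    · push_cast
      ring
    · push_cast
      ring
  rw [h2] at h1
  obtain ⟨C, hC, hK⟩ := exists_regKernel_bound hRH
  rw [integral_vertical_eq (f := fun s => (x : ℂ) ^ (s + 1) * regKernel s) (a := δ) (b := 3 / 2)
    (B := fun y => max (x ^ (δ + 1)) (x ^ (3 / 2 + 1 : ℝ)) * (C / δ * (1 + y) ^ (-(13 / 8) : ℝ)))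
    (by linarith) ?_ (integrable_cpow_mul_regKernel hRH hδ (by linarith) hx)
    (integrable_cpow_mul_regKernel hRH (by norm_num) (by norm_num) hx) ?_ ?_, ← h1]
  · simp
  · intro z hz hz'
    have hz0 : z ≠ 0 := fun h => by rw [h] at hz; simp at hz; linarith
    have hz1 : z + 1 ≠ 0 := fun h => by
      have := congrArg re h
      simp at this
      linarith
    have h3 := hdiff z (by linarith) (by linarith)
    have h4 : DifferentiableAt ℂ (fun s : ℂ => (x : ℂ) ^ (s + 1)) z :=
      DifferentiableAt.const_cpow (by fun_prop) (Or.inl (ofReal_ne_zero.2 hx.ne'))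
    refine h4.mul (h3.div (by fun_prop) (mul_ne_zero hz0 hz1))
  · have h3 : Tendsto (fun y : ℝ => (1 + y) ^ (-(13 / 8) : ℝ)) atTop (𝓝 0) :=
      (tendsto_rpow_neg_atTop (by norm_num)).comp (tendsto_atTop_add_const_left _ 1 tendsto_id)
    simpa using (h3.const_mul (C / δ)).const_mul (max (x ^ (δ + 1)) (x ^ (3 / 2 + 1 : ℝ)))
  · intro σ hσ hσ' y
    have h3 := (hK δ hδ hδ1 (σ + y * I) (by simpa) (by simp; linarith)).2
    have him : (σ + y * I : ℂ).im = y := by simp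
    rw [him] at h3
    rw [norm_mul, norm_cpow_vertical hx]
    refine mul_le_mul ?_ h3 (norm_nonneg _) (by positivity)
    rcases le_total 1 x with h | h
    · exact (Real.rpow_le_rpow_of_exponent_le h (by linarith)).trans (le_max_right _ _)
    · exact (Real.rpow_le_rpow_of_exponent_ge hx h (by linarith)).trans (le_max_left _ _)

theorem exists_norm_smoothErr_le (hRH : RiemannHypothesis) : ∃ C : ℝ, 0 < C ∧
    ∀ δ x : ℝ, 0 < δ → δ ≤ 1 → 0 < x → ‖smoothErr x‖ ≤ C / δ * x ^ (δ + 1) := by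
  obtain ⟨C, hC, hK⟩ := exists_regKernel_bound hRH
  set J := ∫ y : ℝ, (1 + |y|) ^ (-(13 / 8) : ℝ)
  have hJ : 0 ≤ J := integral_nonneg fun y => by positivity
  refine ⟨C * J + 1, by positivity, fun δ x hδ hδ1 hx => ?_⟩
  rw [smoothErr_eq_integral hRH hδ hδ1 hx, norm_mul]
  have h1 : ‖(1 / (2 * Real.pi) : ℂ)‖ ≤ 1 := by
    have := Real.pi_gt_three
    rw [norm_div, norm_one, norm_mul, Complex.norm_real, Real.norm_of_nonneg Real.pi_pos.le,
      Complex.norm_ofNat, div_le_one (by positivity)]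
    linarith
  have h2 : ‖∫ y : ℝ, (x : ℂ) ^ (δ + y * I + 1 : ℂ) * regKernel (δ + y * I)‖ ≤
      x ^ (δ + 1) * (C / δ) * J := by
    rw [← integral_const_mul]
    refine norm_integral_le_of_norm_le
      ((integrable_one_add_abs_rpow (r := 13 / 8) (by norm_num)).const_mul _)
      (Eventually.of_forall fun y => ?_)
    have h3 := (hK δ hδ hδ1 (δ + y * I) (by simp) (by simp; linarith)).2
    have him : (δ + y * I : ℂ).im = y := by simp
    rw [him] at h3
    rw [norm_mul, norm_cpow_vertical hx, mul_assoc]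
    gcongr
  calc _ ≤ 1 * (x ^ (δ + 1) * (C / δ) * J) := by gcongr
    _ = C * J / δ * x ^ (δ + 1) := by ring
    _ ≤ _ := by gcongr; linarith

end GoldbachAverage

/-! ### Mean squares over dyadic intervals. -/

namespace GoldbachAverage

open Complex Set Filter Topology Metric MeasureTheory
open scoped ENNReal

/-- Substitute `x = X e ^ u`; as `4 ≤ e ^ 2`, the variable stays in `[0, 2]`, where `u + u ^ 2 ≤ 6`
bounds the Jacobian `X e ^ u` by `e ^ 6 X e ^ (-u ^ 2)`. -/
lemma lintegral_Icc_le_gaussian {X : ℝ} (hX : 0 < X) {g k : ℝ → ℝ≥0∞}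
    (h : ∀ u ∈ Icc (0 : ℝ) 2, g (X * Real.exp u) ≤ k u) :
    ∫⁻ x in Icc X (4 * X), g x ≤
      ENNReal.ofReal (Real.exp 6 * X) * ∫⁻ u : ℝ, k u * ENNReal.ofReal (Real.exp (-u ^ 2)) := by
  have hsub : Icc X (4 * X) ⊆ (fun u => X * Real.exp u) '' Icc 0 2 := by
    intro x hx
    have hx0 : 0 < x / X := div_pos (hX.trans_le hx.1) hX
    refine ⟨Real.log (x / X), ⟨Real.log_nonneg ((one_le_div hX).2 hx.1), ?_⟩, ?_⟩
    · rw [Real.log_le_iff_le_exp hx0, div_le_iff₀ hX]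
      have h4 : (4 : ℝ) ≤ Real.exp 2 := by
        have h1 := Real.add_one_le_exp (1 : ℝ)
        have h2 : Real.exp 2 = Real.exp 1 * Real.exp 1 := by rw [← Real.exp_add]; norm_num
        rw [h2]
        nlinarith
      exact hx.2.trans (by gcongr)
    · simp only
      rw [Real.exp_log hx0]
      field_simp
  refine (lintegral_mono_set hsub).trans ?_
  rw [lintegral_image_eq_lintegral_abs_deriv_mul measurableSet_Icc
    (fun u _ => ((Real.hasDerivAt_exp u).const_mul X).hasDerivWithinAt)
    (fun u _ v _ huv => Real.exp_injective (mul_left_cancel₀ hX.ne' huv))]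
  rw [← lintegral_const_mul' _ _ ENNReal.ofReal_ne_top]
  refine (setLIntegral_mono' measurableSet_Icc fun u hu => ?_).trans (setLIntegral_le_lintegral _ _)
  have e1 : |X * Real.exp u| ≤ Real.exp 6 * X * Real.exp (-u ^ 2) := by
    rw [abs_of_pos (by positivity), mul_comm, mul_right_comm, ← Real.exp_add]
    gcongr
    nlinarith [hu.1, hu.2]
  calc ENNReal.ofReal |X * Real.exp u| * g (X * Real.exp u)
      ≤ ENNReal.ofReal (Real.exp 6 * X * Real.exp (-u ^ 2)) * k u :=
        mul_le_mul' (ENNReal.ofReal_le_ofReal e1) (h u hu)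
    _ = _ := by rw [ENNReal.ofReal_mul (by positivity)]; ring

/-- Mean square of a superposition of powers `x ^ (σ + iτ)`. -/
theorem lintegral_normSq_powers_le {Ω : Type*} [MeasurableSpace Ω] {ν : Measure Ω} [SFinite ν]
    {τ : Ω → ℝ} (hτ : Measurable τ) {q : Ω → ℝ} (hq : Measurable q) (hq0 : ∀ ω, 0 ≤ q ω)
    {a : Ω → ℂ} (ha : Measurable a) (hint : Integrable (fun ω => q ω * a ω) ν)
    {W : Ω → ℝ≥0∞}
    (hW : ∀ ω, ∫⁻ ω', ENNReal.ofReal (q ω' * Real.exp (-(τ ω - τ ω') ^ 2 / 4)) ∂ν ≤ W ω)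
    {X σ : ℝ} (hX : 0 < X) (hσ1 : σ ≤ 1) :
    ∫⁻ x in Icc X (4 * X), ENNReal.ofReal
        (‖∫ ω, q ω * a ω * (x : ℂ) ^ ((σ : ℂ) + τ ω * I) ∂ν‖ ^ 2) ≤
      ENNReal.ofReal (Real.exp 10 * √Real.pi * X ^ (1 + 2 * σ)) *
        ∫⁻ ω, ENNReal.ofReal (q ω * ‖a ω‖ ^ 2) * W ω ∂ν := by
  have hX0 : (X : ℂ) ≠ 0 := ofReal_ne_zero.2 hX.ne'
  set b : Ω → ℂ := fun ω => a ω * (X : ℂ) ^ ((σ : ℂ) + τ ω * I) with hb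
  have hpow : ∀ ω, ‖(X : ℂ) ^ ((σ : ℂ) + τ ω * I)‖ = X ^ σ := fun ω => by
    rw [norm_cpow_eq_rpow_re_of_pos hX]
    simp
  have hpm : Measurable fun ω => (X : ℂ) ^ ((σ : ℂ) + τ ω * I) := by fun_prop
  have hbm : Measurable b := ha.mul hpm
  have hbint : Integrable (fun ω => q ω * b ω) ν := by
    have := hint.mul_bdd (c := X ^ σ) hpm.aestronglyMeasurable
      (Eventually.of_forall fun ω => (hpow ω).le)
    refine this.congr (Eventually.of_forall fun ω => ?_)
    simp only [hb]
    ring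
  have h1 := lintegral_normSq_gaussian_le hτ hq hq0 hbm hbint hW
  have h2 : ∀ u ∈ Icc (0 : ℝ) 2, ENNReal.ofReal (‖∫ ω, q ω * a ω *
      ((X * Real.exp u : ℝ) : ℂ) ^ ((σ : ℂ) + τ ω * I) ∂ν‖ ^ 2) ≤
      ENNReal.ofReal (Real.exp 4) *
        ENNReal.ofReal (‖∫ ω, q ω * b ω * cexp (I * τ ω * u) ∂ν‖ ^ 2) := by
    intro u hu
    have e : ∀ ω, (q ω : ℂ) * a ω * ((X * Real.exp u : ℝ) : ℂ) ^ ((σ : ℂ) + τ ω * I) =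
        (Real.exp (σ * u) : ℂ) * (q ω * b ω * cexp (I * τ ω * u)) := by
      intro ω
      have e1 : ((Real.exp u : ℝ) : ℂ) ^ ((σ : ℂ) + τ ω * I) =
          (Real.exp (σ * u) : ℂ) * cexp (I * τ ω * u) := by
        rw [cpow_def_of_ne_zero (ofReal_ne_zero.2 (Real.exp_pos u).ne'), ← ofReal_log
          (Real.exp_pos u).le, Real.log_exp]
        push_cast
        rw [← Complex.exp_add]
        ring_nf
      rw [ofReal_mul, mul_cpow_ofReal_nonneg hX.le (Real.exp_pos u).le, e1, hb]
      ring
    simp only [e]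
    rw [integral_const_mul, norm_mul, mul_pow, ← ENNReal.ofReal_mul (Real.exp_pos 4).le]
    refine ENNReal.ofReal_le_ofReal ?_
    refine mul_le_mul_of_nonneg_right ?_ (sq_nonneg _)
    rw [Complex.norm_real, Real.norm_of_nonneg (Real.exp_pos _).le, ← Real.exp_nat_mul]
    -- Here `2 σ u ≤ 4` because `σ ≤ 1` and `0 ≤ u ≤ 2`; together with the Jacobian this gives the
    -- constant `e ^ 10`.
    refine Real.exp_le_exp.2 ?_
    push_cast
    nlinarith [hu.1, hu.2]
  refine (lintegral_Icc_le_gaussian hX h2).trans ?_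
  have e2 : ∀ u : ℝ, ENNReal.ofReal (Real.exp 4) *
      ENNReal.ofReal (‖∫ ω, q ω * b ω * cexp (I * τ ω * u) ∂ν‖ ^ 2) *
      ENNReal.ofReal (Real.exp (-u ^ 2)) = ENNReal.ofReal (Real.exp 4) *
      ENNReal.ofReal (‖∫ ω, q ω * b ω * cexp (I * τ ω * u) ∂ν‖ ^ 2 * Real.exp (-u ^ 2)) := by
    intro u
    rw [mul_assoc, ENNReal.ofReal_mul (sq_nonneg _)]
  simp only [e2]
  rw [lintegral_const_mul' _ _ ENNReal.ofReal_ne_top]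
  have e3 : ∀ ω, ENNReal.ofReal (q ω * ‖b ω‖ ^ 2) * W ω =
      ENNReal.ofReal (X ^ (2 * σ)) * (ENNReal.ofReal (q ω * ‖a ω‖ ^ 2) * W ω) := by
    intro ω
    rw [← mul_assoc, ← ENNReal.ofReal_mul (by positivity)]
    congr 2
    simp only [hb]
    rw [norm_mul, hpow, mul_pow, ← Real.rpow_mul_natCast hX.le]
    push_cast
    ring_nf
  simp only [e3] at h1
  rw [lintegral_const_mul' _ _ ENNReal.ofReal_ne_top] at h1
  refine (mul_le_mul_right (mul_le_mul_right h1 _) _).trans (le_of_eq ?_)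
  simp only [← mul_assoc]
  rw [← ENNReal.ofReal_mul (by positivity), ← ENNReal.ofReal_mul (by positivity),
    ← ENNReal.ofReal_mul (by positivity)]
  congr 2
  rw [Real.rpow_add hX, Real.rpow_one, show (10 : ℝ) = 6 + 4 by norm_num, Real.exp_add]
  ring

lemma measurable_powers_integral {Ω : Type*} [MeasurableSpace Ω] {ν : Measure Ω} [SFinite ν]
    {τ : Ω → ℝ} (hτ : Measurable τ) {c : Ω → ℂ} (hc : Measurable c) (σ : ℝ) :
    Measurable fun x : ℝ => ∫ ω, c ω * (x : ℂ) ^ ((σ : ℂ) + τ ω * I) ∂ν := by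
  have : Measurable (Function.uncurry fun (x : ℝ) ω =>
      c ω * (x : ℂ) ^ ((σ : ℂ) + τ ω * I)) := by
    unfold Function.uncurry
    fun_prop
  exact this.stronglyMeasurable.integral_prod_right.measurable

lemma setLIntegral_comp_add_right (g : ℝ → ℝ≥0∞) (a b h : ℝ) :
    ∫⁻ x in Icc a b, g (x + h) = ∫⁻ x in Icc (a + h) (b + h), g x := by
  rw [← lintegral_indicator measurableSet_Icc, ← lintegral_indicator measurableSet_Icc,
    ← lintegral_add_right_eq_self ((Icc (a + h) (b + h)).indicator g) h]
  refine lintegral_congr fun x => ?_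
  by_cases hx : x ∈ Icc a b
  · rw [indicator_of_mem hx, indicator_of_mem (show x + h ∈ Icc (a + h) (b + h) from
      ⟨by linarith [hx.1], by linarith [hx.2]⟩)]
  · rw [indicator_of_notMem hx, indicator_of_notMem]
    exact fun h' => hx ⟨by linarith [h'.1], by linarith [h'.2]⟩

lemma ofReal_normSq_sub_le (z w : ℂ) : ENNReal.ofReal (‖z - w‖ ^ 2) ≤
    2 * ENNReal.ofReal (‖z‖ ^ 2) + 2 * ENNReal.ofReal (‖w‖ ^ 2) := by
  rw [show (2 : ℝ≥0∞) = ENNReal.ofReal 2 by norm_num, ← ENNReal.ofReal_mul (by norm_num),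
    ← ENNReal.ofReal_mul (by norm_num), ← ENNReal.ofReal_add (by positivity) (by positivity)]
  refine ENNReal.ofReal_le_ofReal ?_
  have := norm_sub_le z w
  have h0 := norm_nonneg (z - w)
  nlinarith [sq_nonneg (‖z‖ - ‖w‖)]

/-- The mean square of a difference is controlled by the mean square. -/
lemma lintegral_normSq_shift_sub_le {S : ℝ → ℂ} (hS : Measurable S) {X h : ℝ} (hh : 0 ≤ h)
    (hhX : h ≤ X) :
    ∫⁻ x in Icc X (2 * X), ENNReal.ofReal (‖S (x + h) - S x‖ ^ 2) ≤
      4 * ∫⁻ x in Icc X (4 * X), ENNReal.ofReal (‖S x‖ ^ 2) := by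
  have hm : Measurable fun x => ENNReal.ofReal (‖S x‖ ^ 2) := by fun_prop
  calc _ ≤ ∫⁻ x in Icc X (2 * X), (2 * ENNReal.ofReal (‖S (x + h)‖ ^ 2) +
        2 * ENNReal.ofReal (‖S x‖ ^ 2)) := lintegral_mono fun x => ofReal_normSq_sub_le _ _
    _ = 2 * (∫⁻ x in Icc X (2 * X), ENNReal.ofReal (‖S (x + h)‖ ^ 2)) +
        2 * ∫⁻ x in Icc X (2 * X), ENNReal.ofReal (‖S x‖ ^ 2) := by
        rw [lintegral_add_right _ (hm.const_mul 2), lintegral_const_mul' _ _ (by norm_num),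
          lintegral_const_mul' _ _ (by norm_num)]
    _ ≤ 2 * (∫⁻ x in Icc X (4 * X), ENNReal.ofReal (‖S x‖ ^ 2)) +
        2 * ∫⁻ x in Icc X (4 * X), ENNReal.ofReal (‖S x‖ ^ 2) := by
        rw [setLIntegral_comp_add_right (fun x => ENNReal.ofReal (‖S x‖ ^ 2))]
        have s1 : Icc (X + h) (2 * X + h) ⊆ Icc X (4 * X) :=
          Icc_subset_Icc (by linarith) (by linarith)
        have s2 : Icc X (2 * X) ⊆ Icc X (4 * X) := Icc_subset_Icc le_rfl (by linarith)
        exact add_le_add (mul_le_mul_right (lintegral_mono_set s1) _)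
          (mul_le_mul_right (lintegral_mono_set s2) _)
    _ = _ := by rw [← add_mul]; norm_num

/-- The mean square of a difference is controlled by the mean square of the derivative. -/
lemma lintegral_normSq_shift_sub_le_deriv {L L' : ℝ → ℂ} {X Y h : ℝ} (hX : 0 < X) (hh : 0 < h)
    (hL : ∀ x, 0 < x → HasDerivAt L (L' x) x) (hc : ContinuousOn L' (Ioi 0))
    (hm : Measurable L') :
    ∫⁻ x in Icc X Y, ENNReal.ofReal (‖L (x + h) - L x‖ ^ 2) ≤
      ENNReal.ofReal (h ^ 2) * ∫⁻ x in Icc X (Y + h), ENNReal.ofReal (‖L' x‖ ^ 2) := by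
  set g : ℝ → ℝ≥0∞ := fun x => ENNReal.ofReal (‖L' x‖ ^ 2) with hg
  have hgm : Measurable g := by fun_prop
  have h1 : ∀ x ∈ Icc X Y, ENNReal.ofReal (‖L (x + h) - L x‖ ^ 2) ≤
      ENNReal.ofReal h * ∫⁻ θ in Icc 0 h, g (x + θ) := by
    intro x hx
    have hx0 : 0 < x := hX.trans_le hx.1
    have hle : x ≤ x + h := by linarith
    have hcont : ContinuousOn L' (Icc x (x + h)) := hc.mono fun y hy => hx0.trans_le hy.1
    have hint : IntervalIntegrable L' volume x (x + h) :=
      ContinuousOn.intervalIntegrable (by rwa [uIcc_of_le hle])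
    have hn2 : ContinuousOn (fun y => ‖L' y‖ ^ 2) (Icc x (x + h)) := (hcont.norm).pow 2
    have hint2 : IntervalIntegrable (fun y => ‖L' y‖ ^ 2) volume x (x + h) :=
      ContinuousOn.intervalIntegrable (by rwa [uIcc_of_le hle])
    have hFTC : ∫ y in x..(x + h), L' y = L (x + h) - L x :=
      intervalIntegral.integral_eq_sub_of_hasDerivAt
        (fun y hy => hL y (by rw [uIcc_of_le hle] at hy; exact hx0.trans_le hy.1)) hint
    set J := ∫ y in x..(x + h), ‖L' y‖ ^ 2 with hJ
    set M := ‖L (x + h) - L x‖ with hM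
    have hM1 : M ≤ ∫ y in x..(x + h), ‖L' y‖ := by
      rw [hM, ← hFTC]
      exact intervalIntegral.norm_integral_le_integral_norm hle
    -- Cauchy–Schwarz, obtained from the nonnegativity of `∫ (‖L'‖ - M / h) ^ 2`.
    have hCS : M ^ 2 ≤ h * J := by
      have hkey : 0 ≤ ∫ y in x..(x + h), (‖L' y‖ - M / h) ^ 2 :=
        intervalIntegral.integral_nonneg hle fun y _ => sq_nonneg _
      have e : ∫ y in x..(x + h), (‖L' y‖ - M / h) ^ 2 =
          J - 2 * (M / h) * (∫ y in x..(x + h), ‖L' y‖) + (M / h) ^ 2 * h := by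
        have e1 : ∀ y, (‖L' y‖ - M / h) ^ 2 =
            ‖L' y‖ ^ 2 - 2 * (M / h) * ‖L' y‖ + (M / h) ^ 2 := fun y => by ring
        simp only [e1]
        rw [intervalIntegral.integral_add (hint2.sub (hint.norm.const_mul _))
          intervalIntegrable_const, intervalIntegral.integral_sub hint2 (hint.norm.const_mul _),
          intervalIntegral.integral_const_mul, intervalIntegral.integral_const]
        simp
        ring
      rw [e] at hkey
      have h0 : 0 ≤ M := norm_nonneg _
      have h3 : 2 * (M / h) * M ≤ 2 * (M / h) * ∫ y in x..(x + h), ‖L' y‖ :=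
        mul_le_mul_of_nonneg_left hM1 (by positivity)
      have h4 : M / h * M ≤ J := by
        have : (M / h) ^ 2 * h = M / h * M := by field_simp
        rw [this] at hkey
        linarith
      rw [div_mul_eq_mul_div, div_le_iff₀ hh] at h4
      nlinarith
    have hJe : ENNReal.ofReal J = ∫⁻ θ in Icc 0 h, g (x + θ) := by
      have e2 := setLIntegral_comp_add_right g 0 h x
      simp only [add_comm _ x, add_zero] at e2
      rw [e2, hJ, intervalIntegral.integral_of_le hle, ← integral_Icc_eq_integral_Ioc,
        ofReal_integral_eq_lintegral_ofReal]
      · exact hn2.integrableOn_Icc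
      · exact Eventually.of_forall fun y => sq_nonneg _
    rw [← hJe, ← ENNReal.ofReal_mul hh.le]
    exact ENNReal.ofReal_le_ofReal hCS
  refine (setLIntegral_mono' measurableSet_Icc h1).trans ?_
  rw [lintegral_const_mul' _ _ ENNReal.ofReal_ne_top, lintegral_lintegral_swap (by fun_prop)]
  have h2 : ∀ θ ∈ Icc 0 h, ∫⁻ x in Icc X Y, g (x + θ) ≤ ∫⁻ x in Icc X (Y + h), g x := by
    intro θ hθ
    rw [setLIntegral_comp_add_right]
    exact lintegral_mono_set (Icc_subset_Icc (by linarith [hθ.1]) (by linarith [hθ.2]))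
  refine (mul_le_mul_right (setLIntegral_mono' measurableSet_Icc h2) _).trans ?_
  rw [setLIntegral_const, Real.volume_Icc, sub_zero, mul_comm _ (ENNReal.ofReal h), ← mul_assoc,
    ← ENNReal.ofReal_mul hh.le, sq]

end GoldbachAverage

/-! ### Mean squares of the sum over zeros and of the regular integral. -/

namespace GoldbachAverage

open Complex Set Filter Topology Metric MeasureTheory
open scoped ENNReal

/-- The superposition `∑ m a_ρ x ^ ρ` over the zeros, written as an integral. -/
noncomputable def zeroPow (a : nontrivialZetaZeros → ℂ) (x : ℝ) : ℂ :=
  ∫ ρ : nontrivialZetaZeros, ((zetaZeroMult ρ : ℝ) : ℂ) * a ρ *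
    (x : ℂ) ^ (((1 / 2 : ℝ) : ℂ) + ((ρ : ℂ).im : ℂ) * I) ∂Measure.count

lemma measurable_zeroPow (a : nontrivialZetaZeros → ℂ) : Measurable (zeroPow a) :=
  measurable_powers_integral (measurable_of_countable _) (measurable_of_countable _) (1 / 2)

lemma half_add_im (hRH : RiemannHypothesis) {ρ : ℂ} (h : ρ ∈ nontrivialZetaZeros) :
    ((1 / 2 : ℝ) : ℂ) + (ρ.im : ℂ) * I = ρ := by
  apply Complex.ext <;> simp [re_eq_half_of_mem hRH h]

lemma integrable_zeroPow {a : nontrivialZetaZeros → ℂ}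
    (ha : Summable fun ρ : nontrivialZetaZeros => (zetaZeroMult ρ : ℝ) * ‖a ρ‖) :
    Integrable (fun ρ : nontrivialZetaZeros => ((zetaZeroMult ρ : ℝ) : ℂ) * a ρ)
      Measure.count := by
  rw [integrable_count_iff]
  refine ha.congr fun ρ => ?_
  rw [norm_mul, Complex.norm_real, Real.norm_of_nonneg (Nat.cast_nonneg _)]

lemma integrable_zeroPow_mul {a : nontrivialZetaZeros → ℂ}
    (ha : Summable fun ρ : nontrivialZetaZeros => (zetaZeroMult ρ : ℝ) * ‖a ρ‖)
    {x : ℝ} (hx : 0 < x) :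
    Integrable (fun ρ : nontrivialZetaZeros => ((zetaZeroMult ρ : ℝ) : ℂ) * a ρ *
      (x : ℂ) ^ (((1 / 2 : ℝ) : ℂ) + ((ρ : ℂ).im : ℂ) * I)) Measure.count := by
  refine (integrable_zeroPow ha).mul_bdd (c := x ^ (1 / 2 : ℝ))
    (measurable_of_countable _).aestronglyMeasurable (Eventually.of_forall fun ρ => ?_)
  rw [norm_cpow_eq_rpow_re_of_pos hx]
  simp

lemma hasSum_zeroPow (hRH : RiemannHypothesis) {a : nontrivialZetaZeros → ℂ}
    (ha : Summable fun ρ : nontrivialZetaZeros => (zetaZeroMult ρ : ℝ) * ‖a ρ‖)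
    {x : ℝ} (hx : 0 < x) :
    HasSum (fun ρ : nontrivialZetaZeros => (zetaZeroMult ρ : ℂ) * a ρ * (x : ℂ) ^ (ρ : ℂ))
      (zeroPow a x) := by
  have h1 := integrable_zeroPow_mul ha hx
  have h2 := (integrable_count_iff.1 h1).of_norm
  rw [zeroPow, integral_countable h1]
  simp only [Measure.real, Measure.count_singleton, ENNReal.toReal_one, one_smul]
  refine h2.hasSum.congr_fun fun ρ => ?_
  rw [half_add_im hRH ρ.2, ofReal_natCast]

lemma zeroPow_add {a b : nontrivialZetaZeros → ℂ}
    (ha : Summable fun ρ : nontrivialZetaZeros => (zetaZeroMult ρ : ℝ) * ‖a ρ‖)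
    (hb : Summable fun ρ : nontrivialZetaZeros => (zetaZeroMult ρ : ℝ) * ‖b ρ‖)
    {x : ℝ} (hx : 0 < x) :
    zeroPow (fun ρ => a ρ + b ρ) x = zeroPow a x + zeroPow b x := by
  rw [zeroPow, zeroPow, zeroPow,
    ← integral_add (integrable_zeroPow_mul ha hx) (integrable_zeroPow_mul hb hx)]
  refine integral_congr_ae (Eventually.of_forall fun ρ => ?_)
  simp only
  ring

/-- The large sieve for counting measure with the multiplicities as weights and row sums `O(logWt
(Im ρ))`. RH fixes `σ = 1/2`, so the power of `X` is `2`. -/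
theorem exists_lintegral_zeroPow_le (hRH : RiemannHypothesis) : ∃ C : ℝ, 0 < C ∧
    ∀ (X : ℝ) (a : nontrivialZetaZeros → ℂ) (f : nontrivialZetaZeros → ℝ), 0 < X →
      Summable (fun ρ : nontrivialZetaZeros => (zetaZeroMult ρ : ℝ) * ‖a ρ‖) →
      (∀ ρ, ‖a ρ‖ ^ 2 * logWt (ρ : ℂ).im ≤ f ρ) →
      Summable (fun ρ : nontrivialZetaZeros => (zetaZeroMult ρ : ℝ) * f ρ) →
      ∫⁻ x in Icc X (4 * X), ENNReal.ofReal (‖zeroPow a x‖ ^ 2) ≤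
        ENNReal.ofReal (C * X ^ 2 * ∑' ρ : nontrivialZetaZeros, (zetaZeroMult ρ : ℝ) * f ρ) := by
  obtain ⟨A, hA, hG⟩ := exists_sum_gaussian_le hRH
  refine ⟨Real.exp 10 * √Real.pi * A, by positivity, fun X a f hX ha hf hfs => ?_⟩
  have hf0 : ∀ ρ, 0 ≤ f ρ := fun ρ =>
    (mul_nonneg (sq_nonneg _) (logWt_pos _).le).trans (hf ρ)
  have hW : ∀ ρ : nontrivialZetaZeros, ∫⁻ ρ' : nontrivialZetaZeros,
      ENNReal.ofReal ((zetaZeroMult ρ' : ℝ) *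
        Real.exp (-((ρ : ℂ).im - (ρ' : ℂ).im) ^ 2 / 4)) ∂Measure.count ≤
      ENNReal.ofReal (A * logWt (ρ : ℂ).im) := by
    intro ρ
    obtain ⟨h1, h2⟩ := hG (ρ : ℂ).im
    rw [lintegral_count, ← ENNReal.ofReal_tsum_of_nonneg (fun _ => by positivity) h1]
    exact ENNReal.ofReal_le_ofReal h2
  have h1 := lintegral_normSq_powers_le (ν := (Measure.count : Measure nontrivialZetaZeros))
    (τ := fun ρ => (ρ : ℂ).im) (measurable_of_countable _)
    (q := fun ρ => (zetaZeroMult ρ : ℝ)) (measurable_of_countable _)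
    (fun ρ => Nat.cast_nonneg _) (a := a) (measurable_of_countable _) (integrable_zeroPow ha)
    hW (σ := 1 / 2) hX (by norm_num)
  refine h1.trans ?_
  have h2 : ∫⁻ ρ : nontrivialZetaZeros, ENNReal.ofReal ((zetaZeroMult ρ : ℝ) * ‖a ρ‖ ^ 2) *
      ENNReal.ofReal (A * logWt (ρ : ℂ).im) ∂Measure.count ≤
      ENNReal.ofReal (∑' ρ : nontrivialZetaZeros, A * ((zetaZeroMult ρ : ℝ) * f ρ)) := by
    rw [lintegral_count, ENNReal.ofReal_tsum_of_nonneg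
      (fun ρ => mul_nonneg hA.le (mul_nonneg (Nat.cast_nonneg _) (hf0 ρ))) (hfs.mul_left A)]
    refine ENNReal.tsum_le_tsum fun ρ => ?_
    rw [← ENNReal.ofReal_mul (by positivity)]
    refine ENNReal.ofReal_le_ofReal ?_
    have := mul_le_mul_of_nonneg_left (hf ρ)
      (mul_nonneg hA.le (Nat.cast_nonneg (zetaZeroMult ρ) : (0 : ℝ) ≤ _))
    linarith
  refine (mul_le_mul_right h2 _).trans (le_of_eq ?_)
  rw [← ENNReal.ofReal_mul (by positivity), tsum_mul_left]
  congr 1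
  have : X ^ (1 + 2 * (1 / 2) : ℝ) = X ^ 2 := by
    rw [← Real.rpow_two]
    norm_num
  rw [this]
  ring

/-- Finite support permits termwise differentiation. The derivative is `x⁻¹` times the superposition
with coefficients `a ρ * ρ`, so the shift gains `(h / X) ^ 2` over the plain mean square. -/
theorem exists_lintegral_zeroPow_shift_le (hRH : RiemannHypothesis) : ∃ C : ℝ, 0 < C ∧
    ∀ (X h : ℝ) (S : Finset nontrivialZetaZeros) (a : nontrivialZetaZeros → ℂ)
      (f : nontrivialZetaZeros → ℝ), 0 < X → 0 < h → h ≤ X → (∀ ρ ∉ S, a ρ = 0) →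
      (∀ ρ : nontrivialZetaZeros, ‖a ρ * ρ‖ ^ 2 * logWt (ρ : ℂ).im ≤ f ρ) →
      Summable (fun ρ : nontrivialZetaZeros => (zetaZeroMult ρ : ℝ) * f ρ) →
      ∫⁻ x in Icc X (2 * X), ENNReal.ofReal (‖zeroPow a (x + h) - zeroPow a x‖ ^ 2) ≤
        ENNReal.ofReal (C * h ^ 2 * ∑' ρ : nontrivialZetaZeros, (zetaZeroMult ρ : ℝ) * f ρ) := by
  obtain ⟨C, hC, hms⟩ := exists_lintegral_zeroPow_le hRH
  refine ⟨C, hC, fun X h S a f hX hh hhX hS hf hfs => ?_⟩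
  set b : nontrivialZetaZeros → ℂ := fun ρ => a ρ * ρ with hb
  have hbS : ∀ ρ ∉ S, b ρ = 0 := fun ρ hρ => by simp only [hb, hS ρ hρ, zero_mul]
  have hsum : ∀ c : nontrivialZetaZeros → ℂ, (∀ ρ ∉ S, c ρ = 0) →
      Summable fun ρ : nontrivialZetaZeros => (zetaZeroMult ρ : ℝ) * ‖c ρ‖ := fun c hc =>
    summable_of_ne_finset_zero (s := S) fun ρ hρ => by rw [hc ρ hρ, norm_zero, mul_zero]
  have hfin : ∀ c : nontrivialZetaZeros → ℂ, (∀ ρ ∉ S, c ρ = 0) → ∀ x : ℝ, 0 < x →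
      zeroPow c x = ∑ ρ ∈ S, (zetaZeroMult ρ : ℂ) * c ρ * (x : ℂ) ^ (ρ : ℂ) := fun c hc x hx => by
    rw [← (hasSum_zeroPow hRH (hsum c hc) hx).tsum_eq]
    exact tsum_eq_sum fun ρ hρ => by rw [hc ρ hρ, mul_zero, zero_mul]
  set L' : ℝ → ℂ := fun x => (x : ℂ)⁻¹ * zeroPow b x with hL'
  have hL'eq : ∀ x : ℝ, 0 < x → L' x =
      ∑ ρ ∈ S, (zetaZeroMult ρ : ℂ) * a ρ * ((ρ : ℂ) * (x : ℂ) ^ ((ρ : ℂ) - 1)) := by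
    intro x hx
    have hx0 : (x : ℂ) ≠ 0 := ofReal_ne_zero.2 hx.ne'
    simp only [hL']
    rw [hfin b hbS x hx, Finset.mul_sum]
    refine Finset.sum_congr rfl fun ρ _ => ?_
    rw [cpow_sub _ _ hx0, cpow_one]
    simp only [hb]
    field_simp
  have hderiv : ∀ x : ℝ, 0 < x → HasDerivAt (zeroPow a) (L' x) x := by
    intro x hx
    have h1 : HasDerivAt (fun x : ℝ => ∑ ρ ∈ S, (zetaZeroMult ρ : ℂ) * a ρ * (x : ℂ) ^ (ρ : ℂ))
        (L' x) x := by
      rw [hL'eq x hx]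
      refine HasDerivAt.fun_sum fun ρ _ => ?_
      have h2 := (hasDerivAt_ofReal_cpow_const' (r := (ρ : ℂ) - 1) hx.ne' (by
        intro h3
        exact ne_zero_of_mem ρ.2 (by linear_combination h3))).const_mul (ρ : ℂ)
      refine HasDerivAt.const_mul _ ?_
      rw [sub_add_cancel] at h2
      refine h2.congr_of_eventuallyEq (Eventually.of_forall fun y => ?_)
      simp only
      rw [mul_div_cancel₀ _ (ne_zero_of_mem ρ.2)]
    refine h1.congr_of_eventuallyEq ?_
    filter_upwards [Ioi_mem_nhds hx] with y hy using hfin a hS y hy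
  have hcont : ContinuousOn L' (Ioi 0) := by
    refine ContinuousOn.congr (f := fun x : ℝ => ∑ ρ ∈ S, (zetaZeroMult ρ : ℂ) * a ρ *
      ((ρ : ℂ) * (x : ℂ) ^ ((ρ : ℂ) - 1))) ?_ fun x hx => hL'eq x hx
    refine continuousOn_finsetSum _ fun ρ _ => continuousOn_const.mul (continuousOn_const.mul ?_)
    exact fun x hx => (continuousAt_ofReal_cpow_const _ _
      (Or.inr (ne_of_gt hx))).continuousWithinAt
  have hmeas : Measurable L' := by
    have := measurable_zeroPow b
    fun_prop
  refine (lintegral_normSq_shift_sub_le_deriv hX hh hderiv hcont hmeas).trans ?_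
  have h1 := hms X b f hX (hsum b hbS) hf hfs
  have h2 : ∫⁻ x in Icc X (2 * X + h), ENNReal.ofReal (‖L' x‖ ^ 2) ≤
      ENNReal.ofReal ((X ^ 2)⁻¹) * ∫⁻ x in Icc X (4 * X), ENNReal.ofReal (‖zeroPow b x‖ ^ 2) := by
    refine (lintegral_mono_set (Icc_subset_Icc le_rfl
      (show 2 * X + h ≤ 4 * X by linarith))).trans ?_
    rw [← lintegral_const_mul' _ _ ENNReal.ofReal_ne_top]
    refine setLIntegral_mono' measurableSet_Icc fun x hx => ?_
    rw [← ENNReal.ofReal_mul (by positivity)]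
    refine ENNReal.ofReal_le_ofReal ?_
    simp only [hL']
    have hx0 : 0 < x := hX.trans_le hx.1
    rw [norm_mul, mul_pow, norm_inv, Complex.norm_real, Real.norm_of_nonneg hx0.le, inv_pow]
    gcongr
    exact hx.1
  refine (mul_le_mul_right (h2.trans (mul_le_mul_right h1 _)) _).trans (le_of_eq ?_)
  rw [← ENNReal.ofReal_mul (by positivity), ← ENNReal.ofReal_mul (by positivity)]
  congr 1
  field_simp

/-- The difference quotient `((1 + η) ^ (s + 1) - 1) / η`. -/
noncomputable def powDiff (η : ℝ) (s : ℂ) : ℂ := (((1 + η : ℝ) : ℂ) ^ (s + 1) - 1) / η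

/-- Mean value inequality on `[1, 1 + η]`. The uniformity in `η` is what survives the final limit `η
→ 0`. -/
lemma norm_powDiff_le {η : ℝ} (hη : 0 < η) (hη1 : η ≤ 1) {s : ℂ} (hs : 0 ≤ s.re)
    (hs1 : s.re ≤ 1) : ‖powDiff η s‖ ≤ 2 * ‖s + 1‖ := by
  have hs0 : s + 1 ≠ 0 := fun h => by
    have := congrArg re h
    simp at this
    linarith
  have hd : ∀ v ∈ Icc (1 : ℝ) (1 + η), HasDerivWithinAt (fun v : ℝ => (v : ℂ) ^ (s + 1))
      ((s + 1) * (v : ℂ) ^ s) (Icc 1 (1 + η)) v := by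
    intro v hv
    have hv0 : v ≠ 0 := by linarith [hv.1]
    have h2 := (hasDerivAt_ofReal_cpow_const' (r := s) hv0 (by
      intro h3
      exact hs0 (by rw [h3]; ring))).const_mul (s + 1)
    refine HasDerivAt.hasDerivWithinAt (h2.congr_of_eventuallyEq (Eventually.of_forall fun y => ?_))
    simp only
    rw [mul_div_cancel₀ _ hs0]
  have hb : ∀ v ∈ Icc (1 : ℝ) (1 + η), ‖(s + 1) * (v : ℂ) ^ s‖ ≤ 2 * ‖s + 1‖ := by
    intro v hv
    have hv0 : 0 < v := by linarith [hv.1]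
    rw [norm_mul, norm_cpow_eq_rpow_re_of_pos hv0, mul_comm]
    refine mul_le_mul_of_nonneg_right ?_ (norm_nonneg _)
    calc v ^ s.re ≤ v ^ (1 : ℝ) := Real.rpow_le_rpow_of_exponent_le hv.1 hs1
      _ ≤ 2 := by rw [Real.rpow_one]; linarith [hv.2]
  have := (convex_Icc (1 : ℝ) (1 + η)).norm_image_sub_le_of_norm_hasDerivWithin_le hd hb
    (left_mem_Icc.2 (by linarith)) (right_mem_Icc.2 (by linarith))
  rw [add_sub_cancel_left, Real.norm_of_nonneg hη.le, ofReal_one, one_cpow] at this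
  rw [powDiff, norm_div, Complex.norm_real, Real.norm_of_nonneg hη.le, div_le_iff₀ hη]
  exact this

/-- This bound blows up with `1 / η`; it serves only for absolute convergence at fixed `η`. -/
lemma norm_powDiff_le_div {η : ℝ} (hη : 0 < η) (hη1 : η ≤ 1) {s : ℂ}
    (hs1 : s.re ≤ 1) : ‖powDiff η s‖ ≤ 5 / η := by
  rw [powDiff, norm_div, Complex.norm_real, Real.norm_of_nonneg hη.le]
  gcongr
  refine (norm_sub_le _ _).trans ?_
  rw [norm_cpow_eq_rpow_re_of_pos (by linarith), norm_one, add_re, one_re]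
  have : (1 + η) ^ (s.re + 1) ≤ 4 := by
    calc (1 + η) ^ (s.re + 1) ≤ (1 + η) ^ (2 : ℝ) :=
          Real.rpow_le_rpow_of_exponent_le (by linarith) (by linarith)
      _ = (1 + η) ^ 2 := Real.rpow_two _
      _ ≤ 4 := by nlinarith
  linarith

/-- The integral of the regular part over the line `Re s = δ`, differenced. -/
noncomputable def regInt (δ η x : ℝ) : ℂ :=
  ∫ y : ℝ, ((1 : ℝ) : ℂ) * (powDiff η (δ + y * I) * regKernel (δ + y * I)) *
    (x : ℂ) ^ ((δ : ℂ) + y * I)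

lemma continuous_powDiff_vertical {η : ℝ} (hη : 0 < η) (δ : ℝ) :
    Continuous fun y : ℝ => powDiff η (δ + y * I) := by
  unfold powDiff
  refine (Continuous.sub ?_ continuous_const).div_const _
  exact Continuous.const_cpow (by fun_prop) (Or.inl (ofReal_ne_zero.2 (by linarith)))

lemma continuous_regCoef (hRH : RiemannHypothesis) {δ η : ℝ} (hδ : 0 < δ) (hδ1 : δ ≤ 1)
    (hη : 0 < η) :
    Continuous fun y : ℝ => powDiff η (δ + y * I) * regKernel (δ + y * I) :=
  (continuous_powDiff_vertical hη δ).mul (continuous_regKernel_vertical hRH hδ (by linarith))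

lemma measurable_regInt (hRH : RiemannHypothesis) {δ η : ℝ} (hδ : 0 < δ) (hδ1 : δ ≤ 1)
    (hη : 0 < η) : Measurable (regInt δ η) :=
  measurable_powers_integral (τ := fun y : ℝ => y) measurable_id
    (((continuous_regCoef hRH hδ hδ1 hη).measurable).const_mul _) δ

lemma integrable_regCoef (hRH : RiemannHypothesis) {δ η : ℝ} (hδ : 0 < δ) (hδ1 : δ ≤ 1)
    (hη : 0 < η) (hη1 : η ≤ 1) :
    Integrable fun y : ℝ => powDiff η (δ + y * I) * regKernel (δ + y * I) :=
  (integrable_regKernel_vertical hRH hδ (by linarith)).bdd_mul (c := 5 / η)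
    (continuous_powDiff_vertical hη δ).aestronglyMeasurable
    (Eventually.of_forall fun y => norm_powDiff_le_div hη hη1 (by simpa))

/-- The large sieve for Lebesgue measure, whose row sums are one Gaussian integral. `powDiff`
cancels the factor `s + 1` of the kernel, so the coefficients are `O(δ⁻¹ (1 + |y|) ^ (3/8 - 1))`,
and their squares, of exponent `-5/4`, are integrable. -/
theorem exists_lintegral_regInt_le (hRH : RiemannHypothesis) : ∃ C : ℝ, 0 < C ∧
    ∀ δ η X : ℝ, 0 < δ → δ ≤ 1 → 0 < η → η ≤ 1 → 0 < X →
      ∫⁻ x in Icc X (4 * X), ENNReal.ofReal (‖regInt δ η x‖ ^ 2) ≤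
        ENNReal.ofReal (C / δ ^ 2 * X ^ (1 + 2 * δ)) := by
  obtain ⟨C, hC, hK⟩ := exists_regKernel_bound hRH
  set κ := ∫ t : ℝ, Real.exp (-(1 / 4) * t ^ 2) with hκ
  set J := ∫ y : ℝ, (1 + |y|) ^ (-(5 / 4) : ℝ) with hJ
  have hκ0 : 0 ≤ κ := integral_nonneg fun t => (Real.exp_pos _).le
  have hJ0 : 0 ≤ J := integral_nonneg fun y => by positivity
  refine ⟨Real.exp 10 * √Real.pi * (16 * C ^ 2 * J * κ) + 1, by positivity,
    fun δ η X hδ hδ1 hη hη1 hX => ?_⟩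
  have hW : ∀ y : ℝ, ∫⁻ y' : ℝ, ENNReal.ofReal (1 * Real.exp (-(y - y') ^ 2 / 4)) ≤
      ENNReal.ofReal κ := by
    intro y
    rw [lintegral_sub_left_eq_self (fun t => ENNReal.ofReal (1 * Real.exp (-t ^ 2 / 4))) y,
      hκ, ofReal_integral_eq_lintegral_ofReal (integrable_exp_neg_mul_sq (by norm_num))
        (Eventually.of_forall fun t => (Real.exp_pos _).le)]
    refine lintegral_mono fun t => ENNReal.ofReal_le_ofReal (le_of_eq ?_)
    rw [one_mul]
    congr 1
    ring
  have hint := integrable_regCoef hRH hδ hδ1 hη hη1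
  have h1 := lintegral_normSq_powers_le (ν := (volume : Measure ℝ)) (τ := fun y => y)
    measurable_id (q := fun _ => (1 : ℝ)) measurable_const (fun _ => zero_le_one)
    (continuous_regCoef hRH hδ hδ1 hη).measurable (by simpa using hint) hW (σ := δ) hX hδ1
  refine h1.trans ?_
  have h2 : ∀ y : ℝ, ‖powDiff η (δ + y * I) * regKernel (δ + y * I)‖ ^ 2 ≤
      16 * C ^ 2 / δ ^ 2 * (1 + |y|) ^ (-(5 / 4) : ℝ) := by
    intro y
    have hre : (δ + y * I : ℂ).re = δ := by simp
    have him : (δ + y * I : ℂ).im = y := by simp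
    have h3 := (hK δ hδ hδ1 (δ + y * I) hre.ge (by rw [hre]; linarith)).1
    have h4 := one_add_abs_im_le_of_re hδ1 hre.ge
    have h5 := norm_powDiff_le hη hη1 (s := δ + y * I) (by rw [hre]; exact hδ.le)
      (by rw [hre]; exact hδ1)
    rw [him] at h3 h4
    have hy := abs_nonneg y
    set s : ℂ := δ + y * I with hs
    set Y := 1 + |y| with hY
    have hYp : 0 < Y := by positivity
    have hs0 : 0 < ‖s‖ := norm_pos_iff.2 (vertical_ne_zero hδ y)
    have hs1 : 0 < ‖s + 1‖ := norm_pos_iff.2 (vertical_add_one_ne_zero hδ y)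
    have h6 : ‖powDiff η s * regKernel s‖ ≤ 4 * C / δ * (Y ^ (3 / 8 : ℝ) / Y) := by
      rw [norm_mul, regKernel, norm_div, norm_mul]
      calc ‖powDiff η s‖ * (‖regPart s‖ / (‖s‖ * ‖s + 1‖))
          ≤ 2 * ‖s + 1‖ * ((C * Y ^ (3 / 8 : ℝ)) / (‖s‖ * ‖s + 1‖)) := by gcongr
        _ = 2 * C * Y ^ (3 / 8 : ℝ) / ‖s‖ := by field_simp
        _ ≤ 2 * C * Y ^ (3 / 8 : ℝ) / (δ * Y / 2) := by
            gcongr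
            linarith
        _ = _ := by field_simp; norm_num
    have e : (Y ^ (3 / 8 : ℝ) / Y) ^ 2 = Y ^ (-(5 / 4) : ℝ) := by
      rw [← Real.rpow_sub_one hYp.ne', ← Real.rpow_mul_natCast hYp.le]
      norm_num
    calc _ ≤ (4 * C / δ * (Y ^ (3 / 8 : ℝ) / Y)) ^ 2 := pow_le_pow_left₀ (norm_nonneg _) h6 2
      _ = 16 * C ^ 2 / δ ^ 2 * (Y ^ (3 / 8 : ℝ) / Y) ^ 2 := by ring
      _ = _ := by rw [e]
  have h3 : ∫⁻ y : ℝ, ENNReal.ofReal (1 * ‖powDiff η (δ + y * I) * regKernel (δ + y * I)‖ ^ 2) *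
      ENNReal.ofReal κ ≤ ENNReal.ofReal (16 * C ^ 2 / δ ^ 2 * J * κ) := by
    rw [lintegral_mul_const' _ _ ENNReal.ofReal_ne_top,
      ENNReal.ofReal_mul (by positivity : 0 ≤ 16 * C ^ 2 / δ ^ 2 * J)]
    refine mul_le_mul_left ?_ _
    rw [hJ, ← integral_const_mul, ofReal_integral_eq_lintegral_ofReal
      ((integrable_one_add_abs_rpow (by norm_num)).const_mul _)
      (Eventually.of_forall fun y => by positivity)]
    refine lintegral_mono fun y => ENNReal.ofReal_le_ofReal ?_
    rw [one_mul]
    exact h2 y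
  refine (mul_le_mul_right h3 _).trans ?_
  rw [← ENNReal.ofReal_mul (by positivity)]
  refine ENNReal.ofReal_le_ofReal ?_
  have hXp : 0 < X ^ (1 + 2 * δ) := by positivity
  calc _ = Real.exp 10 * √Real.pi * (16 * C ^ 2 * J * κ) / δ ^ 2 * X ^ (1 + 2 * δ) := by ring
    _ ≤ _ := by
      gcongr
      linarith

end GoldbachAverage

/-! ### Mean square of the smoothed remainder and of its increments. -/

namespace GoldbachAverage

open Complex Set Filter Topology Metric MeasureTheory
open scoped ENNReal

/-- The coefficient of `x ^ ρ` in the smoothed explicit formula. -/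
noncomputable def smoothCoef (η : ℝ) (ρ : nontrivialZetaZeros) : ℂ :=
  powDiff η ρ / ((ρ : ℂ) * ((ρ : ℂ) + 1))

lemma norm_smoothCoef_mul_le (hRH : RiemannHypothesis) {η : ℝ} (hη : 0 < η) (hη1 : η ≤ 1)
    (ρ : nontrivialZetaZeros) : ‖smoothCoef η ρ * ρ‖ ≤ 2 := by
  have hre := re_eq_half_of_mem hRH ρ.2
  have h1 := norm_powDiff_le hη hη1 (s := ρ) (by rw [hre]; norm_num) (by rw [hre]; norm_num)
  have h2 := ne_zero_of_mem ρ.2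
  have h3 : 0 < ‖(ρ : ℂ) + 1‖ := norm_pos_iff.2 (add_one_ne_zero_of_mem ρ.2)
  have e : smoothCoef η ρ * ρ = powDiff η ρ / ((ρ : ℂ) + 1) := by
    rw [smoothCoef]
    field_simp
  rw [e, norm_div, div_le_iff₀ h3]
  exact h1

lemma norm_smoothCoef_le (hRH : RiemannHypothesis) {η : ℝ} (hη : 0 < η) (hη1 : η ≤ 1)
    (ρ : nontrivialZetaZeros) : ‖smoothCoef η ρ‖ ≤ 6 / (1 + |(ρ : ℂ).im|) := by
  have h1 := norm_smoothCoef_mul_le hRH hη hη1 ρ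
  have h2 := one_add_abs_im_le hRH ρ.2
  rw [norm_mul] at h1
  have h3 := abs_nonneg (ρ : ℂ).im
  rw [le_div_iff₀ (by positivity)]
  nlinarith [norm_nonneg (smoothCoef η ρ)]

lemma summable_smoothCoef (hRH : RiemannHypothesis) {η : ℝ} (hη : 0 < η) (hη1 : η ≤ 1) :
    Summable fun ρ : nontrivialZetaZeros => (zetaZeroMult ρ : ℝ) * ‖smoothCoef η ρ‖ := by
  refine Summable.of_nonneg_of_le (fun ρ => by positivity) (fun ρ => ?_)
    ((summable_norm_zeroCoef hRH).mul_left (5 / η))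
  have hre := re_eq_half_of_mem hRH ρ.2
  have h1 := norm_powDiff_le_div hη hη1 (s := ρ) (by rw [hre]; norm_num)
  rw [smoothCoef, zeroCoef, norm_div, norm_div, Complex.norm_natCast, div_eq_mul_inv,
    div_eq_mul_inv (zetaZeroMult (ρ : ℂ) : ℝ)]
  have h2 : 0 ≤ (zetaZeroMult (ρ : ℂ) : ℝ) * ‖(ρ : ℂ) * ((ρ : ℂ) + 1)‖⁻¹ := by positivity
  calc _ = ‖powDiff η ρ‖ * ((zetaZeroMult (ρ : ℂ) : ℝ) * ‖(ρ : ℂ) * ((ρ : ℂ) + 1)‖⁻¹) := by ring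
    _ ≤ _ := by gcongr

/-- The smoothed remainder of the prime number theorem. -/
noncomputable def smoothQuot (η x : ℝ) : ℝ :=
  (smoothPsi (x * (1 + η)) - smoothPsi x) / (η * x) - x - η * x / 2

lemma hasSum_zeroPrim (hRH : RiemannHypothesis) (x : ℝ) :
    Summable fun ρ : nontrivialZetaZeros => zeroPrim ρ x :=
  Summable.of_norm_bounded ((summable_norm_zeroCoef hRH).mul_right _)
    fun ρ => norm_zeroPrim_le hRH ρ.2 x

/-- Difference the formula for `smoothErr` between `x` and `x (1 + η)` and divide by `η x`: the
multiplicative step turns each power `x ^ (s + 1)` into `powDiff η s * x ^ s`. The `-1` arises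
because the polar term is `(x - 1)² / 2` and not `x² / 2`. -/
theorem smoothQuot_eq (hRH : RiemannHypothesis) {δ η x : ℝ} (hδ : 0 < δ) (hδ1 : δ ≤ 1)
    (hη : 0 < η) (hη1 : η ≤ 1) (hx : 1 ≤ x) :
    (smoothQuot η x : ℂ) =
      (1 / (2 * Real.pi)) * regInt δ η x - zeroPow (smoothCoef η) x - 1 := by
  have hx0 : 0 < x := by linarith
  have hxc : (x : ℂ) ≠ 0 := ofReal_ne_zero.2 hx0.ne'
  have hηc : (η : ℂ) ≠ 0 := ofReal_ne_zero.2 hη.ne'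
  have hη' : 0 < 1 + η := by linarith
  set x' := x * (1 + η) with hx'
  have hx'1 : 1 ≤ x' := by rw [hx']; nlinarith
  have hx'0 : 0 < x' := by linarith
  have hpow : ∀ s : ℂ, (x' : ℂ) ^ (s + 1) - (x : ℂ) ^ (s + 1) =
      η * x * (powDiff η s * (x : ℂ) ^ s) := by
    intro s
    rw [hx', ofReal_mul, mul_cpow_ofReal_nonneg hx0.le hη'.le, cpow_add s 1 hxc, cpow_one, powDiff]
    field_simp
  have h1 : smoothErr x' - smoothErr x = (1 / (2 * Real.pi)) * (η * x * regInt δ η x) := by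
    rw [smoothErr_eq_integral hRH hδ hδ1 hx0, smoothErr_eq_integral hRH hδ hδ1 hx'0, ← mul_sub,
      ← integral_sub (integrable_cpow_mul_regKernel hRH hδ (by linarith) hx'0)
        (integrable_cpow_mul_regKernel hRH hδ (by linarith) hx0), regInt, ← integral_const_mul,
      ← integral_const_mul, ← integral_const_mul]
    refine integral_congr_ae (Eventually.of_forall fun y => ?_)
    simp only
    rw [← sub_mul, hpow]
    push_cast
    ring
  have h2 : ∑' ρ : nontrivialZetaZeros, zeroPrim ρ x' - ∑' ρ : nontrivialZetaZeros, zeroPrim ρ x =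
      η * x * zeroPow (smoothCoef η) x := by
    rw [← (hasSum_zeroPrim hRH x').tsum_sub (hasSum_zeroPrim hRH x),
      ← (hasSum_zeroPow hRH (summable_smoothCoef hRH hη hη1) hx0).tsum_eq, ← tsum_mul_left]
    refine tsum_congr fun ρ => ?_
    rw [zeroPrim, zeroPrim, max_eq_left hx'1, max_eq_left hx, ← mul_sub, sub_sub_sub_cancel_right,
      hpow, smoothCoef, zeroCoef]
    ring
  have h3 : smoothErr x' - smoothErr x = ((smoothPsi x' - smoothPsi x : ℝ) : ℂ) -
      (((x' - 1) ^ 2 / 2 - (x - 1) ^ 2 / 2 : ℝ) : ℂ) + η * x * zeroPow (smoothCoef η) x := by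
    rw [← h2, smoothErr, smoothErr, max_eq_left hx'1, max_eq_left hx]
    push_cast
    ring
  have h4 : (((x' - 1) ^ 2 / 2 - (x - 1) ^ 2 / 2 : ℝ) : ℂ) =
      η * x * (x + η * x / 2 - 1) := by
    rw [hx']
    push_cast
    ring
  have h5 : (smoothQuot η x : ℂ) * (η * x) = ((smoothPsi x' - smoothPsi x : ℝ) : ℂ) -
      (x + η * x / 2) * (η * x) := by
    rw [smoothQuot]
    push_cast
    field_simp
    ring
  have h6 : ((η : ℂ) * x) ≠ 0 := mul_ne_zero hηc hxc
  refine mul_right_cancel₀ h6 ?_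
  rw [h5]
  rw [h1, h4] at h3
  linear_combination -h3

lemma ofReal_normSq_add₃_le (u v w : ℂ) : ENNReal.ofReal (‖u + v + w‖ ^ 2) ≤
    3 * (ENNReal.ofReal (‖u‖ ^ 2) + ENNReal.ofReal (‖v‖ ^ 2) + ENNReal.ofReal (‖w‖ ^ 2)) := by
  rw [show (3 : ℝ≥0∞) = ENNReal.ofReal 3 by norm_num,
    ← ENNReal.ofReal_add (by positivity) (by positivity),
    ← ENNReal.ofReal_add (by positivity) (by positivity), ← ENNReal.ofReal_mul (by norm_num)]
  refine ENNReal.ofReal_le_ofReal ?_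
  have h1 : ‖u + v + w‖ ≤ ‖u‖ + ‖v‖ + ‖w‖ := norm_add₃_le
  have h2 := pow_le_pow_left₀ (norm_nonneg _) h1 2
  nlinarith [sq_nonneg (‖u‖ - ‖v‖), sq_nonneg (‖u‖ - ‖w‖), sq_nonneg (‖v‖ - ‖w‖)]

lemma lintegral_normSq_add₃_le {u v w : ℝ → ℂ} (hv : Measurable v) (hw : Measurable w) (s : Set ℝ) :
    ∫⁻ x in s, ENNReal.ofReal (‖u x + v x + w x‖ ^ 2) ≤
      3 * ((∫⁻ x in s, ENNReal.ofReal (‖u x‖ ^ 2)) + (∫⁻ x in s, ENNReal.ofReal (‖v x‖ ^ 2)) +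
        ∫⁻ x in s, ENNReal.ofReal (‖w x‖ ^ 2)) := by
  refine (lintegral_mono fun x => ofReal_normSq_add₃_le (u x) (v x) (w x)).trans ?_
  rw [lintegral_const_mul' _ _ (by norm_num), lintegral_add_right _ (by fun_prop),
    lintegral_add_right _ (by fun_prop)]

lemma norm_inv_two_pi_le : ‖(1 / (2 * Real.pi) : ℂ)‖ ≤ 1 := by
  have := Real.pi_gt_three
  rw [norm_div, norm_one, norm_mul, Complex.norm_real, Real.norm_of_nonneg Real.pi_pos.le,
    Complex.norm_ofNat, div_le_one (by positivity)]
  linarith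

lemma half_le_log {N : ℝ} (hN : 2 ≤ N) : 1 / 2 ≤ Real.log N := by
  have : Real.log 2 ≤ Real.log N := Real.log_le_log (by norm_num) hN
  linarith [Real.log_two_gt_d9]

lemma rpow_inv_log_le {N X : ℝ} (hN : 2 ≤ N) (hX : 0 < X) (hXN : X ≤ N) :
    X ^ (1 / Real.log N) ≤ 3 := by
  have hl := half_le_log hN
  calc X ^ (1 / Real.log N) ≤ N ^ (1 / Real.log N) :=
        Real.rpow_le_rpow hX.le hXN (by positivity)
    _ = Real.exp 1 := by
        rw [Real.rpow_def_of_pos (by linarith), mul_one_div_cancel (by positivity)]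
    _ ≤ 3 := Real.exp_one_lt_three.le

/-- Mean square of the regular part at height `X ≤ N`. -/
theorem exists_lintegral_reg_le (hRH : RiemannHypothesis) : ∃ C : ℝ, 0 < C ∧
    ∀ η X N : ℝ, 0 < η → η ≤ 1 → 1 ≤ X → X ≤ N → 2 ≤ N →
      ∫⁻ x in Icc X (4 * X), ENNReal.ofReal
          (‖(1 / (2 * Real.pi) : ℂ) * regInt (1 / (2 * Real.log N)) η x‖ ^ 2) ≤
        ENNReal.ofReal (C * X * Real.log N ^ 2) := by
  obtain ⟨C, hC, h⟩ := exists_lintegral_regInt_le hRH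
  -- With `δ = 1 / (2 log N)` one has `X ^ (2 δ) ≤ e ≤ 3` and `1 / δ ^ 2 = 4 (log N) ^ 2`, whence
  -- `12`.
  refine ⟨12 * C, by positivity, fun η X N hη hη1 hX hXN hN => ?_⟩
  have hl := half_le_log hN
  have hδ : 0 < 1 / (2 * Real.log N) := by positivity
  have hδ1 : 1 / (2 * Real.log N) ≤ 1 := by
    rw [div_le_one (by positivity)]
    linarith
  have h1 : ∀ x, ENNReal.ofReal
      (‖(1 / (2 * Real.pi) : ℂ) * regInt (1 / (2 * Real.log N)) η x‖ ^ 2) ≤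
      ENNReal.ofReal (‖regInt (1 / (2 * Real.log N)) η x‖ ^ 2) := fun x => by
    refine ENNReal.ofReal_le_ofReal (pow_le_pow_left₀ (norm_nonneg _) ?_ 2)
    rw [norm_mul]
    exact mul_le_of_le_one_left (norm_nonneg _) norm_inv_two_pi_le
  refine (lintegral_mono h1).trans ((h _ η X hδ hδ1 hη hη1 (by linarith)).trans ?_)
  refine ENNReal.ofReal_le_ofReal ?_
  have h2 := rpow_inv_log_le hN (by linarith) hXN
  have e : X ^ (1 + 2 * (1 / (2 * Real.log N))) = X * X ^ (1 / Real.log N) := by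
    rw [Real.rpow_add (by linarith), Real.rpow_one]
    congr 2
    field_simp
  rw [e]
  calc C / (1 / (2 * Real.log N)) ^ 2 * (X * X ^ (1 / Real.log N))
      ≤ C / (1 / (2 * Real.log N)) ^ 2 * (X * 3) := by gcongr
    _ = _ := by field_simp; norm_num

/-- The coefficients are `O(1 / (1 + |γ|))` for the ordinate `γ` of the zero, uniformly in `η`, so
the diagonal sum is the case `T = 1` of `exists_sum_logWt_le`. -/
theorem exists_lintegral_smoothQuot_le (hRH : RiemannHypothesis) : ∃ C : ℝ, 0 < C ∧
    ∀ η X N : ℝ, 0 < η → η ≤ 1 → 1 ≤ X → X ≤ N → 2 ≤ N →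
      ∫⁻ x in Icc X (4 * X), ENNReal.ofReal (smoothQuot η x ^ 2) ≤
        ENNReal.ofReal (C * X ^ 2 * Real.log N ^ 2) := by
  obtain ⟨C₁, hC₁, h₁⟩ := exists_lintegral_reg_le hRH
  obtain ⟨C₂, hC₂, h₂⟩ := exists_lintegral_zeroPow_le hRH
  obtain ⟨A, hA, hsum⟩ := exists_sum_logWt_le hRH
  obtain ⟨hs, hs'⟩ := hsum 1 le_rfl
  refine ⟨3 * (C₁ + C₂ * (36 * (A * (1 * logWt 1 ^ 2))) * 4 + 12), by positivity,
    fun η X N hη hη1 hX hXN hN => ?_⟩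
  have hl := half_le_log hN
  have hδ : 0 < 1 / (2 * Real.log N) := by positivity
  have hδ1 : 1 / (2 * Real.log N) ≤ 1 := by
    rw [div_le_one (by positivity)]
    linarith
  set c : ℂ := 1 / (2 * Real.pi)
  have e1 : ∀ x ∈ Icc X (4 * X), ENNReal.ofReal (smoothQuot η x ^ 2) =
      ENNReal.ofReal (‖c * regInt (1 / (2 * Real.log N)) η x +
        -zeroPow (smoothCoef η) x + (-1)‖ ^ 2) := fun x hx => by
    rw [← sub_eq_add_neg, ← sub_eq_add_neg, ← smoothQuot_eq hRH hδ hδ1 hη hη1 (hX.trans hx.1),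
      Complex.norm_real, Real.norm_eq_abs, sq_abs]
  rw [setLIntegral_congr_fun measurableSet_Icc e1]
  refine (lintegral_normSq_add₃_le (measurable_zeroPow _).neg measurable_const _).trans ?_
  simp only [Pi.neg_apply, norm_neg, norm_one, one_pow, ENNReal.ofReal_one]
  have hz := h₂ X (smoothCoef η) (fun ρ => 36 * (logWt (ρ : ℂ).im / (1 + |(ρ : ℂ).im| / 1) ^ 2))
    (by linarith) (summable_smoothCoef hRH hη hη1) (fun ρ => by
      have h3 := norm_smoothCoef_le hRH hη hη1 ρ
      have h4 := pow_le_pow_left₀ (norm_nonneg _) h3 2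
      calc _ ≤ (6 / (1 + |(ρ : ℂ).im|)) ^ 2 * logWt (ρ : ℂ).im :=
            mul_le_mul_of_nonneg_right h4 (logWt_pos _).le
        _ = _ := by rw [div_pow, div_one]; ring)
    ((hs.mul_left 36).congr fun ρ => by ring)
  have hz' : ∑' ρ : nontrivialZetaZeros, (zetaZeroMult (ρ : ℂ) : ℝ) *
      (36 * (logWt (ρ : ℂ).im / (1 + |(ρ : ℂ).im| / 1) ^ 2)) ≤ 36 * (A * (1 * logWt 1 ^ 2)) := by
    rw [← mul_le_mul_iff_right₀ (by norm_num : (0 : ℝ) < 36), ← tsum_mul_left] at hs'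
    refine le_trans (le_of_eq (tsum_congr fun ρ => by ring)) hs'
  have hone : ∫⁻ _ in Icc X (4 * X), (1 : ℝ≥0∞) = ENNReal.ofReal (3 * X) := by
    rw [setLIntegral_const, Real.volume_Icc, one_mul]
    congr 1
    ring
  refine (mul_le_mul_right (add_le_add (add_le_add (h₁ η X N hη hη1 hX hXN hN) hz)
    hone.le) 3).trans ?_
  have hX0 : 0 < X := by linarith
  have hS0 : 0 ≤ ∑' ρ : nontrivialZetaZeros, (zetaZeroMult (ρ : ℂ) : ℝ) *
      (36 * (logWt (ρ : ℂ).im / (1 + |(ρ : ℂ).im| / 1) ^ 2)) := tsum_nonneg fun ρ => by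
    have := logWt_pos (ρ : ℂ).im
    positivity
  rw [show (3 : ℝ≥0∞) = ENNReal.ofReal 3 by norm_num,
    ← ENNReal.ofReal_add (by positivity) (by positivity),
    ← ENNReal.ofReal_add (by positivity) (by positivity), ← ENNReal.ofReal_mul (by norm_num)]
  refine ENNReal.ofReal_le_ofReal ?_
  set S := ∑' ρ : nontrivialZetaZeros, (zetaZeroMult (ρ : ℂ) : ℝ) *
      (36 * (logWt (ρ : ℂ).im / (1 + |(ρ : ℂ).im| / 1) ^ 2))
  set B := 36 * (A * (1 * logWt 1 ^ 2))
  have hL : 1 ≤ 4 * Real.log N ^ 2 := by nlinarith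
  have hXX : X ≤ X ^ 2 := by nlinarith
  have i1 : C₁ * X * Real.log N ^ 2 ≤ C₁ * X ^ 2 * Real.log N ^ 2 := by gcongr
  have i2 : C₂ * X ^ 2 * S ≤ C₂ * X ^ 2 * B * (4 * Real.log N ^ 2) := by
    calc C₂ * X ^ 2 * S ≤ C₂ * X ^ 2 * B := by gcongr
      _ ≤ _ := le_mul_of_one_le_right (by positivity) hL
  have i3 : 3 * X ≤ 3 * X ^ 2 * (4 * Real.log N ^ 2) := by
    calc 3 * X ≤ 3 * X ^ 2 := by gcongr
      _ ≤ _ := le_mul_of_one_le_right (by positivity) hL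
  linarith

lemma finite_zeros_abs_im_le (T : ℝ) : {ρ : nontrivialZetaZeros | |(ρ : ℂ).im| ≤ T}.Finite := by
  refine ((finite_zeros_inter_closedBall 0 (T + 1)).preimage
    Subtype.val_injective.injOn).subset fun ρ hρ => ⟨ρ.2, ?_⟩
  rw [mem_closedBall, dist_zero_right]
  have h1 := Complex.norm_le_abs_re_add_abs_im (ρ : ℂ)
  have h2 := ρ.2.2
  have h3 : |(ρ : ℂ).im| ≤ T := hρ
  rw [abs_of_pos h2.1] at h1
  linarith

lemma logWt_le_two_mul_log {T N : ℝ} (hT : 0 ≤ T) (hTN : T ≤ N) (hN : 2 ≤ N) :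
    logWt T ≤ 2 * Real.log N := by
  rw [logWt, abs_of_nonneg hT, show 2 * Real.log N = Real.log (N ^ 2) by
    rw [Real.log_pow]; norm_num]
  exact Real.log_le_log (by linarith) (by nlinarith)

/-- The zeros are split at `T = X / h`, where the derivative bound and the trivial bound balance:
the low zeros give `h² T (log N)²` and the high ones `X² T⁻¹ (log N)²`, both equal to `h X (log
N)²`. The regular part needs no saving since `h ≥ 1`. -/
theorem exists_lintegral_smoothQuot_shift_le (hRH : RiemannHypothesis) : ∃ C : ℝ, 0 < C ∧
    ∀ η X N h : ℝ, 0 < η → η ≤ 1 → 1 ≤ h → h ≤ X → X ≤ N → 2 ≤ N →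
      ∫⁻ x in Icc X (2 * X), ENNReal.ofReal ((smoothQuot η (x + h) - smoothQuot η x) ^ 2) ≤
        ENNReal.ofReal (C * h * X * Real.log N ^ 2) := by
  obtain ⟨C₁, hC₁, h₁⟩ := exists_lintegral_reg_le hRH
  obtain ⟨C₂, hC₂, h₂⟩ := exists_lintegral_zeroPow_le hRH
  obtain ⟨C₃, hC₃, h₃⟩ := exists_lintegral_zeroPow_shift_le hRH
  obtain ⟨A, hA, hsum⟩ := exists_sum_logWt_le hRH
  refine ⟨3 * (4 * C₁ + C₃ * 64 * A + 4 * (C₂ * 576 * A)), by positivity,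
    fun η X N h hη hη1 hh hhX hXN hN => ?_⟩
  have hX : 1 ≤ X := hh.trans hhX
  have hX0 : 0 < X := by linarith
  have hh0 : 0 < h := by linarith
  have hl := half_le_log hN
  have hδ : 0 < 1 / (2 * Real.log N) := by positivity
  have hδ1 : 1 / (2 * Real.log N) ≤ 1 := by
    rw [div_le_one (by positivity)]
    linarith
  set T := X / h with hT
  have hT1 : 1 ≤ T := (one_le_div hh0).2 hhX
  have hT0 : 0 < T := by linarith
  have hTN : T ≤ N := (div_le_self hX0.le hh).trans hXN
  obtain ⟨hs, hs'⟩ := hsum T hT1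
  have hlT := logWt_le_two_mul_log hT0.le hTN hN
  have hlT2 : logWt T ^ 2 ≤ 4 * Real.log N ^ 2 := by
    have := pow_le_pow_left₀ (logWt_pos T).le hlT 2
    linarith
  classical
  set S := (finite_zeros_abs_im_le T).toFinset with hS
  have hmemS : ∀ ρ, ρ ∈ S ↔ |(ρ : ℂ).im| ≤ T := fun ρ => by simp [hS]
  set a : nontrivialZetaZeros → ℂ := fun ρ => if ρ ∈ S then smoothCoef η ρ else 0 with ha
  set b : nontrivialZetaZeros → ℂ := fun ρ => if ρ ∈ S then 0 else smoothCoef η ρ with hb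
  set w : nontrivialZetaZeros → ℝ := fun ρ => logWt (ρ : ℂ).im / (1 + |(ρ : ℂ).im| / T) ^ 2 with hw
  have hw0 : ∀ ρ, 0 ≤ w ρ := fun ρ => by
    have := logWt_pos (ρ : ℂ).im
    positivity
  have hsc := summable_smoothCoef hRH hη hη1
  have hna : ∀ ρ, ‖a ρ‖ ≤ ‖smoothCoef η ρ‖ := fun ρ => by
    simp only [ha]
    split_ifs <;> simp
  have hnb : ∀ ρ, ‖b ρ‖ ≤ ‖smoothCoef η ρ‖ := fun ρ => by
    simp only [hb]
    split_ifs <;> simp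
  have hsa : Summable fun ρ : nontrivialZetaZeros => (zetaZeroMult ρ : ℝ) * ‖a ρ‖ :=
    Summable.of_nonneg_of_le (fun ρ => by positivity)
      (fun ρ => mul_le_mul_of_nonneg_left (hna ρ) (Nat.cast_nonneg _)) hsc
  have hsb : Summable fun ρ : nontrivialZetaZeros => (zetaZeroMult ρ : ℝ) * ‖b ρ‖ :=
    Summable.of_nonneg_of_le (fun ρ => by positivity)
      (fun ρ => mul_le_mul_of_nonneg_left (hnb ρ) (Nat.cast_nonneg _)) hsc
  have hsplit : ∀ x : ℝ, 0 < x → zeroPow (smoothCoef η) x = zeroPow a x + zeroPow b x := by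
    intro x hx
    rw [← zeroPow_add hsa hsb hx]
    congr 1
    funext ρ
    simp only [ha, hb]
    split_ifs <;> simp
  have hlow := h₃ X h S a (fun ρ => 16 * w ρ) hX0 hh0 hhX
    (fun ρ hρ => by simp only [ha, if_neg hρ])
    (fun ρ => by
      simp only [ha]
      split_ifs with hρ
      · have h4 := norm_smoothCoef_mul_le hRH hη hη1 ρ
        have h5 := pow_le_pow_left₀ (norm_nonneg _) h4 2
        have h6 : |(ρ : ℂ).im| / T ≤ 1 := (div_le_one hT0).2 ((hmemS ρ).1 hρ)
        have h7 : (1 + |(ρ : ℂ).im| / T) ^ 2 ≤ 2 ^ 2 :=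
          pow_le_pow_left₀ (by positivity) (by linarith) 2
        have hlw := logWt_pos (ρ : ℂ).im
        have h8 : logWt (ρ : ℂ).im ≤ 4 * w ρ := by
          simp only [hw]
          rw [mul_div_assoc', le_div_iff₀ (by positivity)]
          nlinarith
        nlinarith
      · simpa using hw0 ρ)
    ((hs.mul_left 16).congr fun ρ => by simp only [hw]; ring)
  have hhigh := h₂ X b (fun ρ => 144 / T ^ 2 * w ρ) hX0 hsb
    (fun ρ => by
      have hlw := logWt_pos (ρ : ℂ).im
      simp only [hb]
      split_ifs with hρ
      · have := hw0 ρ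
        simp only [norm_zero, ne_eq, OfNat.ofNat_ne_zero, not_false_eq_true, zero_pow, zero_mul]
        positivity
      · have h4 := norm_smoothCoef_le hRH hη hη1 ρ
        have h5 := pow_le_pow_left₀ (norm_nonneg _) h4 2
        have h6 : T < |(ρ : ℂ).im| := by
          rw [hmemS, not_le] at hρ
          exact hρ
        set γ := |(ρ : ℂ).im|
        have hγ : 0 ≤ γ := by linarith
        -- For `γ > T` one has `1 + γ ≥ (T + γ) / 2`, so `36 / (1 + γ)²` is at most `144 / (T +
        -- γ)²`.
        have e : 144 / T ^ 2 * w ρ = 36 / ((T + γ) / 2) ^ 2 * logWt (ρ : ℂ).im := by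
          simp only [hw]
          have : 1 + γ / T = (T + γ) / T := by field_simp
          rw [this]
          field_simp
          norm_num
        rw [e]
        refine mul_le_mul_of_nonneg_right (h5.trans ?_) hlw.le
        rw [div_pow]
        norm_num
        gcongr
        linarith)
    ((hs.mul_left (144 / T ^ 2)).congr fun ρ => by simp only [hw]; ring)
  have hlow' : ∑' ρ : nontrivialZetaZeros, (zetaZeroMult (ρ : ℂ) : ℝ) * (16 * w ρ) ≤
      16 * (A * (T * logWt T ^ 2)) := by
    rw [← mul_le_mul_iff_right₀ (by norm_num : (0 : ℝ) < 16), ← tsum_mul_left] at hs'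
    exact le_trans (le_of_eq (tsum_congr fun ρ => by simp only [hw]; ring)) hs'
  have hhigh' : ∑' ρ : nontrivialZetaZeros, (zetaZeroMult (ρ : ℂ) : ℝ) * (144 / T ^ 2 * w ρ) ≤
      144 / T ^ 2 * (A * (T * logWt T ^ 2)) := by
    rw [← mul_le_mul_iff_right₀ (by positivity : (0 : ℝ) < 144 / T ^ 2), ← tsum_mul_left] at hs'
    exact le_trans (le_of_eq (tsum_congr fun ρ => by simp only [hw]; ring)) hs'
  set c : ℂ := 1 / (2 * Real.pi)
  set G : ℝ → ℂ := fun x => c * regInt (1 / (2 * Real.log N)) η x with hG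
  have hGm : Measurable G := (measurable_regInt hRH hδ hδ1 hη).const_mul c
  have ham := measurable_zeroPow a
  have hbm := measurable_zeroPow b
  have e1 : ∀ x ∈ Icc X (2 * X), ENNReal.ofReal ((smoothQuot η (x + h) - smoothQuot η x) ^ 2) =
      ENNReal.ofReal (‖(G (x + h) - G x) + -(zeroPow a (x + h) - zeroPow a x) +
        -(zeroPow b (x + h) - zeroPow b x)‖ ^ 2) := fun x hx => by
    have hx1 : 1 ≤ x := hX.trans hx.1
    rw [← sq_abs, ← Real.norm_eq_abs, ← Complex.norm_real, ofReal_sub,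
      smoothQuot_eq hRH hδ hδ1 hη hη1 hx1, smoothQuot_eq hRH hδ hδ1 hη hη1 (by linarith),
      hsplit x (by linarith), hsplit (x + h) (by linarith)]
    congr 3
    ring
  rw [setLIntegral_congr_fun measurableSet_Icc e1]
  refine (lintegral_normSq_add₃_le (by fun_prop) (by fun_prop) _).trans ?_
  simp only [norm_neg]
  have k1 := (lintegral_normSq_shift_sub_le hGm hh0.le hhX).trans
    (mul_le_mul_right (h₁ η X N hη hη1 hX hXN hN) 4)
  have k2 := hlow.trans (ENNReal.ofReal_le_ofReal
    (mul_le_mul_of_nonneg_left hlow' (by positivity : 0 ≤ C₃ * h ^ 2)))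
  have k3 := (lintegral_normSq_shift_sub_le hbm hh0.le hhX).trans
    (mul_le_mul_right (hhigh.trans (ENNReal.ofReal_le_ofReal
      (mul_le_mul_of_nonneg_left hhigh' (by positivity : 0 ≤ C₂ * X ^ 2)))) 4)
  refine (mul_le_mul_right (add_le_add (add_le_add k1 k2) k3) 3).trans ?_
  rw [show (3 : ℝ≥0∞) = ENNReal.ofReal 3 by norm_num,
    show (4 : ℝ≥0∞) = ENNReal.ofReal 4 by norm_num,
    ← ENNReal.ofReal_mul (by norm_num), ← ENNReal.ofReal_mul (by norm_num),
    ← ENNReal.ofReal_add (by positivity) (by positivity),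
    ← ENNReal.ofReal_add (by positivity) (by positivity), ← ENNReal.ofReal_mul (by norm_num)]
  refine ENNReal.ofReal_le_ofReal ?_
  have j1 : C₁ * X * Real.log N ^ 2 ≤ C₁ * (h * X) * Real.log N ^ 2 := by
    gcongr
    nlinarith
  have j2 : C₃ * h ^ 2 * (16 * (A * (T * logWt T ^ 2))) ≤
      C₃ * 64 * A * (h * X) * Real.log N ^ 2 := by
    calc C₃ * h ^ 2 * (16 * (A * (T * logWt T ^ 2)))
        ≤ C₃ * h ^ 2 * (16 * (A * (T * (4 * Real.log N ^ 2)))) := by gcongr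
      _ = _ := by rw [hT]; field_simp; norm_num
  have j3 : C₂ * X ^ 2 * (144 / T ^ 2 * (A * (T * logWt T ^ 2))) ≤
      C₂ * 576 * A * (h * X) * Real.log N ^ 2 := by
    calc C₂ * X ^ 2 * (144 / T ^ 2 * (A * (T * logWt T ^ 2)))
        ≤ C₂ * X ^ 2 * (144 / T ^ 2 * (A * (T * (4 * Real.log N ^ 2)))) := by gcongr
      _ = _ := by rw [hT]; field_simp; norm_num
  linarith

end GoldbachAverage

/-! ### Removal of the smoothing, passage to integers, and assembly. -/

namespace GoldbachAverage

open Complex Set Filter Topology Metric MeasureTheory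
open scoped ENNReal

/-- The remainder `ψ(x) - x`. -/
noncomputable def psiRem (x : ℝ) : ℝ := psiErr ⌊x⌋₊ + ⌊x⌋₊ - x

lemma sum_range_vonMangoldt (n : ℕ) :
    ∑ m ∈ Finset.range (n + 1), ArithmeticFunction.vonMangoldt m = psiErr n + n := by
  rw [psiErr, Finset.sum_sub_distrib, Finset.range_eq_Ico, Finset.sum_eq_sum_Ico_succ_bot (by omega)]
  simp
  rfl

/-- Between consecutive integers `smoothPsi` is affine with slope `ψ(x)`. Once `x (1 + η) < ⌊x⌋ + 1`
the quotient is exactly `ψ(x) - x - η x / 2`. -/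
lemma tendsto_smoothQuot {x : ℝ} (hx : 0 < x) :
    Tendsto (fun k : ℕ => smoothQuot (1 / ((k : ℝ) + 1)) x) atTop (𝓝 (psiRem x)) := by
  have h0 : Tendsto (fun k : ℕ => 1 / ((k : ℝ) + 1)) atTop (𝓝 0) :=
    tendsto_one_div_add_atTop_nhds_zero_nat
  have hlt : x < ⌊x⌋₊ + 1 := Nat.lt_floor_add_one x
  have h1 : ∀ᶠ k : ℕ in atTop, x * (1 + 1 / ((k : ℝ) + 1)) < ⌊x⌋₊ + 1 := by
    have : Tendsto (fun k : ℕ => x * (1 + 1 / ((k : ℝ) + 1))) atTop (𝓝 (x * (1 + 0))) :=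
      (h0.const_add 1).const_mul x
    rw [add_zero, mul_one] at this
    exact this.eventually (gt_mem_nhds hlt)
  have h2 : Tendsto (fun k : ℕ => psiRem x - 1 / ((k : ℝ) + 1) * x / 2) atTop (𝓝 (psiRem x)) := by
    have := ((h0.mul_const x).div_const 2).const_sub (psiRem x)
    simpa using this
  refine h2.congr' ?_
  filter_upwards [h1] with k hk
  have hη : 0 < 1 / ((k : ℝ) + 1) := by positivity
  set η := 1 / ((k : ℝ) + 1)
  have e1 : smoothPsi (x * (1 + η)) - smoothPsi x = (psiErr ⌊x⌋₊ + ⌊x⌋₊) * (η * x) := by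
    rw [smoothPsi_eq_sum (M := ⌊x⌋₊ + 1) (by push_cast; exact hk.le),
      smoothPsi_eq_sum (M := ⌊x⌋₊ + 1) (by push_cast; exact hlt.le), ← Finset.sum_sub_distrib,
      ← sum_range_vonMangoldt, Finset.sum_mul]
    refine Finset.sum_congr rfl fun n hn => ?_
    have hn' : (n : ℝ) ≤ x :=
      (Nat.le_floor_iff hx.le).1 (Nat.lt_succ_iff.1 (Finset.mem_range.1 hn))
    have : 0 < x * η := by positivity
    rw [max_eq_left (by linarith), max_eq_left (by linarith)]
    ring
  rw [smoothQuot, e1, mul_div_cancel_right₀ _ (by positivity), psiRem]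

lemma measurable_smoothQuot (η : ℝ) : Measurable (smoothQuot η) := by
  have := continuous_smoothPsi.measurable
  unfold smoothQuot
  fun_prop

lemma lintegral_le_of_tendsto_of_le {f : ℕ → ℝ → ℝ≥0∞} {g : ℝ → ℝ≥0∞} {s : Set ℝ} {B : ℝ≥0∞}
    (hs : MeasurableSet s) (hf : ∀ k, Measurable (f k))
    (hlim : ∀ x ∈ s, Tendsto (fun k => f k x) atTop (𝓝 (g x)))
    (hB : ∀ k, ∫⁻ x in s, f k x ≤ B) : ∫⁻ x in s, g x ≤ B := by
  rw [setLIntegral_congr_fun hs fun x hx => (hlim x hx).liminf_eq.symm]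
  refine (lintegral_liminf_le hf).trans ?_
  refine (liminf_le_liminf (Eventually.of_forall hB)).trans ?_
  simp

/-- The smoothed bounds are uniform in `η`, so Fatou's lemma along `η = 1 / (k + 1)` passes them to
`ψ(x) - x`. -/
theorem exists_lintegral_psiRem_le (hRH : RiemannHypothesis) : ∃ C : ℝ, 0 < C ∧
    (∀ X N : ℝ, 1 ≤ X → X ≤ N → 2 ≤ N →
      ∫⁻ x in Icc X (2 * X), ENNReal.ofReal (psiRem x ^ 2) ≤
        ENNReal.ofReal (C * X ^ 2 * Real.log N ^ 2)) ∧
    ∀ X N h : ℝ, 1 ≤ h → h ≤ X → X ≤ N → 2 ≤ N →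
      ∫⁻ x in Icc X (2 * X), ENNReal.ofReal ((psiRem (x + h) - psiRem x) ^ 2) ≤
        ENNReal.ofReal (C * h * X * Real.log N ^ 2) := by
  obtain ⟨C₁, hC₁, h₁⟩ := exists_lintegral_smoothQuot_le hRH
  obtain ⟨C₂, hC₂, h₂⟩ := exists_lintegral_smoothQuot_shift_le hRH
  have hη0 : ∀ k : ℕ, 0 < 1 / ((k : ℝ) + 1) := fun k => by positivity
  have hη1 : ∀ k : ℕ, 1 / ((k : ℝ) + 1) ≤ 1 := fun k => by
    rw [div_le_one (by positivity)]
    linarith [(Nat.cast_nonneg k : (0 : ℝ) ≤ k)]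
  refine ⟨C₁ + C₂, by positivity, fun X N hX hXN hN => ?_, fun X N h hh hhX hXN hN => ?_⟩
  · refine lintegral_le_of_tendsto_of_le measurableSet_Icc
      (f := fun k x => ENNReal.ofReal (smoothQuot (1 / ((k : ℝ) + 1)) x ^ 2)) (fun k => ?_)
      (fun x hx => ?_) fun k => ?_
    · have := measurable_smoothQuot (1 / ((k : ℝ) + 1))
      fun_prop
    · exact (ENNReal.continuous_ofReal.tendsto _).comp
        ((tendsto_smoothQuot (by linarith [hx.1])).pow 2)
    · refine (lintegral_mono_set (Icc_subset_Icc le_rfl (by linarith))).trans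
        ((h₁ _ X N (hη0 k) (hη1 k) hX hXN hN).trans (ENNReal.ofReal_le_ofReal ?_))
      gcongr
      linarith
  · refine lintegral_le_of_tendsto_of_le measurableSet_Icc
      (f := fun k x => ENNReal.ofReal ((smoothQuot (1 / ((k : ℝ) + 1)) (x + h) -
        smoothQuot (1 / ((k : ℝ) + 1)) x) ^ 2)) (fun k => ?_) (fun x hx => ?_) fun k => ?_
    · have := measurable_smoothQuot (1 / ((k : ℝ) + 1))
      fun_prop
    · exact (ENNReal.continuous_ofReal.tendsto _).comp
        (((tendsto_smoothQuot (by linarith [hx.1])).sub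
          (tendsto_smoothQuot (by linarith [hx.1]))).pow 2)
    · refine (h₂ _ X N h (hη0 k) (hη1 k) hh hhX hXN hN).trans (ENNReal.ofReal_le_ofReal ?_)
      have : 0 < X := by linarith
      gcongr
      linarith

lemma sum_Ico_ofReal_le_lintegral {c : ℕ → ℝ} {g : ℝ → ℝ≥0∞} {Y Z : ℕ} (hYZ : Y ≤ Z)
    (h : ∀ y : ℕ, ∀ x ∈ Ico (y : ℝ) (y + 1), Y ≤ y → ENNReal.ofReal (c y) ≤ g x) :
    ∑ y ∈ Finset.Ico Y Z, ENNReal.ofReal (c y) ≤ ∫⁻ x in Ico (Y : ℝ) Z, g x := by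
  induction Z, hYZ using Nat.le_induction with
  | base => simp
  | succ Z hYZ ih =>
    have hYZ' : (Y : ℝ) ≤ Z := by exact_mod_cast hYZ
    rw [Finset.sum_Ico_succ_top hYZ, Nat.cast_succ,
      ← Ico_union_Ico_eq_Ico hYZ' (show (Z : ℝ) ≤ Z + 1 by linarith),
      lintegral_union measurableSet_Ico (by
        rw [Set.disjoint_left]
        exact fun x hx hx' => absurd hx.2 (not_lt.2 hx'.1))]
    refine add_le_add ih ?_
    calc ENNReal.ofReal (c Z) = ∫⁻ _ in Ico (Z : ℝ) (Z + 1), ENNReal.ofReal (c Z) := by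
          rw [setLIntegral_const, Real.volume_Ico]
          simp
      _ ≤ _ := setLIntegral_mono' measurableSet_Ico fun x hx => h Z x hx hYZ

lemma sum_le_of_sum_ofReal_le {c : ℕ → ℝ} {s : Finset ℕ} {B : ℝ} (hc : ∀ y, 0 ≤ c y) (hB : 0 ≤ B)
    (h : ∑ y ∈ s, ENNReal.ofReal (c y) ≤ ENNReal.ofReal B) : ∑ y ∈ s, c y ≤ B := by
  rw [← ENNReal.ofReal_sum_of_nonneg fun y _ => hc y] at h
  exact (ENNReal.ofReal_le_ofReal_iff hB).1 h

/-- On `[y, y + 1)` one has `psiErr y = psiRem x + (x - y)`, so the square costs a factor `2` and an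
additive `2`. For an integral shift `h` the increment of `psiRem` is constant there and equals that
of `psiErr`. -/
theorem exists_sum_psiErr_le (hRH : RiemannHypothesis) : ∃ C : ℝ, 0 < C ∧ ∀ N : ℕ, 2 ≤ N →
    (∀ Y : ℕ, 1 ≤ Y → Y ≤ N → ∑ y ∈ Finset.Ico Y (2 * Y), psiErr y ^ 2 ≤
      C * Real.log N ^ 2 * (Y : ℝ) ^ 2) ∧
    ∀ h Y : ℕ, 1 ≤ h → h ≤ Y → Y ≤ N →
      ∑ y ∈ Finset.Ico Y (2 * Y), (psiErr (y + h) - psiErr y) ^ 2 ≤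
        C * Real.log N ^ 2 * h * Y := by
  obtain ⟨C, hC, h₁, h₂⟩ := exists_lintegral_psiRem_le hRH
  refine ⟨2 * C + 8, by positivity, fun N hN => ⟨fun Y hY hYN => ?_, fun h Y hh hhY hYN => ?_⟩⟩
  all_goals
    have hN' : (2 : ℝ) ≤ N := by exact_mod_cast hN
    have hYN' : (Y : ℝ) ≤ N := by exact_mod_cast hYN
    have hl := half_le_log hN'
    have hL : 1 ≤ 4 * Real.log N ^ 2 := by nlinarith
    have hsub : Ico (Y : ℝ) ((2 * Y : ℕ) : ℝ) ⊆ Icc (Y : ℝ) (2 * Y) := by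
      push_cast
      exact Ico_subset_Icc_self
  · have hY' : (1 : ℝ) ≤ Y := by exact_mod_cast hY
    refine sum_le_of_sum_ofReal_le (fun y => sq_nonneg _) (by positivity) ?_
    refine (sum_Ico_ofReal_le_lintegral (g := fun x => 2 * ENNReal.ofReal (psiRem x ^ 2) + 2)
      (by omega) fun y x hx _ => ?_).trans ?_
    · have hfl : ⌊x⌋₊ = y := by
        rw [Nat.floor_eq_iff ((Nat.cast_nonneg y).trans hx.1)]
        exact hx
      rw [show (2 : ℝ≥0∞) = ENNReal.ofReal 2 by norm_num, ← ENNReal.ofReal_mul (by norm_num),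
        ← ENNReal.ofReal_add (by positivity) (by norm_num)]
      refine ENNReal.ofReal_le_ofReal ?_
      rw [psiRem, hfl]
      have hx1 := hx.1
      have hx2 := hx.2
      nlinarith [sq_nonneg (psiErr y - 2 * (x - y))]
    · refine (lintegral_mono_set hsub).trans ?_
      rw [lintegral_add_right _ measurable_const, lintegral_const_mul' _ _ (by norm_num),
        setLIntegral_const, Real.volume_Icc]
      refine (add_le_add_left (mul_le_mul_right (h₁ Y N hY' hYN' hN') 2) _).trans ?_
      rw [show (2 : ℝ≥0∞) = ENNReal.ofReal 2 by norm_num, ← ENNReal.ofReal_mul (by norm_num),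
        ← ENNReal.ofReal_mul (by norm_num), ← ENNReal.ofReal_add (by positivity) (by linarith)]
      refine ENNReal.ofReal_le_ofReal ?_
      have : (Y : ℝ) ≤ (Y : ℝ) ^ 2 * (4 * Real.log N ^ 2) := by
        calc (Y : ℝ) ≤ (Y : ℝ) ^ 2 := by nlinarith
          _ ≤ _ := le_mul_of_one_le_right (by positivity) hL
      linarith
  · have hh' : (1 : ℝ) ≤ h := by exact_mod_cast hh
    have hhY' : (h : ℝ) ≤ Y := by exact_mod_cast hhY
    refine sum_le_of_sum_ofReal_le (fun y => sq_nonneg _) (by positivity) ?_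
    refine (sum_Ico_ofReal_le_lintegral
      (g := fun x => ENNReal.ofReal ((psiRem (x + h) - psiRem x) ^ 2))
      (by omega) fun y x hx _ => ?_).trans ?_
    · have hx0 : 0 ≤ x := (Nat.cast_nonneg y).trans hx.1
      have hfl : ⌊x⌋₊ = y := by
        rw [Nat.floor_eq_iff hx0]
        exact hx
      refine ENNReal.ofReal_le_ofReal (le_of_eq ?_)
      rw [psiRem, psiRem, Nat.floor_add_natCast hx0, hfl]
      push_cast
      ring
    · refine (lintegral_mono_set hsub).trans ((h₂ Y N h hh' hhY' hYN' hN').trans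
        (ENNReal.ofReal_le_ofReal ?_))
      have : 0 ≤ h * (Y : ℝ) * Real.log N ^ 2 := by positivity
      nlinarith

theorem exists_abs_shiftCorr_le (hRH : RiemannHypothesis) : ∃ C : ℝ, 0 < C ∧ ∀ N : ℕ, 2 ≤ N →
    |shiftCorr psiErr N 1| ≤ C * (N * Real.log N ^ 3) := by
  obtain ⟨C, hC, h⟩ := exists_sum_psiErr_le hRH
  refine ⟨240 * C, by positivity, fun N hN => ?_⟩
  obtain ⟨h1, h2⟩ := h N hN
  refine (abs_shiftCorr_one_le_log psiErr_zero hN (B := 60 * (C * Real.log N ^ 2) * N)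
    fun k hk => ?_).trans (le_of_eq (by ring))
  exact incrMoment_le_of_blocks psiErr_zero (by omega) (by positivity) h1 h2 k hk

lemma smoothPsi_natCast (N : ℕ) : smoothPsi N = psiOne N := by
  rw [smoothPsi_eq_sum (M := N + 1) (by push_cast; linarith), psiOne, Finset.range_eq_Ico,
    Finset.sum_eq_sum_Ico_succ_bot (by omega)]
  simp only [ArithmeticFunction.map_zero, zero_mul, zero_add]
  refine Finset.sum_congr rfl fun n hn => ?_
  have : (n : ℝ) ≤ N := by
    have := Finset.mem_Ico.1 hn
    exact_mod_cast Nat.lt_succ_iff.1 this.2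
  rw [max_eq_left (by linarith)]

lemma zetaZeroTerm_eq (N : ℕ) (ρ : ℂ) : zetaZeroTerm N ρ = zeroCoef ρ * (N : ℂ) ^ (ρ + 1) := by
  rw [zetaZeroTerm, zeroCoef]
  ring

lemma summable_zetaZeroTerm (hRH : RiemannHypothesis) {N : ℕ} (hN : 1 ≤ N) :
    Summable fun ρ : nontrivialZetaZeros => zetaZeroTerm N (ρ : ℂ) := by
  refine Summable.of_norm_bounded
    ((summable_norm_zeroCoef hRH).mul_right ((N : ℝ) ^ (3 / 2 : ℝ))) fun ρ => le_of_eq ?_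
  have hN0 : (0 : ℝ) < N := by exact_mod_cast hN
  rw [zetaZeroTerm_eq, norm_mul, ← ofReal_natCast, norm_cpow_eq_rpow_re_of_pos hN0, add_re,
    re_eq_half_of_mem hRH ρ.2, one_re]
  norm_num

/-- The `-1` in each `zeroPrim` adds up to the convergent constant `∑ zeroCoef ρ`. -/
lemma psiOne_add_tsum_eq (hRH : RiemannHypothesis) {N : ℕ} (hN : 1 ≤ N) :
    (psiOne N : ℂ) + ∑' ρ : nontrivialZetaZeros, zetaZeroTerm N (ρ : ℂ) =
      smoothErr N + ((N : ℂ) - 1) ^ 2 / 2 + ∑' ρ : nontrivialZetaZeros, zeroCoef ρ := by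
  have hN1 : (1 : ℝ) ≤ N := by exact_mod_cast hN
  have h1 : ∑' ρ : nontrivialZetaZeros, zeroPrim ρ N =
      ∑' ρ : nontrivialZetaZeros, zetaZeroTerm N (ρ : ℂ) -
        ∑' ρ : nontrivialZetaZeros, zeroCoef ρ := by
    rw [← (summable_zetaZeroTerm hRH hN).tsum_sub (Summable.of_norm (summable_norm_zeroCoef hRH))]
    refine tsum_congr fun ρ => ?_
    rw [zetaZeroTerm_eq, zeroPrim, max_eq_left hN1, ofReal_natCast]
    ring
  rw [smoothErr, h1, smoothPsi_natCast, max_eq_left hN1]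
  push_cast
  ring

theorem exists_norm_smoothErr_natCast_le (hRH : RiemannHypothesis) : ∃ C : ℝ, 0 < C ∧
    ∀ N : ℕ, 2 ≤ N → ‖smoothErr N‖ ≤ C * (N * Real.log N) := by
  obtain ⟨C, hC, h⟩ := exists_norm_smoothErr_le hRH
  refine ⟨6 * C, by positivity, fun N hN => ?_⟩
  have hN' : (2 : ℝ) ≤ N := by exact_mod_cast hN
  have hl := half_le_log hN'
  -- The line `δ = 1 / (2 log N)` gives `N ^ δ ≤ 3` and `1 / δ = 2 log N`.
  have hδ : 0 < 1 / (2 * Real.log N) := by positivity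
  have hδ1 : 1 / (2 * Real.log N) ≤ 1 := by
    rw [div_le_one (by positivity)]
    linarith
  have h1 : (N : ℝ) ^ (1 / (2 * Real.log N)) ≤ 3 := by
    refine le_trans ?_ (rpow_inv_log_le hN' (by linarith) le_rfl)
    refine Real.rpow_le_rpow_of_exponent_le (by linarith) ?_
    gcongr
    linarith
  refine (h _ N hδ hδ1 (by linarith)).trans ?_
  rw [Real.rpow_add (by linarith), Real.rpow_one]
  calc C / (1 / (2 * Real.log N)) * ((N : ℝ) ^ (1 / (2 * Real.log N)) * N)
      ≤ C / (1 / (2 * Real.log N)) * (3 * N) := by gcongr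
    _ = _ := by field_simp; norm_num

end GoldbachAverage

/-! ### Conclusion. -/

theorem theorem1 (hRH : RiemannHypothesis) :
    (∀ N : ℕ, 1 ≤ N → Summable (fun ρ : nontrivialZetaZeros => zetaZeroTerm N (ρ : ℂ))) ∧
    ∃ C : ℝ, ∀ N : ℕ, 2 ≤ N →
      ‖((∑ n ∈ Finset.Icc 1 N, goldbachR2 n : ℝ) : ℂ)
          - ((1 / 2 : ℂ) * (N : ℂ) ^ 2
              - 2 * ∑' ρ : nontrivialZetaZeros, zetaZeroTerm N (ρ : ℂ))‖
        ≤ C * ((N : ℝ) * Real.log (N : ℝ) ^ 3) := by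
  refine ⟨fun N hN => GoldbachAverage.summable_zetaZeroTerm hRH hN, ?_⟩
  obtain ⟨C₁, hC₁, h₁⟩ := GoldbachAverage.exists_abs_shiftCorr_le hRH
  obtain ⟨C₂, hC₂, h₂⟩ := GoldbachAverage.exists_norm_smoothErr_natCast_le hRH
  set K := ∑' ρ : nontrivialZetaZeros, GoldbachAverage.zeroCoef ρ
  refine ⟨C₁ + 8 * C₂ + 16 * ‖K‖ + 16, fun N hN => ?_⟩
  have hN' : (2 : ℝ) ≤ N := by exact_mod_cast hN
  have hl := GoldbachAverage.half_le_log hN'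
  have h3 := GoldbachAverage.psiOne_add_tsum_eq hRH (show 1 ≤ N by omega)
  -- The polynomial terms combine as `(N - 1)² - (N² - N) / 2 - N² / 2 = 1 - 3 N / 2`. Only the
  -- correlation term is bounded by `N (log N)^3`; the others are `O(N log N)`.
  have e : ((∑ n ∈ Finset.Icc 1 N, goldbachR2 n : ℝ) : ℂ) - ((1 / 2 : ℂ) * (N : ℂ) ^ 2
      - 2 * ∑' ρ : nontrivialZetaZeros, zetaZeroTerm N (ρ : ℂ)) =
      (GoldbachAverage.shiftCorr GoldbachAverage.psiErr N 1 : ℂ) +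
        2 * GoldbachAverage.smoothErr N + 2 * K + ((1 - 3 / 2 * N : ℝ) : ℂ) := by
    rw [GoldbachAverage.sum_goldbachR2]
    push_cast
    linear_combination 2 * h3
  rw [e]
  have h4 : ‖((1 - 3 / 2 * N : ℝ) : ℂ)‖ ≤ 2 * N := by
    rw [Complex.norm_real, Real.norm_eq_abs, abs_le]
    constructor <;> linarith
  have h5 : ‖(GoldbachAverage.shiftCorr GoldbachAverage.psiErr N 1 : ℂ)‖ ≤
      C₁ * (N * Real.log N ^ 3) := by
    rw [Complex.norm_real, Real.norm_eq_abs]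
    exact h₁ N hN
  have h6 := h₂ N hN
  have h7 : ‖(GoldbachAverage.shiftCorr GoldbachAverage.psiErr N 1 : ℂ) +
      2 * GoldbachAverage.smoothErr N + 2 * K + ((1 - 3 / 2 * N : ℝ) : ℂ)‖ ≤
      ‖(GoldbachAverage.shiftCorr GoldbachAverage.psiErr N 1 : ℂ)‖ +
        2 * ‖GoldbachAverage.smoothErr N‖ + 2 * ‖K‖ + ‖((1 - 3 / 2 * N : ℝ) : ℂ)‖ := by
    refine (norm_add_le _ _).trans (add_le_add_left (norm_add₃_le.trans ?_) _)
    rw [norm_mul, norm_mul, Complex.norm_ofNat]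
  set l := Real.log N
  have hsq : 1 ≤ 4 * l ^ 2 := by nlinarith
  have hcube : l ≤ 4 * l ^ 3 := by nlinarith
  have hone : 1 ≤ 8 * l ^ 3 := by linarith
  have hP : 1 ≤ 8 * (N * l ^ 3) := by
    calc (1 : ℝ) ≤ 8 * l ^ 3 * 1 := by linarith
      _ ≤ 8 * l ^ 3 * N := by gcongr; linarith
      _ = _ := by ring
  have i1 : N * l ≤ 4 * (N * l ^ 3) := by nlinarith
  have i2 : (N : ℝ) ≤ 8 * (N * l ^ 3) := by nlinarith
  have i3 : C₂ * (N * l) ≤ C₂ * (4 * (N * l ^ 3)) := by gcongr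
  have i4 : ‖K‖ ≤ ‖K‖ * (8 * (N * l ^ 3)) := le_mul_of_one_le_right (norm_nonneg _) hP
  linarith
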